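/- Let $d\ge 1$. A $\delta$-tube $R$ in $\mathbf R^d$ is the image of $[0,1]\times B_{\mathbf R^{d-1}}(0,\delta)$ (open ball) under an affine isometry from $\mathbf R\times\mathbf R^{d-1}$ onto $\mathbf R^d$, and $\overline R$ denotes the image of $[2,3]\times B_{\mathbf R^{d-1}}(0,\delta)$ under the same isometry. For $\delta>0$ let $f_d(\delta)$ be the infimum of the $\varepsilon>0$ such that there is a finite nonempty family $(R_j)$ of $\delta$-tubes in $\mathbf R^d$ with pairwise disjoint $\overline R_j$ and $\big|\bigcup_j R_j\big|\le \varepsilon\sum_j|R_j|$. For $1\le p<\infty$ let $S_p(\mathcal H)$ be the Schatten class of operators with $\|A\|_p=\mathrm{Tr}((A^*A)^{p/2})^{1/p}<\infty$, and let $S_\infty(\mathcal H)$ be the compact operators with the operator norm. For a finite measure space $(X,\mu)$ and $M\in L_\infty(X\times X,\mu\otimes\mu)$, the Schur multiplier $S_M$ maps the operator on $L_2(X,\mu)$ with kernel $a\in L_2(X\times X)$ to the operator with kernel $Ma$. Its norm $\|M\|_{MS_p(L_2(X,\mu))}$ is the least $C\in[0,\infty]$ with $\|S_M A\|_p\le C\|A\|_p$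 for all $A\in S_2\cap S_p$ (the norm of its extension to $S_p$ if it is finite). There is a constant $C_d<\infty$, depending only on $d$, with the following property. Let $1\le p\le\infty$, and let $m:(-1,1)\to\mathbf C$ be such that $(\xi,\eta)\mapsto m(\langle\xi,\eta\rangle)$ is measurable and essentially bounded on $\mathbf S^d\times\mathbf S^d$ and the Schur multiplier with this symbol is bounded on $S_p(L_2(\mathbf S^d))$ with norm $1$, where $\mathbf S^d\subset\mathbf R^{d+1}$ is the unit sphere with its surface measure. Then for almost every $(s,t)\in\mathbf R^2$, $$|m(\cos s)-m(\cos t)|\le C_d\left(\int_0^{|s-t|^{1/3}}\frac{f_d(\delta)^{|\frac1p-\frac12|}}{\delta}\,d\delta+|s-t|^{\frac19}\Big(\frac1{|\sin s|^{1/3}}+\frac1{|\sin t|^{1/3}}\Big)\right),$$ where the integral takes values in $[0,\infty]$. -/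

import Mathlib

open MeasureTheory Set
open scoped ENNReal NNReal

noncomputable section

/-! ### Tubes and the Kakeya-type function -/

/-- The model space `ℝ × ℝ^(d-1)` with its Euclidean norm. -/
abbrev TubeModel (d : ℕ) : Type :=
  WithLp 2 (ℝ × EuclideanSpace ℝ (Fin (d - 1)))

/-- The cylinder `[a, b] × B(0, δ)` in `ℝ × ℝ^(d-1)`. -/
def cylinder (d : ℕ) (a b δ : ℝ) : Set (TubeModel d) :=
  {x | x.fst ∈ Icc a b ∧ ‖x.snd‖ < δ}

/-- An oriented `δ`-tube in `ℝ^d` is given by an affine isometry `T` from `ℝ × ℝ^(d-1)` onto `ℝ^d`.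
Its underlying set is the image of `[0, 1] × B(0, δ)`. -/
def tube {d : ℕ} (δ : ℝ) (T : TubeModel d ≃ᵃⁱ[ℝ] EuclideanSpace ℝ (Fin d)) :
    Set (EuclideanSpace ℝ (Fin d)) :=
  T '' cylinder d 0 1 δ

/-- The shifted tube, the image of `[2, 3] × B(0, δ)` under the same affine isometry. -/
def shiftedTube {d : ℕ} (δ : ℝ) (T : TubeModel d ≃ᵃⁱ[ℝ] EuclideanSpace ℝ (Fin d)) :
    Set (EuclideanSpace ℝ (Fin d)) :=
  T '' cylinder d 2 3 δ

/-- `kakeyaFun d δ` is the infimum of the `ε > 0` for which there is a finite nonempty family of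
`δ`-tubes in `ℝ^d` whose shifted tubes are pairwise disjoint, but such that
`|⋃ R_j| / ∑ |R_j| ≤ ε`. -/
def kakeyaFun (d : ℕ) (δ : ℝ) : ℝ :=
  sInf {ε : ℝ | 0 < ε ∧ ∃ N : ℕ, 0 < N ∧
    ∃ T : Fin N → (TubeModel d ≃ᵃⁱ[ℝ] EuclideanSpace ℝ (Fin d)),
      Pairwise (fun i j => Disjoint (shiftedTube δ (T i)) (shiftedTube δ (T j))) ∧
      volume.real (⋃ j, tube δ (T j)) / ∑ j, volume.real (tube δ (T j)) ≤ ε}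

/-! ### Schatten classes -/

section Schatten

set_option linter.unusedSectionVars false

variable {H : Type*} [NormedAddCommGroup H] [InnerProductSpace ℂ H] [CompleteSpace H]

/-- The trace, in `[0, ∞]`, of a positive operator: the sum of its diagonal coefficients in
a Hilbert basis (it does not depend on the basis, see `posTrace_eq_tsum`). -/
def posTrace (A : H →L[ℂ] H) : ℝ≥0∞ :=
  ∑' i, ENNReal.ofReal
    (RCLike.re (inner ℂ ((exists_hilbertBasis ℂ H).choose_spec.choose i)
      (A ((exists_hilbertBasis ℂ H).choose_spec.choose i))))

theorem tsum_ofReal_norm_inner_sq {ι : Type*} (b : HilbertBasis ι ℂ H) (x : H) :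
    ∑' i, ENNReal.ofReal (‖inner ℂ (b i) x‖ ^ 2) = ENNReal.ofReal (‖x‖ ^ 2) := by
  have h := (b.hasSum_inner_mul_inner x x).mapL (RCLike.reCLM (K := ℂ))
  have h2 : HasSum (fun i => ‖inner ℂ (b i) x‖ ^ 2) (‖x‖ ^ 2) := by
    have e1 : ∀ i, RCLike.re (inner ℂ x (b i) * inner ℂ (b i) x) = ‖inner ℂ (b i) x‖ ^ 2 := by
      intro i
      rw [← inner_conj_symm x (b i), RCLike.conj_mul]
      norm_cast
    simp only [RCLike.reCLM_apply, e1, inner_self_eq_norm_sq] at h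
    exact h
  rw [← h2.tsum_eq, ENNReal.ofReal_tsum_of_nonneg (fun i => by positivity) h2.summable]

theorem tsum_norm_sq_eq_adjoint {ι κ : Type*} (b : HilbertBasis ι ℂ H) (c : HilbertBasis κ ℂ H)
    (S : H →L[ℂ] H) :
    ∑' i, ENNReal.ofReal (‖S (b i)‖ ^ 2) = ∑' j, ENNReal.ofReal (‖S.adjoint (c j)‖ ^ 2) := by
  simp_rw [← tsum_ofReal_norm_inner_sq c (S _), ← tsum_ofReal_norm_inner_sq b (S.adjoint _)]
  rw [ENNReal.tsum_comm]
  refine tsum_congr fun j => tsum_congr fun i => ?_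
  rw [ContinuousLinearMap.adjoint_inner_right, norm_inner_symm]

/-- The trace of a positive operator can be computed in any Hilbert basis. -/
theorem posTrace_eq_tsum {ι : Type*} (b : HilbertBasis ι ℂ H) (A : H →L[ℂ] H)
    (hA : A.IsPositive) :
    posTrace A = ∑' i, ENNReal.ofReal (RCLike.re (inner ℂ (b i) (A (b i)))) := by
  rw [← ContinuousLinearMap.nonneg_iff_isPositive, CStarAlgebra.nonneg_iff_eq_star_mul_self] at hA
  obtain ⟨S, rfl⟩ := hA
  have key : ∀ x : H, RCLike.re (inner ℂ x ((star S * S) x)) = ‖S x‖ ^ 2 := fun x =>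
    (S.apply_norm_sq_eq_inner_adjoint_right x).symm
  simp_rw [posTrace, key]
  rw [tsum_norm_sq_eq_adjoint _ b, tsum_norm_sq_eq_adjoint b b S]

/-- The Schatten norm `‖A‖_p ∈ [0, ∞]`: it is `Tr((A* A)^(p/2))^(1/p)` if `p < ∞`, and the
operator norm if `p = ∞`. The power `(A* A)^(p/2)` is taken in the continuous functional
calculus. -/
def schattenNorm (p : ℝ≥0∞) (A : H →L[ℂ] H) : ℝ≥0∞ :=
  if p = ∞ then ‖A‖ₑ
  else posTrace (cfc (fun x : ℝ => x ^ (p.toReal / 2)) (A.adjoint * A)) ^ (1 / p.toReal)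

/-- Membership in the Schatten class `S_p`; `S_∞` is the space of compact operators. -/
def MemSchatten (p : ℝ≥0∞) (A : H →L[ℂ] H) : Prop :=
  if p = ∞ then IsCompactOperator A else schattenNorm p A < ∞

end Schatten

/-! ### Schur multipliers -/

section Schur

variable {X : Type*} [MeasurableSpace X]

/-- `A` is the operator on `L²(X, μ)` with kernel `a ∈ L²(X × X, μ ⊗ μ)`, that is
`A f (x) = ∫ a(x, y) f(y) dμ(y)`. These operators are the elements of `S_2(L²(X, μ))`. -/
def HasKernel (μ : Measure X) (A : Lp ℂ 2 μ →L[ℂ] Lp ℂ 2 μ) (a : X × X → ℂ) : Prop :=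
  MemLp a 2 (μ.prod μ) ∧ ∀ f : Lp ℂ 2 μ, A f =ᵐ[μ] fun x => ∫ y, a (x, y) * f y ∂μ

/-- `B = S_M(A)`, where `S_M : S_2 → S_2` is the Schur multiplier with symbol `M`: the operator `A`
has a kernel `a ∈ L²`, and `B` has kernel `M a`. -/
def IsSchurImage (μ : Measure X) (M : X × X → ℂ) (A B : Lp ℂ 2 μ →L[ℂ] Lp ℂ 2 μ) : Prop :=
  ∃ a : X × X → ℂ, HasKernel μ A a ∧ HasKernel μ B (fun z => M z * a z)

/-- The norm `‖M‖_{MS_p(L²(X, μ))} ∈ [0, ∞]` of the Schur multiplier with symbol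
`M ∈ L^∞(X × X, μ ⊗ μ)`: the least constant `C` such that `S_M` maps `S_2 ∩ S_p` to `S_p` with
`‖S_M A‖_p ≤ C ‖A‖_p`. As `S_2 ∩ S_p` is dense in `S_p`, it is finite exactly if `S_M` extends
to a bounded operator on `S_p`, and it is then the norm of the extension. -/
def schurNorm (p : ℝ≥0∞) (μ : Measure X) (M : X × X → ℂ) : ℝ≥0∞ :=
  sInf {C : ℝ≥0∞ | ∀ A B : Lp ℂ 2 μ →L[ℂ] Lp ℂ 2 μ, IsSchurImage μ M A B → MemSchatten p A →
    schattenNorm p B ≤ C * schattenNorm p A}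

end Schur

/-! ### Zonal symbols on the sphere -/

/-- The unit sphere `S^d` of `ℝ^(d+1)`. -/
abbrev UnitSphere (d : ℕ) : Type :=
  Metric.sphere (0 : EuclideanSpace ℝ (Fin (d + 1))) 1

/-- The rotation invariant surface measure on `S^d`. -/
def sphereMeasure (d : ℕ) : Measure (UnitSphere d) :=
  (volume : Measure (EuclideanSpace ℝ (Fin (d + 1)))).toSphere

/-- The zonal symbol `(ξ, η) ↦ m(⟨ξ, η⟩)`. For `d ≥ 1`, only the values of `m` on `(-1, 1)`
matter, since `⟨ξ, η⟩ = ±1` only on a null set. -/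
def zonalSymbol (d : ℕ) (m : ℝ → ℂ) : UnitSphere d × UnitSphere d → ℂ :=
  fun z => m (inner ℝ (z.1 : EuclideanSpace ℝ (Fin (d + 1))) (z.2 : EuclideanSpace ℝ (Fin (d + 1))))

end

/-! The proof is a quantitative version, at every scale, of Fefferman's argument against the ball
multiplier, carried out on the sphere. Fix an angle θ and a small ρ. For a unit vector u and a
vector ξ in ℝ^d, the points (cos(θ+ρX), sin(θ+ρX) u) and (√(1-ρ²|ξ|²), ρξ) of S^d are at an angle
close to θ+ρ(X-⟨u,ξ⟩). On such points a zonal symbol therefore looks like a family of directional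
Fourier multipliers, one for each u, with the common profile x ↦ φ(θ+ρx).

Let u run through the directions of δ-tubes R_j whose shifts are disjoint while their union is
small. Two kinds of wave packets are attached to the tubes: packets on blocks of the shifted tubes,
whose disjointness makes their coefficient matrix bounded on ℓ² independently of the number of
tubes, and packets on blocks of the tubes themselves, which live on a set of small measure. The
product of their Fourier coefficients at ξ is a positive weight times `blockKernel` at X-⟨u,ξ⟩
(`tubeCoeff_mul_conj`). The Schatten inequality `TestData.norm_sum_le`, valid for every contractive
Schur multiplier, then bounds the average of φ(θ+ρ·) against `blockKernel` by a constant times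
f_d(δ)^|1/p-1/2| (`TubeFamily.norm_sum_le_of_isTestedSymbol`). Replacing the true angle by the
affine one costs δ+|ρ|/(δ² sin θ) (`exists_angle_comparison`,
`exists_norm_integral_blockKernel_le`).

The frequencies a-b reached by the two kinds of blocks fill an annulus away from 0. The difference
of the means of φ at the scales 2ρ/3 and ρ, for a kernel whose Fourier transform is a trapezoid, is
exactly a combination of such averages (`annularKernel_dilation`). Telescoping over scales, with a
tube width that also decreases geometrically, compares φ with its mean at scale R; each term holds
for all δ in a window, so the sum becomes the integral of f_d(δ)^α/δ
(`ofReal_norm_sub_dilateMean_le`). Means at scale R are Lipschitz in the angle, and a choice of R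
and of the largest width gives the modulus of continuity (`exists_ofReal_norm_sub_le`).

Since m is only measurable, all this is applied to continuous φ_n, the means of the symbol over
products of small balls. They inherit the tested inequalities by random sampling
(`TestData.norm_sum_closedBall_le`) and converge almost everywhere to m∘cos
(`exists_isTestedSymbol_tendsto`). -/

noncomputable section

/-! ### Quadratic forms and Jensen's inequality in the functional calculus. -/

section Schatten

set_option linter.unusedSectionVars false

variable {H : Type*} [NormedAddCommGroup H] [InnerProductSpace ℂ H] [CompleteSpace H]

/-- The quadratic form of an operator. -/
def quadForm (T : H →L[ℂ] H) (x : H) : ℝ := RCLike.re (inner ℂ x (T x))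

theorem quadForm_mono {S T : H →L[ℂ] H} (h : S ≤ T) (x : H) : quadForm S x ≤ quadForm T x := by
  rw [ContinuousLinearMap.le_def] at h
  have := h.re_inner_nonneg_right x
  simp only [sub_apply, inner_sub_right, map_sub] at this
  unfold quadForm
  linarith

theorem quadForm_nonneg {T : H →L[ℂ] H} (h : 0 ≤ T) (x : H) : 0 ≤ quadForm T x := by
  have := quadForm_mono h x
  simpa [quadForm] using this

theorem quadForm_add (S T : H →L[ℂ] H) (x : H) :
    quadForm (S + T) x = quadForm S x + quadForm T x := by
  simp [quadForm]

theorem quadForm_smul (c : ℝ) (T : H →L[ℂ] H) (x : H) :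
    quadForm (c • T) x = c * quadForm T x := by
  simp [quadForm, inner_smul_right_eq_smul]

theorem quadForm_one (x : H) : quadForm (1 : H →L[ℂ] H) x = ‖x‖ ^ 2 := by
  simp only [quadForm, ContinuousLinearMap.one_apply]
  exact inner_self_eq_norm_sq (𝕜 := ℂ) x

theorem quadForm_star_mul_self (S : H →L[ℂ] H) (x : H) :
    quadForm (star S * S) x = ‖S x‖ ^ 2 :=
  (S.apply_norm_sq_eq_inner_adjoint_right x).symm

theorem spectrum_nonneg {T : H →L[ℂ] H} (hT : 0 ≤ T) {t : ℝ} (ht : t ∈ spectrum ℝ T) : 0 ≤ t :=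
  spectrum_nonneg_of_nonneg hT ht

/-- Jensen's inequality for the spectral measure of `T` at `x`, obtained without that measure: `u ^
s` lies above its tangent at the mean value `a` of `f`, this passes to operators by monotonicity of
the functional calculus, and the tangent is exact when tested on `x`. -/
theorem quadForm_cfc_jensen {T : H →L[ℂ] H} (hT : 0 ≤ T) {f : ℝ → ℝ}
    (hf : ContinuousOn f (spectrum ℝ T)) (hf0 : ∀ t ∈ spectrum ℝ T, 0 ≤ f t) {s : ℝ} (hs : 1 ≤ s)
    (x : H) :
    quadForm (cfc f T) x ^ s ≤ ‖x‖ ^ (2 * (s - 1)) * quadForm (cfc (fun t => f t ^ s) T) x := by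
  have hsa : IsSelfAdjoint T := IsSelfAdjoint.of_nonneg hT
  have hfs : ContinuousOn (fun t => f t ^ s) (spectrum ℝ T) :=
    hf.rpow_const fun _ _ => Or.inr (by linarith)
  have hpos : 0 ≤ cfc f T := cfc_nonneg hf0
  have hpos' : 0 ≤ cfc (fun t => f t ^ s) T :=
    cfc_nonneg fun t ht => Real.rpow_nonneg (hf0 t ht) _
  rcases eq_or_lt_of_le (quadForm_nonneg hpos x) with h0 | h0
  · rw [← h0, Real.zero_rpow (by linarith)]
    exact mul_nonneg (by positivity) (quadForm_nonneg hpos' x)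
  have hx : 0 < ‖x‖ := by
    rcases eq_or_ne x 0 with rfl | h
    · simp [quadForm] at h0
    · exact norm_pos_iff.2 h
  set Q := quadForm (cfc f T) x with hQ
  set a := Q / ‖x‖ ^ 2 with ha
  have ha0 : 0 < a := by positivity
  have key : cfc (fun t => (s * a ^ (s - 1)) * f t + (-(s - 1) * a ^ s) * 1) T
      ≤ cfc (fun t => f t ^ s) T := by
    refine cfc_mono (fun t ht => ?_) (by fun_prop) hfs
    have hu := hf0 t ht
    have h1 := one_add_mul_self_le_rpow_one_add (s := f t / a - 1)
      (by have : 0 ≤ f t / a := by positivity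
          linarith) hs
    have h2 : (1 + (f t / a - 1)) ^ s = f t ^ s / a ^ s := by
      rw [show 1 + (f t / a - 1) = f t / a by ring, Real.div_rpow hu ha0.le]
    have has : 0 < a ^ s := by positivity
    rw [h2, le_div_iff₀ has] at h1
    have h3 : a ^ s = a ^ (s - 1) * a := by
      rw [← Real.rpow_add_one ha0.ne']; ring_nf
    have h4 : (1 + s * (f t / a - 1)) * a ^ s
        = s * a ^ (s - 1) * f t + -(s - 1) * a ^ s * 1 := by
      rw [h3]; field_simp; ring
    linarith
  rw [cfc_add (a := T) (hf := by fun_prop) (hg := by fun_prop), cfc_const_mul _ _ _ hf,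
    cfc_const_mul _ _ _ (by fun_prop), cfc_const_one ℝ T] at key
  have key2 := quadForm_mono key x
  rw [quadForm_add, quadForm_smul, quadForm_smul, quadForm_one, ← hQ] at key2
  have hQa : Q = a * ‖x‖ ^ 2 := by rw [ha]; field_simp
  have h3 : a ^ s = a ^ (s - 1) * a := by
    rw [← Real.rpow_add_one ha0.ne']; ring_nf
  have h5 : a ^ s * ‖x‖ ^ 2 ≤ quadForm (cfc (fun t => f t ^ s) T) x := by
    refine le_trans (le_of_eq ?_) key2
    rw [hQa, h3]; ring
  calc Q ^ s = ‖x‖ ^ (2 * (s - 1)) * (a ^ s * ‖x‖ ^ 2) := by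
        rw [hQa, Real.mul_rpow ha0.le (by positivity), ← Real.rpow_natCast ‖x‖ 2,
          ← Real.rpow_mul hx.le]
        rw [mul_left_comm, ← Real.rpow_add hx]
        congr 2; push_cast; ring
    _ ≤ _ := by gcongr

end Schatten

/-! ### Traces, Hilbert–Schmidt norms and finite rank operators. -/

section Schatten
set_option linter.unusedSectionVars false
variable {H : Type*} [NormedAddCommGroup H] [InnerProductSpace ℂ H] [CompleteSpace H]

theorem posTrace_eq_tsum_quadForm {ι : Type*} (b : HilbertBasis ι ℂ H) {T : H →L[ℂ] H}
    (hT : 0 ≤ T) : posTrace T = ∑' i, ENNReal.ofReal (quadForm T (b i)) :=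
  posTrace_eq_tsum b T ((ContinuousLinearMap.nonneg_iff_isPositive T).1 hT)

theorem posTrace_star_mul_self {ι : Type*} (b : HilbertBasis ι ℂ H) (S : H →L[ℂ] H) :
    posTrace (star S * S) = ∑' i, ENNReal.ofReal (‖S (b i)‖ ^ 2) := by
  rw [posTrace_eq_tsum_quadForm b (star_mul_self_nonneg S)]
  simp_rw [quadForm_star_mul_self]

theorem posTrace_mul_star_self (S : H →L[ℂ] H) :
    posTrace (S * star S) = posTrace (star S * S) := by
  obtain ⟨w, b, -⟩ := exists_hilbertBasis ℂ H
  have h := posTrace_star_mul_self b (star S)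
  rw [star_star] at h
  rw [h, posTrace_star_mul_self b S, tsum_norm_sq_eq_adjoint b b S]
  rfl

theorem posTrace_mono {S T : H →L[ℂ] H} (hS : 0 ≤ S) (h : S ≤ T) : posTrace S ≤ posTrace T := by
  obtain ⟨w, b, -⟩ := exists_hilbertBasis ℂ H
  rw [posTrace_eq_tsum_quadForm b hS, posTrace_eq_tsum_quadForm b (hS.trans h)]
  exact ENNReal.tsum_le_tsum fun i => ENNReal.ofReal_le_ofReal (quadForm_mono h _)

theorem posTrace_smul {c : ℝ} (hc : 0 ≤ c) {T : H →L[ℂ] H} (hT : 0 ≤ T) :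
    posTrace (c • T) = ENNReal.ofReal c * posTrace T := by
  obtain ⟨w, b, -⟩ := exists_hilbertBasis ℂ H
  rw [posTrace_eq_tsum_quadForm b (smul_nonneg hc hT), posTrace_eq_tsum_quadForm b hT,
    ← ENNReal.tsum_mul_left]
  simp_rw [quadForm_smul, ENNReal.ofReal_mul hc]

/-- Conjugating the square of the Hilbert-Schmidt norm by a bounded operator. -/
theorem posTrace_comp_le (A D : H →L[ℂ] H) :
    posTrace (star (A * D) * (A * D)) ≤ ENNReal.ofReal (‖A‖ ^ 2) * posTrace (star D * D) := by
  obtain ⟨w, b, -⟩ := exists_hilbertBasis ℂ H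
  rw [posTrace_star_mul_self b, posTrace_star_mul_self b, ← ENNReal.tsum_mul_left]
  refine ENNReal.tsum_le_tsum fun i => ?_
  rw [← ENNReal.ofReal_mul (by positivity), ← mul_pow]
  exact ENNReal.ofReal_le_ofReal (pow_le_pow_left₀ (norm_nonneg _) (A.le_opNorm _) 2)

theorem sum_norm_sq_le_posTrace {K : Type*} [Fintype K] {e : K → H} (he : Orthonormal ℂ e)
    (Z : H →L[ℂ] H) :
    ENNReal.ofReal (∑ k, ‖Z (e k)‖ ^ 2) ≤ posTrace (star Z * Z) := by
  obtain ⟨w, b, -⟩ := exists_hilbertBasis ℂ H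
  rw [ENNReal.ofReal_sum_of_nonneg (fun _ _ => by positivity), posTrace_star_mul_self b,
    tsum_norm_sq_eq_adjoint b b Z]
  simp_rw [← tsum_ofReal_norm_inner_sq b (Z _)]
  rw [← tsum_fintype (L := .unconditional _), ENNReal.tsum_comm]
  refine ENNReal.tsum_le_tsum fun i => ?_
  rw [tsum_fintype, ← ENNReal.ofReal_sum_of_nonneg (fun _ _ => by positivity)]
  refine ENNReal.ofReal_le_ofReal ?_
  refine le_trans (Finset.sum_le_sum fun k _ => ?_)
    (he.sum_inner_products_le (Z.adjoint (b i)) (s := Finset.univ))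
  rw [ContinuousLinearMap.adjoint_inner_right, norm_inner_symm]

/-- A finite rank operator, with given matrix coefficients. -/
def finOp {I : Type*} [Fintype I] (e r : I → H) : H →L[ℂ] H :=
  ∑ i, InnerProductSpace.rankOne ℂ (e i) (r i)

theorem finOp_apply {I : Type*} [Fintype I] (e r : I → H) (x : H) :
    finOp e r x = ∑ i, inner ℂ (r i) x • e i := by
  simp [finOp]

theorem norm_sum_smul_sq {I : Type*} [Fintype I] {e : I → H} (he : Orthonormal ℂ e) (c : I → ℂ) :
    ‖∑ i, c i • e i‖ ^ 2 = ∑ i, ‖c i‖ ^ 2 := by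
  have h := he.inner_sum c c Finset.univ
  have h2 := inner_self_eq_norm_sq_to_K (𝕜 := ℂ) (∑ i, c i • e i)
  rw [h] at h2
  simp_rw [RCLike.conj_mul] at h2
  exact_mod_cast h2.symm

theorem posTrace_finOp {I : Type*} [Fintype I] {e : I → H} (he : Orthonormal ℂ e) (r : I → H) :
    posTrace (star (finOp e r) * finOp e r) = ENNReal.ofReal (∑ i, ‖r i‖ ^ 2) := by
  obtain ⟨w, b, -⟩ := exists_hilbertBasis ℂ H
  rw [posTrace_star_mul_self b, ENNReal.ofReal_sum_of_nonneg (fun _ _ => by positivity)]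
  simp_rw [finOp_apply, norm_sum_smul_sq he, ← tsum_ofReal_norm_inner_sq b (r _)]
  rw [← tsum_fintype (L := .unconditional _), ENNReal.tsum_comm]
  refine tsum_congr fun i => ?_
  rw [tsum_fintype, ENNReal.ofReal_sum_of_nonneg (fun _ _ => by positivity)]
  exact Finset.sum_congr rfl fun j _ => by rw [norm_inner_symm]

/-- The Bessel inequality says that the integral of the rank one operators `g ⊗ g` is at most `γ`;
the lemma is the trace of this inequality against `P = S* S`. As `g` stays in a finite dimensional
space, `S g` has finitely many coordinates and sum and integral can be exchanged. -/
theorem lintegral_quadForm_le {W : Type*} [MeasurableSpace W] {ν : Measure W} {g : W → H}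
    (hg : AEStronglyMeasurable g ν) (F : Submodule ℂ H) [FiniteDimensional ℂ F]
    (hgF : ∀ w, g w ∈ F) {γ : ℝ≥0∞}
    (hγ : ∀ f : H, ∫⁻ w, ENNReal.ofReal (‖inner ℂ (g w) f‖ ^ 2) ∂ν ≤ γ * ENNReal.ofReal (‖f‖ ^ 2))
    {P : H →L[ℂ] H} (hP : 0 ≤ P) :
    ∫⁻ w, ENNReal.ofReal (quadForm P (g w)) ∂ν ≤ γ * posTrace P := by
  rw [CStarAlgebra.nonneg_iff_eq_star_mul_self] at hP
  obtain ⟨S, rfl⟩ := hP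
  let F' : Submodule ℂ H := F.map S.toLinearMap
  let b := stdOrthonormalBasis ℂ F'
  have hexp : ∀ w, ‖S (g w)‖ ^ 2 = ∑ i, ‖inner ℂ (g w) (S.adjoint (b i : H))‖ ^ 2 := by
    intro w
    have h := b.sum_sq_norm_inner_right (⟨S (g w), Submodule.mem_map_of_mem (hgF w)⟩ : F')
    rw [Submodule.coe_norm] at h
    rw [← h]
    refine Finset.sum_congr rfl fun i _ => ?_
    rw [ContinuousLinearMap.adjoint_inner_right, ← norm_inner_symm, Submodule.coe_inner]
  have hb : Orthonormal ℂ (fun i => (b i : H)) := by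
    have := b.orthonormal
    exact this.comp_linearIsometry F'.subtypeₗᵢ
  calc ∫⁻ w, ENNReal.ofReal (quadForm (star S * S) (g w)) ∂ν
      = ∫⁻ w, ∑ i, ENNReal.ofReal (‖inner ℂ (g w) (S.adjoint (b i : H))‖ ^ 2) ∂ν := by
        refine lintegral_congr fun w => ?_
        rw [quadForm_star_mul_self, hexp, ENNReal.ofReal_sum_of_nonneg (fun _ _ => by positivity)]
    _ = ∑ i, ∫⁻ w, ENNReal.ofReal (‖inner ℂ (g w) (S.adjoint (b i : H))‖ ^ 2) ∂ν := by
        refine lintegral_finsetSum' _ fun i _ => ?_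
        have : AEStronglyMeasurable (fun w => inner ℂ (g w) (S.adjoint (b i : H))) ν :=
          hg.inner aestronglyMeasurable_const
        exact (this.norm.aemeasurable.pow_const 2).ennreal_ofReal
    _ ≤ ∑ i, γ * ENNReal.ofReal (‖S.adjoint (b i : H)‖ ^ 2) := Finset.sum_le_sum fun i _ => hγ _
    _ = γ * ENNReal.ofReal (∑ i, ‖star S (b i : H)‖ ^ 2) := by
        rw [← Finset.mul_sum, ENNReal.ofReal_sum_of_nonneg (fun _ _ => by positivity)]
        rfl
    _ ≤ γ * posTrace (star S * S) := by
        gcongr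
        refine (sum_norm_sq_le_posTrace hb (star S)).trans ?_
        rw [star_star, posTrace_mul_star_self]

/-- If `q` is the minimal polynomial of `T` on its range, then `q X` annihilates `T`. On a finite
spectrum every function is continuous, so negative powers are admitted in the continuous functional
calculus. -/
theorem spectrum_finite_of_finiteDimensional_range (T : H →L[ℂ] H)
    [FiniteDimensional ℂ (LinearMap.range T.toLinearMap)] : (spectrum ℝ T).Finite := by
  set R := LinearMap.range T.toLinearMap
  let T' : R →ₗ[ℂ] R := T.toLinearMap.restrict (p := R) (q := R) fun x _ => ⟨x, rfl⟩
  have h1 : ∀ (p : Polynomial ℂ) (y : R),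
      Polynomial.aeval T p (y : H) = (Polynomial.aeval T' p y : R) := by
    intro p
    induction p using Polynomial.induction_on' with
    | add p q hp hq => intro y; simp [hp y, hq y]
    | monomial n a =>
      intro y
      have : ∀ (n : ℕ), (T ^ n) (y : H) = ((T' ^ n) y : R) := by
        intro n
        induction n with
        | zero => simp
        | succ n ih =>
          rw [pow_succ', pow_succ']
          change T ((T ^ n) y) = (T' ((T' ^ n) y) : R)
          rw [ih]; rfl
      simp [Polynomial.aeval_monomial, this n,
        Algebra.algebraMap_eq_smul_one]
  have h2 : Polynomial.aeval T (minpoly ℂ T' * Polynomial.X) = 0 := by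
    ext x
    have := h1 (minpoly ℂ T') ⟨T x, ⟨x, rfl⟩⟩
    rw [minpoly.aeval] at this
    simpa using this
  have h3 : (spectrum ℂ T).Finite := by
    have hne : minpoly ℂ T' * Polynomial.X ≠ 0 :=
      mul_ne_zero (minpoly.ne_zero (Algebra.IsIntegral.isIntegral T')) Polynomial.X_ne_zero
    refine Set.Finite.subset (Polynomial.finite_setOfPred_isRoot hne) fun z hz => ?_
    have h4 := spectrum.subset_polynomial_aeval T (minpoly ℂ T' * Polynomial.X)
      (Set.mem_image_of_mem _ hz)
    rw [h2] at h4
    by_contra hcon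
    cases subsingleton_or_nontrivial (H →L[ℂ] H) with
    | inl h => simp [spectrum.of_subsingleton] at hz
    | inr h =>
      rw [spectrum.zero_eq] at h4
      exact hcon h4
  have h5 := spectrum.preimage_algebraMap ℂ (R := ℝ) (a := T)
  rw [← h5]
  exact h3.preimage (RCLike.ofReal_injective (K := ℂ)).injOn

end Schatten

/-! ### Schatten norms for p < 2: duality by cutting singular values. -/

section Schatten
set_option linter.unusedSectionVars false
variable {H : Type*} [NormedAddCommGroup H] [InnerProductSpace ℂ H] [CompleteSpace H]

/-- The trace of `|A|^(2r)`. -/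
def absTrace (r : ℝ) (A : H →L[ℂ] H) : ℝ≥0∞ :=
  posTrace (cfc (fun x : ℝ => x ^ r) (star A * A))

theorem schattenNorm_eq_absTrace {p : ℝ≥0∞} (hp : p ≠ ∞) (A : H →L[ℂ] H) :
    schattenNorm p A = absTrace (p.toReal / 2) A ^ (1 / p.toReal) := by
  rw [schattenNorm, if_neg hp]; rfl

theorem absTrace_le_of_one_le {r : ℝ} (hr : 1 ≤ r) (A : H →L[ℂ] H) :
    absTrace r A ≤ ENNReal.ofReal ((‖A‖ ^ 2) ^ (r - 1)) * posTrace (star A * A) := by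
  have hT : 0 ≤ star A * A := star_mul_self_nonneg A
  have hsa := IsSelfAdjoint.of_nonneg hT
  rw [← posTrace_smul (by positivity) hT]
  refine posTrace_mono (cfc_nonneg fun t ht => Real.rpow_nonneg (spectrum_nonneg hT ht) _) ?_
  calc cfc (fun x : ℝ => x ^ r) (star A * A)
      ≤ cfc (fun x : ℝ => (‖A‖ ^ 2) ^ (r - 1) * x) (star A * A) := by
        refine cfc_mono (fun t ht => ?_) ?_ (by fun_prop)
        · have ht0 := spectrum_nonneg hT ht
          have ht1 : t ≤ ‖A‖ ^ 2 := by
            cases subsingleton_or_nontrivial H with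
            | inl h =>
              have : Subsingleton (H →L[ℂ] H) := ⟨fun a b => by ext x; exact Subsingleton.elim _ _⟩
              simp [spectrum.of_subsingleton] at ht
            | inr h =>
            have := spectrum.norm_le_norm_of_mem ht
            rw [CStarRing.norm_star_mul_self, ← sq, Real.norm_of_nonneg ht0] at this
            exact this
          rcases eq_or_lt_of_le ht0 with rfl | h0
          · rw [Real.zero_rpow (by linarith)]; simp
          · calc t ^ r = t ^ (r - 1) * t := by rw [← Real.rpow_add_one h0.ne']; ring_nf
              _ ≤ _ := by gcongr
        · exact continuousOn_id.rpow_const fun _ _ => Or.inr (by linarith)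
    _ = (‖A‖ ^ 2) ^ (r - 1) • (star A * A) := by
        rw [cfc_const_mul _ _ _ (by fun_prop), cfc_id' ℝ (star A * A)]

theorem re_sum_inner_le {K : Type*} [Fintype K] {e : K → H} (he : Orthonormal ℂ e)
    (Y Z : H →L[ℂ] H) {y z : ℝ} (hy : 0 ≤ y) (hz : 0 ≤ z)
    (hY : posTrace (star Y * Y) ≤ ENNReal.ofReal y)
    (hZ : posTrace (star Z * Z) ≤ ENNReal.ofReal z) :
    ‖∑ k, inner ℂ (Y (e k)) (Z (e k))‖ ≤ Real.sqrt y * Real.sqrt z := by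
  have h1 : ∑ k, ‖Y (e k)‖ ^ 2 ≤ y :=
    (ENNReal.ofReal_le_ofReal_iff hy).1 ((sum_norm_sq_le_posTrace he Y).trans hY)
  have h2 : ∑ k, ‖Z (e k)‖ ^ 2 ≤ z :=
    (ENNReal.ofReal_le_ofReal_iff hz).1 ((sum_norm_sq_le_posTrace he Z).trans hZ)
  calc ‖∑ k, inner ℂ (Y (e k)) (Z (e k))‖ ≤ ∑ k, ‖Y (e k)‖ * ‖Z (e k)‖ :=
        (norm_sum_le _ _).trans (Finset.sum_le_sum fun k _ => norm_inner_le_norm _ _)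
    _ ≤ Real.sqrt (∑ k, ‖Y (e k)‖ ^ 2) * Real.sqrt (∑ k, ‖Z (e k)‖ ^ 2) :=
        Real.sum_mul_le_sqrt_mul_sqrt _ _ _
    _ ≤ _ := by gcongr

theorem star_mul_cfc_mul_cfc {D : H →L[ℂ] H} {f : ℝ → ℝ}
    (hf : ContinuousOn f (spectrum ℝ (star D * D))) :
    star (D * cfc f (star D * D)) * (D * cfc f (star D * D))
      = cfc (fun x => x * f x ^ 2) (star D * D) := by
  have hsa : IsSelfAdjoint (star D * D) := IsSelfAdjoint.star_mul_self D
  have h1 : IsSelfAdjoint (cfc f (star D * D)) := cfc_predicate f _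
  rw [star_mul, h1.star_eq, mul_assoc, ← mul_assoc (star D) D]
  have h2 : cfc (fun x => x * f x ^ 2) (star D * D)
      = cfc (fun x => f x * (x * f x)) (star D * D) := by congr 1; ext x; ring
  rw [h2, cfc_mul (fun x => f x) (fun x => x * f x) _ hf (by fun_prop),
    cfc_mul (fun x => x) f _ (by fun_prop) hf, cfc_id' ℝ (star D * D)]

/-- Real interpolation of `S_p` between `S_1` and `S_2`: singular values `σ` are cut at height
`lam`. The operator `Z` keeps `min σ lam` and is estimated in `S_2`; the remainder has singular
values `(σ - lam)₊` and is of trace class, which is expressed by writing it as a product `U V` of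
two Hilbert–Schmidt operators. The bounds are `(σ - λ)₊ ≤ λ^(1-p) σ^p` and `min(σ, λ)² ≤ λ^(2-p)
σ^p`, with `λ` for `lam`. -/
theorem exists_split {D : H →L[ℂ] H} {p : ℝ} (hp1 : 1 ≤ p) (hp2 : p < 2) {τ lam : ℝ}
    (hτ0 : 0 ≤ τ) (hlam : 0 < lam) (hD : absTrace (p / 2) D ≤ ENNReal.ofReal τ) :
    ∃ U V Z : H →L[ℂ] H, D = U * V + Z ∧
      posTrace (star U * U) ≤ ENNReal.ofReal (lam ^ (1 - p) * τ) ∧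
      posTrace (star V * V) ≤ ENNReal.ofReal (lam ^ (1 - p) * τ) ∧
      posTrace (star Z * Z) ≤ ENNReal.ofReal (lam ^ (2 - p) * τ) := by
  set T := star D * D with hTdef
  have hT : 0 ≤ T := star_mul_self_nonneg D
  have hsa : IsSelfAdjoint T := IsSelfAdjoint.of_nonneg hT
  -- the cutoff functions
  let m : ℝ → ℝ := fun x => max (Real.sqrt x) lam
  have hm : Continuous m := by fun_prop
  have hmpos : ∀ x, 0 < m x := fun x => lt_max_of_lt_right hlam
  let g2 : ℝ → ℝ := fun x => lam / m x
  let r : ℝ → ℝ := fun x => Real.sqrt ((m x - lam) / m x) / Real.sqrt (m x)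
  let s : ℝ → ℝ := fun x => Real.sqrt (m x - lam)
  have hg2 : Continuous g2 := continuous_const.div hm fun x => (hmpos x).ne'
  have hr : Continuous r :=
    ((((hm.sub continuous_const).div hm fun x => (hmpos x).ne')).sqrt).div hm.sqrt
      fun x => (Real.sqrt_pos.2 (hmpos x)).ne'
  have hs' : Continuous s := (hm.sub continuous_const).sqrt
  have hsplit : ∀ x, r x * s x + g2 x = 1 := by
    intro x
    have h1 : 0 ≤ m x - lam := sub_nonneg.2 (le_max_right _ _)
    have h2 : r x * s x = (m x - lam) / m x := by
      have e1 := Real.mul_self_sqrt h1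
      have e2 := Real.mul_self_sqrt (hmpos x).le
      have e3 : Real.sqrt (m x) ≠ 0 := (Real.sqrt_pos.2 (hmpos x)).ne'
      simp only [r, s]
      rw [Real.sqrt_div h1, div_div, div_mul_eq_mul_div, e1, e2]
    rw [h2]
    simp only [g2]
    have := (hmpos x).ne'
    field_simp
    ring
  have hDsplit : D = D * cfc r T * cfc s T + D * cfc g2 T := by
    have h1 := cfc_add T (fun x => r x * s x) g2 (hr.mul hs').continuousOn hg2.continuousOn
    simp only [hsplit] at h1
    rw [cfc_const_one ℝ T, cfc_mul r s T hr.continuousOn hs'.continuousOn] at h1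
    rw [mul_assoc, ← mul_add, ← h1, mul_one]
  have hpow : ContinuousOn (fun x : ℝ => x ^ (p / 2)) (spectrum ℝ T) :=
    continuousOn_id.rpow_const fun _ _ => Or.inr (by linarith)
  have hbound : ∀ (φ : ℝ → ℝ) (c : ℝ), 0 ≤ c → Continuous φ →
      (∀ x, 0 ≤ x → 0 ≤ φ x ∧ φ x ≤ c * x ^ (p / 2)) →
      posTrace (cfc φ T) ≤ ENNReal.ofReal (c * τ) := by
    intro φ c hc hφ hφb
    have hpp : 0 ≤ cfc (fun x : ℝ => x ^ (p / 2)) T :=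
      cfc_nonneg fun t ht => Real.rpow_nonneg (spectrum_nonneg hT ht) _
    calc posTrace (cfc φ T) ≤ posTrace (c • cfc (fun x : ℝ => x ^ (p / 2)) T) := by
          refine posTrace_mono (cfc_nonneg fun t ht => (hφb t (spectrum_nonneg hT ht)).1) ?_
          rw [← cfc_const_mul _ _ _ hpow]
          exact cfc_mono (fun t ht => (hφb t (spectrum_nonneg hT ht)).2) hφ.continuousOn
            (continuousOn_const.mul hpow)
      _ = ENNReal.ofReal c * absTrace (p / 2) D := by rw [posTrace_smul hc hpp]; rfl
      _ ≤ _ := by rw [ENNReal.ofReal_mul hc]; gcongr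
  have hsq : ∀ x : ℝ, 0 ≤ x → x ^ (p / 2) = Real.sqrt x ^ p := by
    intro x hx
    rw [Real.sqrt_eq_rpow, ← Real.rpow_mul hx]; ring_nf
  have hl1 : 0 ≤ lam ^ (1 - p) := by positivity
  have hl2 : 0 ≤ lam ^ (2 - p) := by positivity
  have hb1 : ∀ x, 0 ≤ x → 0 ≤ m x - lam ∧ m x - lam ≤ lam ^ (1 - p) * x ^ (p / 2) := by
    intro x hx
    refine ⟨sub_nonneg.2 (le_max_right _ _), ?_⟩
    rw [hsq x hx]
    rcases le_total (Real.sqrt x) lam with h | h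
    · simp only [m, max_eq_right h, sub_self]; positivity
    · simp only [m, max_eq_left h]
      have h0 : 0 < Real.sqrt x := hlam.trans_le h
      calc Real.sqrt x - lam ≤ Real.sqrt x := by linarith
        _ = Real.sqrt x ^ (1 - p) * Real.sqrt x ^ p := by
          rw [← Real.rpow_add h0]; simp
        _ ≤ lam ^ (1 - p) * Real.sqrt x ^ p := by
          exact mul_le_mul_of_nonneg_right
            (Real.rpow_le_rpow_of_nonpos hlam h (by linarith)) (by positivity)
  have hb2 : ∀ x, 0 ≤ x → 0 ≤ x * g2 x ^ 2 ∧ x * g2 x ^ 2 ≤ lam ^ (2 - p) * x ^ (p / 2) := by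
    intro x hx
    refine ⟨by positivity, ?_⟩
    rw [hsq x hx]
    have hxs := Real.sq_sqrt hx
    rcases le_total (Real.sqrt x) lam with h | h
    · simp only [g2, m, max_eq_right h, div_self hlam.ne', one_pow, mul_one]
      rcases eq_or_lt_of_le (Real.sqrt_nonneg x) with h0 | h0
      · rw [← hxs, ← h0]; simp [Real.zero_rpow (by linarith : p ≠ 0)]
      calc x = Real.sqrt x ^ (2 - p) * Real.sqrt x ^ p := by
            rw [← Real.rpow_add h0]; simp [hx]
        _ ≤ _ := by gcongr
    · simp only [g2, m, max_eq_left h]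
      have h0 : 0 < Real.sqrt x := hlam.trans_le h
      have e1 : x * (lam / Real.sqrt x) ^ 2 = lam ^ 2 := by
        have hx0 : x ≠ 0 := by rw [← hxs]; positivity
        rw [div_pow, hxs]; field_simp
      rw [e1]
      calc lam ^ 2 = lam ^ (2 - p) * lam ^ p := by
            rw [← Real.rpow_add hlam]; simp
        _ ≤ _ := by gcongr
  have hE2 : posTrace (star (D * cfc g2 T) * (D * cfc g2 T))
      ≤ ENNReal.ofReal (lam ^ (2 - p) * τ) := by
    rw [star_mul_cfc_mul_cfc hg2.continuousOn]
    exact hbound _ _ hl2 (by fun_prop) hb2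
  have hE3 : posTrace (star (D * cfc r T) * (D * cfc r T)) ≤ ENNReal.ofReal (lam ^ (1 - p) * τ) := by
    rw [star_mul_cfc_mul_cfc hr.continuousOn]
    refine hbound _ _ hl1 (by fun_prop) fun x hx => ?_
    have h1 := hb1 x hx
    refine ⟨by positivity, le_trans ?_ h1.2⟩
    have e1 : r x ^ 2 = (m x - lam) / m x / m x := by
      simp only [r]
      rw [div_pow, Real.sq_sqrt (div_nonneg h1.1 (hmpos x).le), Real.sq_sqrt (hmpos x).le]
    rw [e1, div_div, mul_div_assoc', div_le_iff₀ (mul_pos (hmpos x) (hmpos x)), mul_comm]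
    gcongr
    · exact h1.1
    · have : Real.sqrt x ≤ m x := le_max_left _ _
      nlinarith [Real.sq_sqrt hx, Real.sqrt_nonneg x]
  have hE4 : posTrace (star (cfc s T) * cfc s T) ≤ ENNReal.ofReal (lam ^ (1 - p) * τ) := by
    have h1 : IsSelfAdjoint (cfc s T) := cfc_predicate s T
    rw [h1.star_eq, ← cfc_mul s s T hs'.continuousOn hs'.continuousOn]
    refine hbound _ _ hl1 (by fun_prop) fun x hx => ?_
    rw [Real.mul_self_sqrt (hb1 x hx).1]
    exact hb1 x hx
  exact ⟨_, _, _, hDsplit, hE3, hE4, hE2⟩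

theorem norm_sum_inner_le_of_split {K : Type*} [Fintype K] {e : K → H} (he : Orthonormal ℂ e)
    (A D : H →L[ℂ] H) {p : ℝ} (hp1 : 1 ≤ p) (hp2 : p < 2) {hs τ lam : ℝ} (hs0 : 0 ≤ hs)
    (hτ0 : 0 ≤ τ) (hlam : 0 < lam) (hA : posTrace (star A * A) ≤ ENNReal.ofReal hs)
    (hD : absTrace (p / 2) D ≤ ENNReal.ofReal τ) :
    ‖∑ k, inner ℂ (A (e k)) (D (e k))‖
      ≤ ‖A‖ * (lam ^ (1 - p) * τ) + Real.sqrt hs * Real.sqrt (lam ^ (2 - p) * τ) := by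
  obtain ⟨U, V, Z, hDs, hE3, hE4, hE2⟩ := exists_split hp1 hp2 hτ0 hlam hD
  have hl1 : 0 ≤ lam ^ (1 - p) := by positivity
  have hE5 : posTrace (star (star U * A) * (star U * A))
      ≤ ENNReal.ofReal (‖A‖ ^ 2 * (lam ^ (1 - p) * τ)) := by
    rw [← posTrace_mul_star_self]
    have e1 : star U * A * star (star U * A)
        = star (star A * U) * (star A * U) := by
      simp only [star_mul, star_star, mul_assoc]
    rw [e1]
    refine (posTrace_comp_le _ _).trans ?_
    rw [norm_star, ENNReal.ofReal_mul (by positivity)]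
    gcongr
  have hτl : 0 ≤ lam ^ (1 - p) * τ := by positivity
  calc ‖∑ k, inner ℂ (A (e k)) (D (e k))‖
      = ‖∑ k, inner ℂ ((star U * A) (e k)) (V (e k))
          + ∑ k, inner ℂ (A (e k)) (Z (e k))‖ := by
        congr 1
        rw [← Finset.sum_add_distrib]
        refine Finset.sum_congr rfl fun k _ => ?_
        rw [hDs, ContinuousLinearMap.add_apply, inner_add_right]
        simp only [ContinuousLinearMap.mul_apply, ContinuousLinearMap.star_eq_adjoint,
          ContinuousLinearMap.adjoint_inner_left]
    _ ≤ Real.sqrt (‖A‖ ^ 2 * (lam ^ (1 - p) * τ)) * Real.sqrt (lam ^ (1 - p) * τ)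
          + Real.sqrt hs * Real.sqrt (lam ^ (2 - p) * τ) := by
        refine (norm_add_le _ _).trans (add_le_add ?_ ?_)
        · exact re_sum_inner_le he _ _ (by positivity) hτl hE5 hE4
        · exact re_sum_inner_le he _ _ hs0 (by positivity) hA hE2
    _ = _ := by
        rw [Real.sqrt_mul (by positivity), Real.sqrt_sq (norm_nonneg _), mul_assoc,
          Real.mul_self_sqrt hτl]

/-- A substitute for the duality of `S_p` and `S_p'`, where the `S_p'` norm of `A` is replaced by
its interpolated bound between the operator and Hilbert–Schmidt norms. The trace class part of `D`
is paired with the operator norm of `A`, the other part with its Hilbert–Schmidt norm. -/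
theorem norm_sum_inner_le_absTrace {K : Type*} [Fintype K] {e : K → H} (he : Orthonormal ℂ e)
    (A D : H →L[ℂ] H) {p : ℝ} (hp1 : 1 ≤ p) (hp2 : p < 2) {op hs τ : ℝ} (hop : 0 < op) (hs0 : 0 < hs)
    (hτ0 : 0 ≤ τ) (hA' : ‖A‖ ^ 2 ≤ op) (hA : posTrace (star A * A) ≤ ENNReal.ofReal hs)
    (hD : absTrace (p / 2) D ≤ ENNReal.ofReal τ) :
    ‖∑ k, inner ℂ (A (e k)) (D (e k))‖
      ≤ 2 * (op ^ (1 / p - 1 / 2) * hs ^ (1 - 1 / p) * τ ^ (1 / p)) := by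
  have hAn : ‖A‖ ≤ Real.sqrt op := Real.le_sqrt_of_sq_le hA'
  have hp0 : 0 < p := by linarith
  rcases eq_or_lt_of_le hτ0 with rfl | hτ
  · have := norm_sum_inner_le_of_split he A D hp1 hp2 hs0.le le_rfl one_pos hA hD
    rw [Real.zero_rpow (by positivity)]
    simpa using this
  -- This height makes the two terms of the split equal, whence the factor 2.
  set lam := (op * τ / hs) ^ (1 / p) with hlam
  have hl : 0 < lam := by positivity
  refine (norm_sum_inner_le_of_split he A D hp1 hp2 hs0.le hτ0 hl hA hD).trans ?_
  have e1 : Real.sqrt op * (lam ^ (1 - p) * τ)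
      = op ^ (1 / p - 1 / 2) * hs ^ (1 - 1 / p) * τ ^ (1 / p) := by
    rw [hlam, ← Real.rpow_mul (by positivity), Real.div_rpow (by positivity) (by positivity),
      Real.mul_rpow hop.le hτ0, Real.sqrt_eq_rpow]
    have h1 : 1 / p * (1 - p) = 1 / p - 1 := by field_simp
    rw [h1]
    have h2 : hs ^ (1 - 1 / p) = (hs ^ (1 / p - 1))⁻¹ := by
      rw [← Real.rpow_neg hs0.le]; ring_nf
    have h3 : op ^ (1 / p - 1 / 2) = op ^ (1 / 2 : ℝ) * op ^ (1 / p - 1) := by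
      rw [← Real.rpow_add hop]; ring_nf
    have h4 : τ ^ (1 / p) = τ ^ (1 / p - 1) * τ := by
      rw [← Real.rpow_add_one hτ.ne']; ring_nf
    rw [h2, h3, h4]; ring
  have e2 : Real.sqrt hs * Real.sqrt (lam ^ (2 - p) * τ)
      = op ^ (1 / p - 1 / 2) * hs ^ (1 - 1 / p) * τ ^ (1 / p) := by
    rw [hlam, ← Real.rpow_mul (by positivity), Real.div_rpow (by positivity) (by positivity),
      Real.mul_rpow hop.le hτ0, Real.sqrt_eq_rpow, Real.sqrt_eq_rpow]
    rw [Real.mul_rpow (by positivity) hτ0, Real.div_rpow (by positivity) (by positivity),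
      Real.mul_rpow (by positivity) (by positivity), ← Real.rpow_mul hop.le,
      ← Real.rpow_mul hτ0, ← Real.rpow_mul hs0.le]
    have h1 : 1 / p * (2 - p) * (1 / 2) = 1 / p - 1 / 2 := by field_simp
    rw [h1]
    have h2 : hs ^ (1 - 1 / p) = hs ^ (1 / 2 : ℝ) * (hs ^ (1 / p - 1 / 2))⁻¹ := by
      rw [← Real.rpow_neg hs0.le, ← Real.rpow_add hs0]; ring_nf
    have h4 : τ ^ (1 / p) = τ ^ (1 / p - 1 / 2) * τ ^ (1 / 2 : ℝ) := by
      rw [← Real.rpow_add hτ]; ring_nf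
    rw [h2, h4]; ring
  calc _ ≤ Real.sqrt op * (lam ^ (1 - p) * τ) + Real.sqrt hs * Real.sqrt (lam ^ (2 - p) * τ) := by
        gcongr
    _ = _ := by rw [e1, e2]; ring

end Schatten

/-! ### Pairing an operator with a Bessel family. -/

section Schatten
set_option linter.unusedSectionVars false
variable {H : Type*} [NormedAddCommGroup H] [InnerProductSpace ℂ H] [CompleteSpace H]
variable {W : Type*} [MeasurableSpace W] {ν : Measure W} [IsFiniteMeasure ν]

theorem lintegral_norm_sq_le {f : W → H} (hf : AEStronglyMeasurable f ν) {s Z : ℝ} (hs : 1 ≤ s)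
    (hZ : 0 ≤ Z) (h : ∫⁻ w, ENNReal.ofReal (‖f w‖ ^ (2 * s)) ∂ν ≤ ENNReal.ofReal Z) :
    ∫⁻ w, ENNReal.ofReal (‖f w‖ ^ 2) ∂ν
      ≤ ENNReal.ofReal (ν.real univ ^ (1 - 1 / s) * Z ^ (1 / s)) := by
  rcases eq_or_lt_of_le hs with rfl | hs1
  · simpa using h
  have hs0 : 0 < s := by linarith
  have hc : s.HolderConjugate (s / (s - 1)) := Real.HolderConjugate.conjExponent hs1
  have hm : AEMeasurable (fun w => ENNReal.ofReal (‖f w‖ ^ 2)) ν :=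
    (hf.norm.aemeasurable.pow_const 2).ennreal_ofReal
  have key := ENNReal.lintegral_mul_le_Lp_mul_Lq ν hc hm (aemeasurable_const (b := (1 : ℝ≥0∞)))
  simp only [Pi.mul_apply, mul_one, ENNReal.one_rpow, lintegral_one] at key
  have e1 : ∀ w, ENNReal.ofReal (‖f w‖ ^ 2) ^ s = ENNReal.ofReal (‖f w‖ ^ (2 * s)) := by
    intro w
    rw [ENNReal.ofReal_rpow_of_nonneg (by positivity) hs0.le, ← Real.rpow_natCast,
      ← Real.rpow_mul (norm_nonneg _)]
    norm_num
  simp_rw [e1] at key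
  refine key.trans ?_
  have e2 : 1 / (s / (s - 1)) = 1 - 1 / s := by field_simp
  have h1s : 0 ≤ 1 - 1 / s := by
    rw [sub_nonneg, div_le_one hs0]; exact hs
  rw [e2, ← ofReal_measureReal, ENNReal.ofReal_rpow_of_nonneg measureReal_nonneg h1s, mul_comm,
    ENNReal.ofReal_mul (by positivity), ← ENNReal.ofReal_rpow_of_nonneg hZ (by positivity)]
  gcongr

theorem norm_integral_inner_le {f h : W → H} (hf : AEStronglyMeasurable f ν)
    (hh : AEStronglyMeasurable h ν) {y z : ℝ} (hy : 0 ≤ y) (hz : 0 ≤ z)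
    (hfy : ∫⁻ w, ENNReal.ofReal (‖f w‖ ^ 2) ∂ν ≤ ENNReal.ofReal y)
    (hhz : ∫⁻ w, ENNReal.ofReal (‖h w‖ ^ 2) ∂ν ≤ ENNReal.ofReal z) :
    ‖∫ w, (inner ℂ (f w) (h w) : ℂ) ∂ν‖ ≤ Real.sqrt y * Real.sqrt z := by
  have h1 : ∫⁻ w, ‖f w‖ₑ * ‖h w‖ₑ ∂ν ≤ ENNReal.ofReal (Real.sqrt y * Real.sqrt z) := by
    refine (ENNReal.lintegral_mul_le_Lp_mul_Lq ν Real.HolderConjugate.two_two hf.enorm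
      hh.enorm).trans ?_
    have e : ∀ x : H, ‖x‖ₑ ^ (2 : ℝ) = ENNReal.ofReal (‖x‖ ^ 2) := by
      intro x
      rw [← ofReal_norm, ENNReal.ofReal_rpow_of_nonneg (norm_nonneg _) (by norm_num)]
      norm_num
    simp_rw [e]
    rw [ENNReal.ofReal_mul (Real.sqrt_nonneg _), Real.sqrt_eq_rpow, Real.sqrt_eq_rpow,
      ← ENNReal.ofReal_rpow_of_nonneg hy (by norm_num),
      ← ENNReal.ofReal_rpow_of_nonneg hz (by norm_num)]
    gcongr
  have h3 : ∀ w, ‖(inner ℂ (f w) (h w) : ℂ)‖ₑ ≤ ‖f w‖ₑ * ‖h w‖ₑ := fun w => by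
    rw [← ofReal_norm, ← ofReal_norm, ← ofReal_norm, ← ENNReal.ofReal_mul (norm_nonneg _)]
    exact ENNReal.ofReal_le_ofReal (norm_inner_le_norm _ _)
  have h2 : ‖∫ w, (inner ℂ (f w) (h w) : ℂ) ∂ν‖ₑ ≤ ENNReal.ofReal (Real.sqrt y * Real.sqrt z) :=
    (enorm_integral_le_lintegral_enorm _).trans ((lintegral_mono fun w => h3 w).trans h1)
  rw [← ofReal_norm] at h2
  exact (ENNReal.ofReal_le_ofReal_iff (by positivity)).1 h2


/-- A bounded family of vectors in a finite dimensional subspace which satisfies a Bessel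
inequality. -/
structure IsBesselFamily (ν : Measure W) (g : W → H) (G γ : ℝ) : Prop where
  aesm : AEStronglyMeasurable g ν
  norm_sq_le : ∀ w, ‖g w‖ ^ 2 ≤ G
  bessel : ∀ f : H, ∫⁻ w, ENNReal.ofReal (‖inner ℂ (g w) f‖ ^ 2) ∂ν ≤
    ENNReal.ofReal γ * ENNReal.ofReal (‖f‖ ^ 2)
  finDim : ∃ F : Submodule ℂ H, FiniteDimensional ℂ F ∧ ∀ w, g w ∈ F

namespace IsBesselFamily
variable {g h : W → H} {G γ z : ℝ}

/-- Jensen at each vector `g w`, with `‖g w‖² ≤ G`, followed by the traced Bessel inequality. -/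
theorem lintegral_cfc_le (hg : IsBesselFamily ν g G γ) (hγ : 0 ≤ γ) {B : H →L[ℂ] H}
    {φ : ℝ → ℝ} (hφ : ContinuousOn φ (spectrum ℝ (star B * B)))
    (hφ0 : ∀ t ∈ spectrum ℝ (star B * B), 0 ≤ φ t)
    {s τ : ℝ} (hs : 1 ≤ s) (hτ : posTrace (cfc (fun t => φ t ^ s) (star B * B)) ≤ ENNReal.ofReal τ)
    {f : W → H} (hf : ∀ w, ‖f w‖ ^ 2 = quadForm (cfc φ (star B * B)) (g w)) :
    ∫⁻ w, ENNReal.ofReal (‖f w‖ ^ (2 * s)) ∂ν ≤ ENNReal.ofReal (G ^ (s - 1) * (γ * τ)) := by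
  have hT : 0 ≤ star B * B := star_mul_self_nonneg B
  obtain ⟨F, hF, hgF⟩ := hg.finDim
  have hpos : 0 ≤ cfc (fun t => φ t ^ s) (star B * B) :=
    cfc_nonneg fun t ht => Real.rpow_nonneg (hφ0 t ht) _
  rcases isEmpty_or_nonempty W with hW | ⟨⟨w0⟩⟩
  · simp [Measure.eq_zero_of_isEmpty ν]
  have hG0 : 0 ≤ G := (sq_nonneg _).trans (hg.norm_sq_le w0)
  have h1 : ∀ w, ‖f w‖ ^ (2 * s)
      ≤ G ^ (s - 1) * quadForm (cfc (fun t => φ t ^ s) (star B * B)) (g w) := by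
    intro w
    rw [Real.rpow_mul (norm_nonneg _), Real.rpow_two, hf]
    refine (quadForm_cfc_jensen hT hφ hφ0 hs _).trans ?_
    refine mul_le_mul_of_nonneg_right ?_ (quadForm_nonneg hpos _)
    rw [Real.rpow_mul (norm_nonneg _), Real.rpow_two]
    exact Real.rpow_le_rpow (sq_nonneg _) (hg.norm_sq_le w) (by linarith)
  have hGs : 0 ≤ G ^ (s - 1) := by positivity
  calc ∫⁻ w, ENNReal.ofReal (‖f w‖ ^ (2 * s)) ∂ν
      ≤ ∫⁻ w, ENNReal.ofReal (G ^ (s - 1)) *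
          ENNReal.ofReal (quadForm (cfc (fun t => φ t ^ s) (star B * B)) (g w)) ∂ν := by
        refine lintegral_mono fun w => ?_
        rw [← ENNReal.ofReal_mul hGs]
        exact ENNReal.ofReal_le_ofReal (h1 w)
    _ = ENNReal.ofReal (G ^ (s - 1)) *
          ∫⁻ w, ENNReal.ofReal (quadForm (cfc (fun t => φ t ^ s) (star B * B)) (g w)) ∂ν :=
        lintegral_const_mul' _ _ ENNReal.ofReal_ne_top
    _ ≤ ENNReal.ofReal (G ^ (s - 1)) * (ENNReal.ofReal γ * ENNReal.ofReal τ) := by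
        gcongr
        exact (lintegral_quadForm_le hg.aesm F hgF hg.bessel hpos).trans (by gcongr)
    _ = _ := by rw [ENNReal.ofReal_mul hGs, ENNReal.ofReal_mul hγ]

/-- The case `2 ≤ p < ∞` of the transfer, with `r = p / 2`: Cauchy–Schwarz separates `h` from `B g`,
and Hölder on the finite measure `ν` passes from the exponent 2 to `2 r`, where `absTrace r B`
controls the integral. -/
theorem norm_integral_le (hg : IsBesselFamily ν g G γ) (hG : 0 ≤ G) (hγ : 0 ≤ γ) {B : H →L[ℂ] H}
    (hh : AEStronglyMeasurable h ν) (hz : 0 ≤ z)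
    (hhz : ∫⁻ w, ENNReal.ofReal (‖h w‖ ^ 2) ∂ν ≤ ENNReal.ofReal z) {r τ : ℝ} (hr : 1 ≤ r)
    (hτ0 : 0 ≤ τ) (hτ : absTrace r B ≤ ENNReal.ofReal τ) :
    ‖∫ w, (inner ℂ (h w) (B (g w)) : ℂ) ∂ν‖ ≤
      Real.sqrt z * Real.sqrt ((ν.real univ * G) ^ (1 - 1 / r) * (γ * τ) ^ (1 / r)) := by
  have hT : 0 ≤ star B * B := star_mul_self_nonneg B
  have hsa := IsSelfAdjoint.of_nonneg hT
  have hr0 : 0 < r := by linarith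
  have h1 := hg.lintegral_cfc_le hγ (B := B) (φ := fun x => x) (by fun_prop)
    (fun t ht => spectrum_nonneg hT ht) hr hτ (f := fun w => B (g w))
    (fun w => by rw [cfc_id' ℝ (star B * B), quadForm_star_mul_self])
  have hBg : AEStronglyMeasurable (fun w => B (g w)) ν :=
    B.continuous.comp_aestronglyMeasurable hg.aesm
  have h2 := lintegral_norm_sq_le hBg hr (by positivity) h1
  refine (norm_integral_inner_le hh hBg hz (by positivity) hhz h2).trans (le_of_eq ?_)
  congr 2
  rw [Real.mul_rpow (by positivity) (by positivity), ← Real.rpow_mul hG,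
    Real.mul_rpow measureReal_nonneg hG]
  have : (r - 1) * (1 / r) = 1 - 1 / r := by field_simp
  rw [this]; ring

theorem norm_integral_le_opNorm (hg : IsBesselFamily ν g G γ) (hG : 0 ≤ G) {B : H →L[ℂ] H}
    (hh : AEStronglyMeasurable h ν) (hz : 0 ≤ z)
    (hhz : ∫⁻ w, ENNReal.ofReal (‖h w‖ ^ 2) ∂ν ≤ ENNReal.ofReal z) :
    ‖∫ w, (inner ℂ (h w) (B (g w)) : ℂ) ∂ν‖ ≤
      Real.sqrt z * Real.sqrt (ν.real univ * G * ‖B‖ ^ 2) := by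
  have hBg : AEStronglyMeasurable (fun w => B (g w)) ν :=
    B.continuous.comp_aestronglyMeasurable hg.aesm
  refine norm_integral_inner_le hh hBg hz (by positivity) hhz ?_
  calc ∫⁻ w, ENNReal.ofReal (‖B (g w)‖ ^ 2) ∂ν ≤ ∫⁻ _, ENNReal.ofReal (‖B‖ ^ 2 * G) ∂ν := by
        refine lintegral_mono fun w => ENNReal.ofReal_le_ofReal ?_
        calc ‖B (g w)‖ ^ 2 ≤ (‖B‖ * ‖g w‖) ^ 2 := by gcongr; exact B.le_opNorm _
          _ = ‖B‖ ^ 2 * ‖g w‖ ^ 2 := by ring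
          _ ≤ _ := by gcongr; exact hg.norm_sq_le w
    _ = _ := by
        rw [lintegral_const, ← ofReal_measureReal, ← ENNReal.ofReal_mul (by positivity)]
        congr 1; ring

end IsBesselFamily

end Schatten

/-! ### The Schatten norm, for p < 2, of an integral of rank one operators. -/

section Schatten
set_option linter.unusedSectionVars false
variable {H : Type*} [NormedAddCommGroup H] [InnerProductSpace ℂ H] [CompleteSpace H]
variable {W : Type*} [MeasurableSpace W] {ν : Measure W} [IsFiniteMeasure ν]
variable {I K : Type*} [Fintype I] [Fintype K]

theorem finOp_range_le (e r : I → H) :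
    LinearMap.range (finOp e r).toLinearMap ≤ Submodule.span ℂ (range e) := by
  rintro _ ⟨x, rfl⟩
  change finOp e r x ∈ _
  rw [finOp_apply]
  exact Submodule.sum_mem _ fun i _ => Submodule.smul_mem _ _ (Submodule.subset_span ⟨i, rfl⟩)

theorem finiteDimensional_range_star_mul_self_finOp (e r : I → H) :
    FiniteDimensional ℂ (LinearMap.range (star (finOp e r) * finOp e r).toLinearMap) := by
  have h1 : FiniteDimensional ℂ (Submodule.span ℂ (range e)) :=
    FiniteDimensional.span_of_finite ℂ (finite_range e)
  have h2 : LinearMap.range (star (finOp e r) * finOp e r).toLinearMap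
      ≤ (Submodule.span ℂ (range e)).map (star (finOp e r)).toLinearMap := by
    rintro _ ⟨x, rfl⟩
    exact ⟨finOp e r x, finOp_range_le e r ⟨x, rfl⟩, rfl⟩
  exact Submodule.finiteDimensional_of_le h2

/-- By self-adjointness, killing the orthogonal complement of the span of `e` forces the range into
that span, so `S` is a `finOp` and its trace is a finite sum. -/
theorem posTrace_mul_self_eq_sum {e : K → H} (he : Orthonormal ℂ e) {S : H →L[ℂ] H}
    (hS : IsSelfAdjoint S) (h0 : ∀ y, (∀ k, inner ℂ (e k) y = 0) → S y = 0) :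
    posTrace (S * S) = ENNReal.ofReal (∑ k, ‖S (e k)‖ ^ 2) := by
  have hsym : ∀ x y, inner ℂ (S x) y = inner ℂ x (S y) := fun x y => by
    have h := ContinuousLinearMap.adjoint_inner_left S y x
    rwa [← ContinuousLinearMap.star_eq_adjoint, hS.star_eq] at h
  have h1 : S = finOp e (fun k => S (e k)) := by
    ext x
    rw [finOp_apply]
    set y := S x - ∑ k, inner ℂ (S (e k)) x • e k with hy
    have hyk : ∀ k, inner ℂ (e k) y = 0 := by
      intro k
      rw [hy, inner_sub_right, he.inner_right_fintype, hsym, sub_self]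
    have hSy := h0 y hyk
    have h2 : inner ℂ (S x - ∑ k, inner ℂ (S (e k)) x • e k) y = 0 := by
      rw [inner_sub_left, hsym, hSy, inner_zero_right, sum_inner]
      simp [inner_smul_left, hyk]
    rw [← hy] at h2
    exact sub_eq_zero.1 (inner_self_eq_zero.1 h2)
  have h2 := posTrace_finOp he (fun k => S (e k))
  rw [← h1, hS.star_eq] at h2
  exact h2

/-- The operator `X` with matrix `t` is the integral over `w` of rank one operators built from `h`
and `g`. Pairing `X` with `Y = X |X|^(p-2)` gives `τ = Tr |X|^p` on one side and `∫ ⟨Y g, h⟩` on the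
other. Cauchy–Schwarz and the Bessel property bound the latter by a multiple of `τ^(1-1/p)`; as `τ`
is finite, this power can be divided out. -/
theorem exists_absTrace_finOp_le {e : I → H} {e' : K → H} (he : Orthonormal ℂ e)
    (he' : Orthonormal ℂ e') {gc : W → K → ℂ} {hc : W → I → ℂ} {t : I → K → ℂ}
    (hint : ∀ i k, Integrable (fun w => hc w i * starRingEnd ℂ (gc w k)) ν)
    (ht : ∀ i k, t i k = ∫ w, hc w i * starRingEnd ℂ (gc w k) ∂ν) {G γ z : ℝ}
    (hG : 0 ≤ G) (hγ : 0 ≤ γ) (hz : 0 ≤ z)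
    (hg : IsBesselFamily ν (fun w => ∑ k, gc w k • e' k) G γ)
    (hh : AEStronglyMeasurable (fun w => ∑ i, hc w i • e i) ν)
    (hhz : ∫⁻ w, ENNReal.ofReal (‖∑ i, hc w i • e i‖ ^ 2) ∂ν ≤ ENNReal.ofReal z)
    {p : ℝ} (hp1 : 1 ≤ p) (hp2 : p < 2) :
    ∃ τ : ℝ, 0 ≤ τ ∧
      absTrace (p / 2) (finOp e fun i => ∑ k, starRingEnd ℂ (t i k) • e' k) = ENNReal.ofReal τ ∧
      τ ^ (1 / p) ≤ Real.sqrt z * Real.sqrt ((ν.real univ * G) ^ (2 / p - 1) * γ ^ (2 - 2 / p)) := by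
  set X := finOp e fun i => ∑ k, starRingEnd ℂ (t i k) • e' k with hX
  set T := star X * X with hTdef
  have hT : 0 ≤ T := star_mul_self_nonneg X
  have hsa : IsSelfAdjoint T := IsSelfAdjoint.of_nonneg hT
  have hp0 : 0 < p := by linarith
  have hfin : (spectrum ℝ T).Finite := by
    have := finiteDimensional_range_star_mul_self_finOp e
      fun i => ∑ k, starRingEnd ℂ (t i k) • e' k
    exact spectrum_finite_of_finiteDimensional_range T
  have hcont : ∀ f : ℝ → ℝ, ContinuousOn f (spectrum ℝ T) := fun f => hfin.continuousOn f
  have hXe : ∀ k, X (e' k) = ∑ i, t i k • e i := by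
    intro k
    rw [hX, finOp_apply]
    refine Finset.sum_congr rfl fun i _ => ?_
    rw [he'.inner_left_fintype]
    simp
  have hX0 : ∀ y, (∀ k, inner ℂ (e' k) y = 0) → X y = 0 := by
    intro y hy
    rw [hX, finOp_apply]
    refine Finset.sum_eq_zero fun i _ => ?_
    rw [sum_inner]
    simp [inner_smul_left, hy]
  -- the square root of `|X|^p`
  set S := cfc (fun x : ℝ => x ^ (p / 4)) T with hS
  have hSsa : IsSelfAdjoint S := cfc_predicate _ T
  have hSS : S * S = cfc (fun x : ℝ => x ^ (p / 2)) T := by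
    rw [hS, ← cfc_mul _ _ _ (hcont _) (hcont _)]
    refine cfc_congr fun x hx => ?_
    have := spectrum_nonneg hT hx
    change x ^ (p / 4) * x ^ (p / 4) = x ^ (p / 2)
    rw [← Real.rpow_add_of_nonneg this (by positivity) (by positivity)]
    ring_nf
  have hSq : ∀ y, quadForm (cfc (fun x : ℝ => x ^ (p / 2)) T) y = ‖S y‖ ^ 2 := fun y => by
    rw [← hSS, ← quadForm_star_mul_self, hSsa.star_eq]
  have hS0 : ∀ y, (∀ k, inner ℂ (e' k) y = 0) → S y = 0 := by
    intro y hy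
    have h1 := quadForm_cfc_jensen hT (f := fun x : ℝ => x ^ (p / 2)) (hcont _)
      (fun t ht => Real.rpow_nonneg (spectrum_nonneg hT ht) _) (s := 2 / p)
      (by rw [le_div_iff₀ hp0]; linarith) y
    have h2 : cfc (fun t : ℝ => (t ^ (p / 2)) ^ (2 / p)) T = T := by
      conv_rhs => rw [← cfc_id' ℝ T]
      refine cfc_congr fun x hx => ?_
      rw [← Real.rpow_mul (spectrum_nonneg hT hx)]
      have : p / 2 * (2 / p) = 1 := by field_simp
      rw [this, Real.rpow_one]
    have h3 : quadForm T y = 0 := by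
      rw [hTdef, quadForm_star_mul_self, hX0 y hy]; simp
    rw [h2, h3, mul_zero, hSq] at h1
    have h4 : (‖S y‖ ^ 2) ^ (2 / p) = 0 := le_antisymm h1 (by positivity)
    rw [Real.rpow_eq_zero (by positivity) (by positivity)] at h4
    simpa using h4
  set τ := ∑ k, ‖S (e' k)‖ ^ 2 with hτ
  have hτ0 : 0 ≤ τ := by positivity
  have hτtr : absTrace (p / 2) X = ENNReal.ofReal τ := by
    rw [absTrace, ← hTdef, ← hSS, posTrace_mul_self_eq_sum he' hSsa hS0]
  refine ⟨τ, hτ0, hτtr, ?_⟩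
  -- the pairing with `X k(T)`
  set k : ℝ → ℝ := fun x => x ^ ((p - 2) / 2) with hk
  set Y := X * cfc k T with hY
  have hkT : IsSelfAdjoint (cfc k T) := cfc_predicate _ T
  have hpair1 : ∀ l, RCLike.re (inner ℂ (Y (e' l)) (X (e' l))) = ‖S (e' l)‖ ^ 2 := by
    intro l
    rw [← hSq]
    have h1 : cfc (fun x : ℝ => x ^ (p / 2)) T = cfc k T * T := by
      have : cfc k T * T = cfc k T * cfc (fun x : ℝ => x) T := by rw [cfc_id' ℝ T]
      rw [this, ← cfc_mul _ _ _ (hcont _) (hcont _)]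
      refine cfc_congr fun x hx => ?_
      have hx0 := spectrum_nonneg hT hx
      change x ^ (p / 2) = x ^ ((p - 2) / 2) * x
      rcases eq_or_lt_of_le hx0 with rfl | hx1
      · rw [Real.zero_rpow (by positivity), mul_zero]
      · rw [← Real.rpow_add_one hx1.ne']; ring_nf
    have h2 : Y (e' l) = X (cfc k T (e' l)) := rfl
    have h3 : ∀ u v, inner ℂ (X u) (X v) = inner ℂ u (T v) := fun u v =>
      (ContinuousLinearMap.adjoint_inner_right X u (X v)).symm
    have h4 : ∀ u v, inner ℂ (cfc k T u) v = inner ℂ u (cfc k T v) := fun u v => by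
      have h := ContinuousLinearMap.adjoint_inner_left (cfc k T) v u
      rwa [← ContinuousLinearMap.star_eq_adjoint, hkT.star_eq] at h
    rw [h2, h3, h4, h1]
    rfl
  have hpair2 : ∑ l, inner ℂ (Y (e' l)) (X (e' l))
      = ∫ w, inner ℂ (Y (∑ l, gc w l • e' l)) (∑ i, hc w i • e i) ∂ν := by
    have h1 : ∀ w, inner ℂ (Y (∑ l, gc w l • e' l)) (∑ i, hc w i • e i)
        = ∑ l, ∑ i, (hc w i * starRingEnd ℂ (gc w l)) * inner ℂ (Y (e' l)) (e i) := by
      intro w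
      rw [map_sum, sum_inner]
      refine Finset.sum_congr rfl fun l _ => ?_
      rw [inner_sum]
      refine Finset.sum_congr rfl fun i _ => ?_
      rw [map_smul, inner_smul_left, inner_smul_right]
      ring
    simp_rw [h1]
    rw [integral_finsetSum _ fun l _ => integrable_finsetSum _ fun i _ => (hint i l).mul_const _]
    refine Finset.sum_congr rfl fun l _ => ?_
    rw [integral_finsetSum _ fun i _ => (hint i l).mul_const _, hXe, inner_sum]
    refine Finset.sum_congr rfl fun i _ => ?_
    rw [integral_mul_const, ← ht, inner_smul_right]
  have hτle : τ ≤ ‖∫ w, inner ℂ (Y (∑ l, gc w l • e' l)) (∑ i, hc w i • e i) ∂ν‖ := by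
    rw [← hpair2, hτ]
    simp_rw [← hpair1]
    rw [← map_sum]
    exact RCLike.re_le_norm _
  have hYg : AEStronglyMeasurable (fun w => Y (∑ l, gc w l • e' l)) ν :=
    Y.continuous.comp_aestronglyMeasurable hg.aesm
  have hYn : ∀ w, ‖Y (∑ l, gc w l • e' l)‖ ^ 2
      = quadForm (cfc (fun x => x * k x ^ 2) T) (∑ l, gc w l • e' l) := by
    intro w
    rw [← quadForm_star_mul_self, hY, star_mul_cfc_mul_cfc (hcont k)]
  have hφ : ∀ x, 0 < x → x * k x ^ 2 = x ^ (p - 1) := by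
    intro x hx
    have e1 : k x ^ 2 = x ^ (p - 2) := by
      rw [hk]
      change (x ^ ((p - 2) / 2)) ^ 2 = _
      rw [← Real.rpow_natCast, ← Real.rpow_mul hx.le]
      push_cast
      ring_nf
    rw [e1, mul_comm, ← Real.rpow_add_one hx.ne']
    ring_nf
  have hn : 0 ≤ ν.real univ := measureReal_nonneg
  have hF : ∫⁻ w, ENNReal.ofReal (‖Y (∑ l, gc w l • e' l)‖ ^ 2) ∂ν
      ≤ ENNReal.ofReal ((ν.real univ * G) ^ (2 / p - 1) * (γ * τ) ^ (2 - 2 / p)) := by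
    -- For `p = 1` the Jensen exponent `p / (2 (p - 1))` is infinite; there `Y* Y ≤ 1` suffices.
    rcases eq_or_lt_of_le hp1 with rfl | hp
    · rw [show (2 / 1 - 1 : ℝ) = 1 by norm_num, show (2 - 2 / 1 : ℝ) = 0 by norm_num,
        Real.rpow_one, Real.rpow_zero, mul_one]
      calc ∫⁻ w, ENNReal.ofReal (‖Y (∑ l, gc w l • e' l)‖ ^ 2) ∂ν ≤ ∫⁻ _, ENNReal.ofReal G ∂ν := by
            refine lintegral_mono fun w => ENNReal.ofReal_le_ofReal ?_
            rw [hYn]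
            refine le_trans ?_ (hg.norm_sq_le w)
            rw [← quadForm_one]
            refine quadForm_mono ?_ _
            rw [← cfc_const_one ℝ T]
            refine cfc_mono (fun x hx => ?_) (hcont _) (hcont _)
            rcases eq_or_lt_of_le (spectrum_nonneg hT hx) with rfl | hx1
            · simp
            · rw [hφ x hx1]; norm_num
        _ = _ := by
            rw [lintegral_const, ← ofReal_measureReal, ← ENNReal.ofReal_mul hG, mul_comm]
    -- Chosen so that `(x^(p-1))^s = x^(p/2)`: the trace that appears is again `τ`.
    · set s := p / (2 * (p - 1)) with hs
      have hp' : 0 < p - 1 := by linarith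
      have hs1 : 1 ≤ s := by rw [hs, le_div_iff₀ (by positivity)]; linarith
      have h1 := hg.lintegral_cfc_le hγ (B := X) (φ := fun x => x * k x ^ 2) (hcont _)
        (fun t ht => mul_nonneg (spectrum_nonneg hT ht) (sq_nonneg _)) (s := s) (τ := τ) hs1
        (by
          refine le_of_eq_of_le ?_ hτtr.le
          rw [absTrace]
          congr 1
          refine cfc_congr fun x hx => ?_
          rcases eq_or_lt_of_le (spectrum_nonneg hT hx) with rfl | hx1
          · rw [zero_mul, Real.zero_rpow (by positivity), Real.zero_rpow (by positivity)]
          · rw [hφ x hx1, ← Real.rpow_mul hx1.le]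
            congr 1
            rw [hs]; field_simp) hYn
      refine (lintegral_norm_sq_le hYg hs1 (by positivity) h1).trans (le_of_eq ?_)
      congr 1
      have e1 : 1 / s = 2 - 2 / p := by rw [hs]; field_simp
      have e2 : (s - 1) * (1 / s) = 2 / p - 1 := by rw [hs]; field_simp; ring
      have e3 : 1 - 1 / s = 2 / p - 1 := by rw [e1]; ring
      rw [Real.mul_rpow (by positivity) (by positivity), ← Real.rpow_mul hG, e2, e3, e1,
        Real.mul_rpow hn hG]
      ring
  have hfinal := hτle.trans (norm_integral_inner_le hYg hh (by positivity) hz hF hhz)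
  rcases eq_or_lt_of_le hτ0 with h0 | h0
  · rw [← h0, Real.zero_rpow (by positivity)]; positivity
  have e1 : Real.sqrt ((ν.real univ * G) ^ (2 / p - 1) * (γ * τ) ^ (2 - 2 / p))
      = Real.sqrt ((ν.real univ * G) ^ (2 / p - 1) * γ ^ (2 - 2 / p)) * τ ^ (1 - 1 / p) := by
    rw [Real.mul_rpow hγ hτ0, ← mul_assoc, Real.sqrt_mul (by positivity)]
    congr 1
    rw [Real.sqrt_eq_rpow, ← Real.rpow_mul hτ0]
    ring_nf
  rw [e1] at hfinal
  have e2 : τ = τ ^ (1 / p) * τ ^ (1 - 1 / p) := by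
    rw [← Real.rpow_add h0]; simp
  have h1 : 0 < τ ^ (1 - 1 / p) := by positivity
  refine le_of_mul_le_mul_right ?_ h1
  rw [← e2]
  calc τ ≤ _ := hfinal
    _ = _ := by ring

end Schatten

/-! ### Hilbert–Schmidt kernels and step functions. -/

section Kernel
variable {X : Type*} [MeasurableSpace X] {μ : Measure X} [IsFiniteMeasure μ]

theorem lintegral_enorm_mul_sq_le {b : X × X → ℂ} (hb : MemLp b 2 (μ.prod μ)) (f : Lp ℂ 2 μ) :
    ∫⁻ x, (∫⁻ y, ‖b (x, y) * f y‖ₑ ∂μ) ^ (2 : ℝ) ∂μ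
      ≤ (∫⁻ z, ‖b z‖ₑ ^ (2 : ℝ) ∂(μ.prod μ)) * ∫⁻ y, ‖f y‖ₑ ^ (2 : ℝ) ∂μ := by
  have hbm : AEMeasurable (fun z => ‖b z‖ₑ) (μ.prod μ) := hb.1.enorm
  have hfm : AEMeasurable (fun y => ‖f y‖ₑ) μ := (Lp.aestronglyMeasurable f).enorm
  have h1 : ∀ᵐ x ∂μ, (∫⁻ y, ‖b (x, y) * f y‖ₑ ∂μ) ^ (2 : ℝ)
      ≤ (∫⁻ y, ‖b (x, y)‖ₑ ^ (2 : ℝ) ∂μ) * ∫⁻ y, ‖f y‖ₑ ^ (2 : ℝ) ∂μ := by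
    filter_upwards [hb.1.prodMk_left] with x hx
    simp_rw [enorm_mul]
    have h := ENNReal.lintegral_mul_le_Lp_mul_Lq μ Real.HolderConjugate.two_two hx.enorm hfm
    calc (∫⁻ y, ‖b (x, y)‖ₑ * ‖f y‖ₑ ∂μ) ^ (2 : ℝ)
        ≤ ((∫⁻ y, ‖b (x, y)‖ₑ ^ (2 : ℝ) ∂μ) ^ (1 / 2 : ℝ) *
          (∫⁻ y, ‖f y‖ₑ ^ (2 : ℝ) ∂μ) ^ (1 / 2 : ℝ)) ^ (2 : ℝ) := by
          gcongr; exact h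
      _ = _ := by
        rw [ENNReal.mul_rpow_of_nonneg _ _ (by norm_num), ← ENNReal.rpow_mul, ← ENNReal.rpow_mul]
        norm_num
  calc _ ≤ ∫⁻ x, (∫⁻ y, ‖b (x, y)‖ₑ ^ (2 : ℝ) ∂μ) * ∫⁻ y, ‖f y‖ₑ ^ (2 : ℝ) ∂μ ∂μ :=
        lintegral_mono_ae h1
    _ = _ := by
        rw [lintegral_mul_const'' _ (hbm.pow_const _).lintegral_prod_right',
          ← lintegral_prod _ (hbm.pow_const _)]

theorem eLpNorm_two_rpow {Y : Type*} [MeasurableSpace Y] {ν : Measure Y} (f : Y → ℂ) :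
    eLpNorm f 2 ν ^ (2 : ℝ) = ∫⁻ y, ‖f y‖ₑ ^ (2 : ℝ) ∂ν := by
  rw [eLpNorm_eq_lintegral_rpow_enorm_toReal (by norm_num) (by norm_num), ← ENNReal.rpow_mul]
  norm_num

theorem exists_hasKernel {b : X × X → ℂ} (hb : MemLp b 2 (μ.prod μ)) :
    ∃ B : Lp ℂ 2 μ →L[ℂ] Lp ℂ 2 μ, HasKernel μ B b := by
  have hmeas : ∀ f : Lp ℂ 2 μ, AEStronglyMeasurable (fun z : X × X => b z * f z.2) (μ.prod μ) :=
    fun f => hb.1.mul (Lp.aestronglyMeasurable f).comp_snd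
  have hint : ∀ f : Lp ℂ 2 μ, ∀ᵐ x ∂μ, Integrable (fun y => b (x, y) * f y) μ := by
    intro f
    have h1 : ∫⁻ x, (∫⁻ y, ‖b (x, y) * f y‖ₑ ∂μ) ^ (2 : ℝ) ∂μ ≠ ∞ := by
      refine ne_top_of_le_ne_top ?_ (lintegral_enorm_mul_sq_le hb f)
      rw [← eLpNorm_two_rpow, ← eLpNorm_two_rpow]
      exact ENNReal.mul_ne_top (ENNReal.rpow_ne_top_of_nonneg (by norm_num) hb.2.ne)
        (ENNReal.rpow_ne_top_of_nonneg (by norm_num) (Lp.memLp f).2.ne)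
    have hm : AEMeasurable (fun x => (∫⁻ y, ‖b (x, y) * f y‖ₑ ∂μ) ^ (2 : ℝ)) μ :=
      ((hmeas f).enorm.lintegral_prod_right').pow_const _
    filter_upwards [ae_lt_top' hm h1, (hmeas f).prodMk_left] with x hx hx2
    refine ⟨hx2, ?_⟩
    rw [ENNReal.rpow_lt_top_iff_of_pos (by norm_num)] at hx
    exact hx
  have hnorm : ∀ f : Lp ℂ 2 μ, eLpNorm (fun x => ∫ y, b (x, y) * f y ∂μ) 2 μ
      ≤ eLpNorm b 2 (μ.prod μ) * eLpNorm f 2 μ := by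
    intro f
    have h2 : (eLpNorm (fun x => ∫ y, b (x, y) * f y ∂μ) 2 μ) ^ (2 : ℝ)
        ≤ (eLpNorm b 2 (μ.prod μ) * eLpNorm f 2 μ) ^ (2 : ℝ) := by
      rw [ENNReal.mul_rpow_of_nonneg _ _ (by norm_num), eLpNorm_two_rpow, eLpNorm_two_rpow,
        eLpNorm_two_rpow]
      refine le_trans (lintegral_mono fun x => ?_) (lintegral_enorm_mul_sq_le hb f)
      gcongr
      exact enorm_integral_le_lintegral_enorm _
    rwa [ENNReal.rpow_le_rpow_iff (by norm_num)] at h2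
  have hmem : ∀ f : Lp ℂ 2 μ, MemLp (fun x => ∫ y, b (x, y) * f y ∂μ) 2 μ := fun f =>
    ⟨(hmeas f).integral_prod_right',
      (hnorm f).trans_lt (ENNReal.mul_lt_top hb.2 (Lp.memLp f).2)⟩
  let L : Lp ℂ 2 μ →ₗ[ℂ] Lp ℂ 2 μ :=
    { toFun := fun f => (hmem f).toLp _
      map_add' := by
        intro f g
        rw [← MemLp.toLp_add]
        refine MemLp.toLp_congr _ _ ?_
        filter_upwards [hint f, hint g] with x hf hg
        change _ = (∫ y, b (x, y) * f y ∂μ) + ∫ y, b (x, y) * g y ∂μ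
        rw [← integral_add hf hg]
        refine integral_congr_ae ?_
        filter_upwards [Lp.coeFn_add f g] with y hy
        rw [hy, Pi.add_apply, mul_add]
      map_smul' := by
        intro c f
        rw [RingHom.id_apply, ← MemLp.toLp_const_smul]
        refine MemLp.toLp_congr _ _ ?_
        filter_upwards with x
        change _ = c • ∫ y, b (x, y) * f y ∂μ
        rw [← integral_smul]
        refine integral_congr_ae ?_
        filter_upwards [Lp.coeFn_smul c f] with y hy
        rw [hy, Pi.smul_apply, smul_eq_mul, smul_eq_mul]
        ring }
  refine ⟨L.mkContinuous (eLpNorm b 2 (μ.prod μ)).toReal fun f => ?_, hb, fun f => ?_⟩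
  · change ‖(hmem f).toLp _‖ ≤ _
    rw [Lp.norm_toLp, Lp.norm_def, ← ENNReal.toReal_mul]
    exact ENNReal.toReal_mono (ENNReal.mul_ne_top hb.2.ne (Lp.memLp f).2.ne) (hnorm f)
  · exact (hmem f).coeFn_toLp

/-- The normalized indicator function of a set. -/
def unitIndicator (μ : Measure X) [IsFiniteMeasure μ] (S : Set X) (hS : MeasurableSet S) :
    Lp ℂ 2 μ :=
  indicatorConstLp 2 hS (measure_ne_top μ S) ((Real.sqrt (μ.real S))⁻¹ : ℂ)

theorem unitIndicator_ae (S : Set X) (hS : MeasurableSet S) :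
    unitIndicator μ S hS =ᵐ[μ] S.indicator fun _ => ((Real.sqrt (μ.real S))⁻¹ : ℂ) :=
  indicatorConstLp_coeFn

theorem orthonormal_unitIndicator {I : Type*} {S : I → Set X} (hS : ∀ i, MeasurableSet (S i))
    (hd : Pairwise fun i j => Disjoint (S i) (S j)) (hpos : ∀ i, 0 < μ.real (S i)) :
    Orthonormal ℂ fun i => unitIndicator μ (S i) (hS i) := by
  classical
  rw [orthonormal_iff_ite]
  intro i j
  rw [L2.inner_def]
  have h1 : ∀ᵐ x ∂μ, inner ℂ (unitIndicator μ (S i) (hS i) x) (unitIndicator μ (S j) (hS j) x)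
      = (S i).indicator (fun _ => if i = j then ((μ.real (S i))⁻¹ : ℂ) else 0) x := by
    filter_upwards [unitIndicator_ae (S i) (hS i), unitIndicator_ae (S j) (hS j)] with x hx hy
    rw [hx, hy]
    by_cases hxi : x ∈ S i
    · rcases eq_or_ne i j with rfl | hij
      · have h2 := Real.mul_self_sqrt (hpos i).le
        simp only [indicator_of_mem hxi, if_true, RCLike.inner_apply]
        rw [← Complex.ofReal_inv, Complex.conj_ofReal, ← Complex.ofReal_inv, ← Complex.ofReal_mul,
          ← mul_inv, h2]
      · have hxj : x ∉ S j := fun h => (hd hij).le_bot ⟨hxi, h⟩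
        simp [indicator_of_notMem hxj, hij]
    · simp [indicator_of_notMem hxi]
  rw [integral_congr_ae h1, integral_indicator (hS i), setIntegral_const]
  split_ifs
  · have := (hpos i).ne'
    simp [this]
  · simp

/-- The mean value of `M` on `S × T`. -/
def blockMean (μ : Measure X) (M : X × X → ℂ) (S T : Set X) : ℂ :=
  ((μ.real S)⁻¹ * (μ.real T)⁻¹ : ℝ) * ∫ z in S ×ˢ T, M z ∂(μ.prod μ)

variable {I K : Type*} [Fintype I] [Fintype K]

/-- The step function with values `a i k` on `S i × T k`, suitably normalized. -/
def stepKernel (μ : Measure X) (S : I → Set X) (T : K → Set X) (a : I → K → ℂ) : X × X → ℂ :=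
  fun z => ∑ i, ∑ k, a i k * (S i).indicator (fun _ => ((Real.sqrt (μ.real (S i)))⁻¹ : ℂ)) z.1
    * (T k).indicator (fun _ => ((Real.sqrt (μ.real (T k)))⁻¹ : ℂ)) z.2

theorem memLp_stepKernel {S : I → Set X} {T : K → Set X} (hS : ∀ i, MeasurableSet (S i))
    (hT : ∀ k, MeasurableSet (T k)) (a : I → K → ℂ) (q : ℝ≥0∞) :
    MemLp (stepKernel μ S T a) q (μ.prod μ) := by
  refine memLp_finsetSum _ fun i _ => memLp_finsetSum _ fun k _ => ?_
  have h : (fun z : X × X => a i k *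
      (S i).indicator (fun _ => ((Real.sqrt (μ.real (S i)))⁻¹ : ℂ)) z.1
      * (T k).indicator (fun _ => ((Real.sqrt (μ.real (T k)))⁻¹ : ℂ)) z.2)
      = (S i ×ˢ T k).indicator fun _ => a i k * ((Real.sqrt (μ.real (S i)))⁻¹ : ℂ)
        * ((Real.sqrt (μ.real (T k)))⁻¹ : ℂ) := by
    ext ⟨x, y⟩
    by_cases hx : x ∈ S i <;> by_cases hy : y ∈ T k <;> simp [hx, hy]
  rw [h]
  exact memLp_indicator_const q ((hS i).prod (hT k)) _ (Or.inr (measure_ne_top _ _))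

theorem hasKernel_finOp {S : I → Set X} {T : K → Set X} (hS : ∀ i, MeasurableSet (S i))
    (hT : ∀ k, MeasurableSet (T k)) (a : I → K → ℂ) :
    HasKernel μ (finOp (fun i => unitIndicator μ (S i) (hS i)) fun i =>
      ∑ k, starRingEnd ℂ (a i k) • unitIndicator μ (T k) (hT k)) (stepKernel μ S T a) := by
  refine ⟨memLp_stepKernel hS hT a 2, fun f => ?_⟩
  rw [finOp_apply]
  have h1 : ∀ k, inner ℂ (unitIndicator μ (T k) (hT k)) f
      = ∫ y, (T k).indicator (fun _ => ((Real.sqrt (μ.real (T k)))⁻¹ : ℂ)) y * f y ∂μ := by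
    intro k
    rw [L2.inner_def]
    refine integral_congr_ae ?_
    filter_upwards [unitIndicator_ae (T k) (hT k)] with y hy
    rw [hy]
    by_cases hyT : y ∈ T k
    · simp only [indicator_of_mem hyT, RCLike.inner_apply]
      rw [← Complex.ofReal_inv, Complex.conj_ofReal, mul_comm]
    · simp [indicator_of_notMem hyT]
  have hfi : Integrable f μ := (Lp.memLp f).integrable (by norm_num)
  have h2 : ∀ k, Integrable (fun y => (T k).indicator
      (fun _ => ((Real.sqrt (μ.real (T k)))⁻¹ : ℂ)) y * f y) μ := by
    intro k
    have : (fun y => (T k).indicator (fun _ => ((Real.sqrt (μ.real (T k)))⁻¹ : ℂ)) y * f y)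
        = (T k).indicator fun y => ((Real.sqrt (μ.real (T k)))⁻¹ : ℂ) * f y := by
      ext y; by_cases hy : y ∈ T k <;> simp [hy]
    rw [this]
    exact (hfi.const_mul _).indicator (hT k)
  have h3 := fun i => unitIndicator_ae (μ := μ) (S i) (hS i)
  filter_upwards [Lp.coeFn_finsetSum Finset.univ (fun i => inner ℂ
      (∑ k, starRingEnd ℂ (a i k) • unitIndicator μ (T k) (hT k)) f •
      unitIndicator μ (S i) (hS i)),
    ae_all_iff.2 h3, ae_all_iff.2 fun i => Lp.coeFn_smul (inner ℂ
      (∑ k, starRingEnd ℂ (a i k) • unitIndicator μ (T k) (hT k)) f)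
      (unitIndicator μ (S i) (hS i))] with x hx hx2 hx3
  rw [hx, Finset.sum_apply]
  have h4 : ∀ y, stepKernel μ S T a (x, y) * f y = ∑ i, ∑ k, a i k *
      (S i).indicator (fun _ => ((Real.sqrt (μ.real (S i)))⁻¹ : ℂ)) x *
      ((T k).indicator (fun _ => ((Real.sqrt (μ.real (T k)))⁻¹ : ℂ)) y * f y) := by
    intro y
    simp only [stepKernel, Finset.sum_mul, mul_assoc]
  simp_rw [h4]
  rw [integral_finsetSum _ fun i _ => integrable_finsetSum _ fun k _ => (h2 k).const_mul _]
  refine Finset.sum_congr rfl fun i _ => ?_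
  rw [integral_finsetSum _ fun k _ => (h2 k).const_mul _, hx3, Pi.smul_apply, hx2, smul_eq_mul,
    sum_inner, Finset.sum_mul]
  refine Finset.sum_congr rfl fun k _ => ?_
  rw [integral_const_mul, ← h1, inner_smul_left, RCLike.conj_conj]
  ring

/-- Compressed to normalized indicators of disjoint cells, the Schur multiplier becomes a finite one
whose symbol consists of the means of `M` over the cells. -/
theorem inner_isSchurImage {S : I → Set X} {T : K → Set X} (hS : ∀ i, MeasurableSet (S i))
    (hT : ∀ k, MeasurableSet (T k)) (hSd : Pairwise fun i j => Disjoint (S i) (S j))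
    (hTd : Pairwise fun i j => Disjoint (T i) (T j)) (hSpos : ∀ i, 0 < μ.real (S i))
    (hTpos : ∀ i, 0 < μ.real (T i)) (a : I → K → ℂ) {M : X × X → ℂ}
    (hM : Integrable M (μ.prod μ)) {B : Lp ℂ 2 μ →L[ℂ] Lp ℂ 2 μ}
    (hB : HasKernel μ B fun z => M z * stepKernel μ S T a z) (i : I) (k : K) :
    inner ℂ (unitIndicator μ (S i) (hS i)) (B (unitIndicator μ (T k) (hT k)))
      = a i k * blockMean μ M (S i) (T k) := by
  classical
  have h1 : ∀ᵐ x ∂μ, inner ℂ (unitIndicator μ (S i) (hS i) x) (B (unitIndicator μ (T k) (hT k)) x)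
      = ∫ y, (a i k * ((μ.real (S i))⁻¹ * (μ.real (T k))⁻¹ : ℝ)) *
        (S i ×ˢ T k).indicator M (x, y) ∂μ := by
    filter_upwards [unitIndicator_ae (S i) (hS i), hB.2 (unitIndicator μ (T k) (hT k))] with x hx hy
    rw [hx, hy]
    by_cases hxi : x ∈ S i
    · simp only [indicator_of_mem hxi, RCLike.inner_apply]
      rw [mul_comm, ← integral_const_mul]
      refine integral_congr_ae ?_
      filter_upwards [unitIndicator_ae (T k) (hT k)] with y hy
      rw [hy]
      by_cases hyk : y ∈ T k
      · have e1 : stepKernel μ S T a (x, y) = a i k * ((Real.sqrt (μ.real (S i)))⁻¹ : ℂ)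
            * ((Real.sqrt (μ.real (T k)))⁻¹ : ℂ) := by
          rw [stepKernel, Finset.sum_eq_single i, Finset.sum_eq_single k]
          · simp [hxi, hyk]
          · intro k' _ hk'
            have : y ∉ T k' := fun h => (hTd hk').le_bot ⟨h, hyk⟩
            simp [this]
          · simp
          · intro i' _ hi'
            have : x ∉ S i' := fun h => (hSd hi').le_bot ⟨h, hxi⟩
            simp [this]
          · simp
        have e2 : (S i ×ˢ T k).indicator M (x, y) = M (x, y) := indicator_of_mem (mk_mem_prod hxi hyk) _
        have e3 : (((μ.real (S i))⁻¹ * (μ.real (T k))⁻¹ : ℝ) : ℂ)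
            = ((Real.sqrt (μ.real (S i)))⁻¹ : ℂ) * ((Real.sqrt (μ.real (S i)))⁻¹ : ℂ)
            * (((Real.sqrt (μ.real (T k)))⁻¹ : ℂ) * ((Real.sqrt (μ.real (T k)))⁻¹ : ℂ)) := by
          conv_lhs => rw [← Real.mul_self_sqrt (hSpos i).le, ← Real.mul_self_sqrt (hTpos k).le]
          push_cast
          rw [mul_inv, mul_inv]
        rw [e2, e3, indicator_of_mem hyk, e1, ← Complex.ofReal_inv, ← Complex.ofReal_inv,
          Complex.conj_ofReal]
        ring
      · have e2 : (S i ×ˢ T k).indicator M (x, y) = 0 := indicator_of_notMem (fun h => hyk h.2) _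
        rw [e2, indicator_of_notMem hyk]
        simp
    · have e2 : ∀ y, (S i ×ˢ T k).indicator M (x, y) = 0 := fun y =>
        indicator_of_notMem (fun h => hxi h.1) _
      simp [indicator_of_notMem hxi, e2]
  rw [L2.inner_def, integral_congr_ae h1]
  have h2 : Integrable ((S i ×ˢ T k).indicator M) (μ.prod μ) :=
    hM.indicator ((hS i).prod (hT k))
  rw [← integral_prod (fun z => (a i k * ((μ.real (S i))⁻¹ * (μ.real (T k))⁻¹ : ℝ)) *
        (S i ×ˢ T k).indicator M z) (h2.const_mul _), integral_const_mul,
    integral_indicator ((hS i).prod (hT k)), blockMean]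
  ring

end Kernel

/-! ### The inequality satisfied by contractive Schur multipliers. -/

section Transfer

theorem isCompactOperator_finOp {H : Type*} [NormedAddCommGroup H] [InnerProductSpace ℂ H]
    {I : Type*} [Fintype I] (e r : I → H) : IsCompactOperator (finOp e r) := by
  have h1 : ∀ i, InnerProductSpace.rankOne ℂ (e i) (r i)
      ∈ compactOperator (RingHom.id ℂ) H H := by
    intro i
    rw [InnerProductSpace.rankOne_def']
    have h : IsCompactOperator (ContinuousLinearMap.toSpanSingleton ℂ (e i)) :=
      isCompactOperator_of_locallyCompactSpace_rng _
    exact h.comp_clm (innerSL ℂ (r i))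
  exact Submodule.sum_mem _ fun i _ => h1 i

section
variable {H : Type*} [NormedAddCommGroup H] [InnerProductSpace ℂ H] [CompleteSpace H]
variable {I K : Type*} [Fintype I] [Fintype K]

theorem norm_finOp_sq_le {e : I → H} {e' : K → H} (he : Orthonormal ℂ e) (he' : Orthonormal ℂ e')
    {a : I → K → ℂ} {op : ℝ} (hop0 : 0 ≤ op)
    (hop : ∀ f : K → ℂ, ∑ i, ‖∑ k, a i k * f k‖ ^ 2 ≤ op * ∑ k, ‖f k‖ ^ 2) :
    ‖finOp e fun i => ∑ k, starRingEnd ℂ (a i k) • e' k‖ ^ 2 ≤ op := by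
  rw [← Real.sq_sqrt hop0]
  refine pow_le_pow_left₀ (norm_nonneg _) (ContinuousLinearMap.opNorm_le_bound _
    (Real.sqrt_nonneg _) fun x => ?_) 2
  refine abs_le_of_sq_le_sq' ?_ (by positivity) |>.2
  rw [finOp_apply, norm_sum_smul_sq he, mul_pow, Real.sq_sqrt hop0]
  have h := hop fun k => inner ℂ (e' k) x
  calc _ = ∑ i, ‖∑ k, a i k * inner ℂ (e' k) x‖ ^ 2 := by
        refine Finset.sum_congr rfl fun i _ => ?_
        rw [sum_inner]
        simp [inner_smul_left]
    _ ≤ op * ∑ k, ‖inner ℂ (e' k) x‖ ^ 2 := h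
    _ ≤ _ := by
        gcongr
        exact he'.sum_inner_products_le x (s := Finset.univ)

theorem posTrace_finOp_le {e : I → H} {e' : K → H} (he : Orthonormal ℂ e) (he' : Orthonormal ℂ e')
    {a : I → K → ℂ} {hs : ℝ} (hhs : ∑ i, ∑ k, ‖a i k‖ ^ 2 ≤ hs) :
    posTrace (star (finOp e fun i => ∑ k, starRingEnd ℂ (a i k) • e' k) *
      finOp e fun i => ∑ k, starRingEnd ℂ (a i k) • e' k) ≤ ENNReal.ofReal hs := by
  rw [posTrace_finOp he]
  refine ENNReal.ofReal_le_ofReal (le_of_eq_of_le ?_ hhs)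
  refine Finset.sum_congr rfl fun i _ => ?_
  rw [norm_sum_smul_sq he']
  simp

theorem finOp_apply_basis (e : I → H) {e' : K → H} (he' : Orthonormal ℂ e') (a : I → K → ℂ)
    (k : K) : finOp e (fun i => ∑ k, starRingEnd ℂ (a i k) • e' k) (e' k) = ∑ i, a i k • e i := by
  classical
  rw [finOp_apply]
  refine Finset.sum_congr rfl fun i _ => ?_
  rw [he'.inner_left_fintype]
  simp

theorem isBesselFamily_sum {W : Type*} [MeasurableSpace W] {ν : Measure W} {e' : K → H}
    (he' : Orthonormal ℂ e') {g : W → K → ℂ} (hgm : ∀ k, AEStronglyMeasurable (fun w => g w k) ν)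
    {G γ : ℝ} (hγ : 0 ≤ γ) (hG : ∀ w, ∑ k, ‖g w k‖ ^ 2 ≤ G)
    (hbes : ∀ f : K → ℂ, ∫⁻ w, ENNReal.ofReal (‖∑ k, starRingEnd ℂ (g w k) * f k‖ ^ 2) ∂ν
      ≤ ENNReal.ofReal (γ * ∑ k, ‖f k‖ ^ 2)) :
    IsBesselFamily ν (fun w => ∑ k, g w k • e' k) G γ where
  aesm := Finset.aestronglyMeasurable_fun_sum _ fun k _ => (hgm k).smul_const _
  norm_sq_le w := by rw [norm_sum_smul_sq he']; exact hG w
  bessel f := by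
    have h := hbes fun k => inner ℂ (e' k) f
    have e1 : ∀ w, (inner ℂ (∑ k, g w k • e' k) f : ℂ)
        = ∑ k, starRingEnd ℂ (g w k) * inner ℂ (e' k) f := by
      intro w
      rw [sum_inner]
      simp [inner_smul_left]
    simp_rw [e1]
    refine h.trans ?_
    rw [← ENNReal.ofReal_mul hγ]
    refine ENNReal.ofReal_le_ofReal ?_
    gcongr
    exact he'.sum_inner_products_le f (s := Finset.univ)
  finDim := ⟨Submodule.span ℂ (range e'), FiniteDimensional.span_of_finite ℂ (finite_range e'),
    fun w => Submodule.sum_mem _ fun k _ => Submodule.smul_mem _ _ (Submodule.subset_span ⟨k, rfl⟩)⟩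

end

variable {X : Type*} [MeasurableSpace X] {μ : Measure X} [IsFiniteMeasure μ]
variable {W : Type*} [MeasurableSpace W] {ν : Measure W} [IsFiniteMeasure ν]
variable {I K : Type*} [Fintype I] [Fintype K]

/-- The Schur multiplier with symbol `M` is contractive on the Schatten class `S_p`. -/
def SchurContractive (p : ℝ≥0∞) (μ : Measure X) (M : X × X → ℂ) : Prop :=
  ∀ A B : Lp ℂ 2 μ →L[ℂ] Lp ℂ 2 μ, IsSchurImage μ M A B → MemSchatten p A →
    schattenNorm p B ≤ schattenNorm p A

theorem schurContractive_of_schurNorm_le_one {μ : Measure X} {p : ℝ≥0∞} {M : X × X → ℂ}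
    (h : schurNorm p μ M ≤ 1) : SchurContractive p μ M := by
  intro A B hAB hA
  have h1 : ∀ C : ℝ≥0∞, 1 < C → schattenNorm p B ≤ C * schattenNorm p A := by
    intro C hC
    obtain ⟨C', hC', hlt⟩ := sInf_lt_iff.1 (h.trans_lt hC)
    exact (hC' A B hAB hA).trans (by gcongr)
  rcases eq_or_ne (schattenNorm p A) ∞ with h2 | h2
  · rw [h2]; exact le_top
  refine ge_of_tendsto (x := nhdsWithin 1 (Ioi 1)) (f := fun C : ℝ≥0∞ => C * schattenNorm p A) ?_
    (eventually_nhdsWithin_of_forall fun C hC => h1 C hC)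
  have : Filter.Tendsto (fun C : ℝ≥0∞ => C * schattenNorm p A) (nhds 1)
      (nhds (1 * schattenNorm p A)) :=
    ENNReal.Tendsto.mul_const Filter.tendsto_id (Or.inr h2)
  rw [one_mul] at this
  exact this.mono_left nhdsWithin_le_nhds

theorem exists_isSchurImage {S : I → Set X} {T : K → Set X} (hS : ∀ i, MeasurableSet (S i))
    (hT : ∀ k, MeasurableSet (T k)) (a : I → K → ℂ) {M : X × X → ℂ} (hM : MemLp M ∞ (μ.prod μ)) :
    ∃ B, IsSchurImage μ M (finOp (fun i => unitIndicator μ (S i) (hS i)) fun i =>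
      ∑ k, starRingEnd ℂ (a i k) • unitIndicator μ (T k) (hT k)) B ∧
      HasKernel μ B fun z => M z * stepKernel μ S T a z := by
  have h1 : MemLp (fun z => M z * stepKernel μ S T a z) 2 (μ.prod μ) :=
    (memLp_stepKernel hS hT a 2).mul hM
  obtain ⟨B, hB⟩ := exists_hasKernel h1
  exact ⟨B, ⟨_, hasKernel_finOp hS hT a, hB⟩, hB⟩

/-- The data on which a contractive Schur multiplier is tested. -/
structure TestData (ν : Measure W) (I K : Type*) [Fintype I] [Fintype K] where
  a : I → K → ℂ
  h : W → I → ℂ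
  g : W → K → ℂ
  op : ℝ
  hs : ℝ
  G : ℝ
  γ : ℝ
  z : ℝ
  op_pos : 0 < op
  hs_pos : 0 < hs
  G_nonneg : 0 ≤ G
  γ_nonneg : 0 ≤ γ
  z_nonneg : 0 ≤ z
  op_le : ∀ f : K → ℂ, ∑ i, ‖∑ k, a i k * f k‖ ^ 2 ≤ op * ∑ k, ‖f k‖ ^ 2
  hs_le : ∑ i, ∑ k, ‖a i k‖ ^ 2 ≤ hs
  meas_h : ∀ i, AEStronglyMeasurable (fun w => h w i) ν
  meas_g : ∀ k, AEStronglyMeasurable (fun w => g w k) ν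
  integrable : ∀ i k, Integrable (fun w => starRingEnd ℂ (h w i) * g w k) ν
  norm_g : ∀ w, ∑ k, ‖g w k‖ ^ 2 ≤ G
  bessel : ∀ f : K → ℂ, ∫⁻ w, ENNReal.ofReal (‖∑ k, starRingEnd ℂ (g w k) * f k‖ ^ 2) ∂ν
      ≤ ENNReal.ofReal (γ * ∑ k, ‖f k‖ ^ 2)
  norm_h : ∫⁻ w, ENNReal.ofReal (∑ i, ‖h w i‖ ^ 2) ∂ν ≤ ENNReal.ofReal z

namespace TestData

/-- The coefficients of the linear form on symbols attached to the test data. -/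
def coeff (D : TestData ν I K) (i : I) (k : K) : ℂ :=
  D.a i k * ∫ w, starRingEnd ℂ (D.h w i) * D.g w k ∂ν

/-- The bound satisfied by contractive multipliers. -/
def bound (D : TestData ν I K) (α : ℝ) : ℝ :=
  2 * (Real.sqrt D.z * Real.sqrt ((ν.real univ * D.G * D.op) ^ (2 * α) *
    (D.γ * D.hs) ^ (1 - 2 * α)))

variable {S : I → Set X} {T : K → Set X} {M : X × X → ℂ} {p : ℝ≥0∞}

/-- For `p ≥ 2` the multiplier acts on the operator with matrix `D.a`, whose `S_p` norm is
interpolated between `op` and `hs`; the image is then paired with the families `h` and `g`, which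
have the Bessel constant `γ` and the bounds `G` and `z`. The factor 2 of `bound` is needed only for
`p < 2`. -/
theorem norm_sum_le_of_two_le (D : TestData ν I K) (hM : MemLp M ∞ (μ.prod μ))
    (hp : 2 ≤ p) (hc : SchurContractive p μ M) (hS : ∀ i, MeasurableSet (S i))
    (hT : ∀ k, MeasurableSet (T k)) (hSd : Pairwise fun i j => Disjoint (S i) (S j))
    (hTd : Pairwise fun i j => Disjoint (T i) (T j)) (hSpos : ∀ i, 0 < μ.real (S i))
    (hTpos : ∀ i, 0 < μ.real (T i)) :
    ‖∑ i, ∑ k, D.coeff i k * blockMean μ M (S i) (T k)‖ ≤ D.bound |(p⁻¹).toReal - 1 / 2| := by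
  set e := fun i => unitIndicator μ (S i) (hS i) with he_def
  set e' := fun k => unitIndicator μ (T k) (hT k) with he'_def
  have he : Orthonormal ℂ e := orthonormal_unitIndicator hS hSd hSpos
  have he' : Orthonormal ℂ e' := orthonormal_unitIndicator hT hTd hTpos
  obtain ⟨B, hAB, hB⟩ := exists_isSchurImage hS hT D.a hM
  set A := finOp e fun i => ∑ k, starRingEnd ℂ (D.a i k) • e' k with hA
  have hMi : Integrable M (μ.prod μ) := hM.integrable le_top
  have hcoef : ∀ i k, inner ℂ (e i) (B (e' k)) = D.a i k * blockMean μ M (S i) (T k) :=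
    inner_isSchurImage hS hT hSd hTd hSpos hTpos D.a hMi hB
  have hAn : ‖A‖ ^ 2 ≤ D.op := norm_finOp_sq_le he he' D.op_pos.le D.op_le
  have hAtr : posTrace (star A * A) ≤ ENNReal.ofReal D.hs := posTrace_finOp_le he he' D.hs_le
  have hgB := isBesselFamily_sum he' D.meas_g D.γ_nonneg D.norm_g D.bessel
  have hhm : AEStronglyMeasurable (fun w => ∑ i, D.h w i • e i) ν :=
    Finset.aestronglyMeasurable_fun_sum _ fun k _ => (D.meas_h k).smul_const _
  have hhz : ∫⁻ w, ENNReal.ofReal (‖∑ i, D.h w i • e i‖ ^ 2) ∂ν ≤ ENNReal.ofReal D.z := by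
    simp_rw [norm_sum_smul_sq he]; exact D.norm_h
  have hsum : ∑ i, ∑ k, D.coeff i k * blockMean μ M (S i) (T k)
      = ∫ w, inner ℂ (∑ i, D.h w i • e i) (B (∑ k, D.g w k • e' k)) ∂ν := by
    have h1 : ∀ w, inner ℂ (∑ i, D.h w i • e i) (B (∑ k, D.g w k • e' k))
        = ∑ i, ∑ k, (starRingEnd ℂ (D.h w i) * D.g w k) * inner ℂ (e i) (B (e' k)) := by
      intro w
      rw [map_sum, sum_inner]
      refine Finset.sum_congr rfl fun i _ => ?_
      rw [inner_sum]
      refine Finset.sum_congr rfl fun k _ => ?_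
      rw [map_smul, inner_smul_left, inner_smul_right]
      ring
    simp_rw [h1]
    rw [integral_finsetSum _ fun i _ => integrable_finsetSum _ fun k _ =>
      (D.integrable i k).mul_const _]
    refine Finset.sum_congr rfl fun i _ => ?_
    rw [integral_finsetSum _ fun k _ => (D.integrable i k).mul_const _]
    refine Finset.sum_congr rfl fun k _ => ?_
    rw [integral_mul_const, hcoef, coeff]
    ring
  rw [hsum, bound]
  have hn : 0 ≤ ν.real univ := measureReal_nonneg
  have hG := D.G_nonneg
  have hγ := D.γ_nonneg
  have hop := D.op_pos
  have hhs := D.hs_pos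
  have hdouble : ∀ x : ℝ, 0 ≤ x → x ≤ 2 * x := fun x hx => by linarith
  refine le_trans ?_ (hdouble _ (by positivity))
  rcases eq_or_ne p ∞ with rfl | hptop
  · have h1 := hc A B hAB (by rw [MemSchatten, if_pos rfl]; exact isCompactOperator_finOp _ _)
    simp only [schattenNorm, if_true] at h1
    rw [enorm_le_iff_norm_le] at h1
    have hBn : ‖B‖ ^ 2 ≤ D.op := (pow_le_pow_left₀ (norm_nonneg _) h1 2).trans hAn
    refine (hgB.norm_integral_le_opNorm hG hhm D.z_nonneg hhz).trans ?_
    have e1 : 2 * |((∞ : ℝ≥0∞)⁻¹).toReal - 1 / 2| = 1 := by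
      simp [abs_of_nonneg]
    rw [e1]
    rw [Real.rpow_one, sub_self, Real.rpow_zero, mul_one]
    refine mul_le_mul_of_nonneg_left (Real.sqrt_le_sqrt ?_) (Real.sqrt_nonneg _)
    gcongr
  · set r := p.toReal / 2 with hr
    have hp2 : 2 ≤ p.toReal := by
      have := ENNReal.toReal_mono hptop hp
      simpa using this
    have hr1 : 1 ≤ r := by rw [hr]; linarith
    have hτA : absTrace r A ≤ ENNReal.ofReal (D.op ^ (r - 1) * D.hs) := by
      refine (absTrace_le_of_one_le hr1 A).trans ?_
      rw [ENNReal.ofReal_mul (by positivity)]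
      have : (‖A‖ ^ 2) ^ (r - 1) ≤ D.op ^ (r - 1) :=
        Real.rpow_le_rpow (by positivity) hAn (by linarith)
      gcongr
    have h1 := hc A B hAB (by
      rw [MemSchatten, if_neg hptop, schattenNorm_eq_absTrace hptop]
      exact ENNReal.rpow_lt_top_of_nonneg (by positivity)
        (ne_top_of_le_ne_top ENNReal.ofReal_ne_top hτA))
    rw [schattenNorm_eq_absTrace hptop, schattenNorm_eq_absTrace hptop,
      ENNReal.rpow_le_rpow_iff (by positivity)] at h1
    refine (hgB.norm_integral_le hG hγ hhm D.z_nonneg hhz hr1 (by positivity)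
      (h1.trans hτA)).trans (le_of_eq ?_)
    congr 2
    have e0 : (p⁻¹).toReal = 1 / p.toReal := by rw [ENNReal.toReal_inv, one_div]
    have e1 : 2 * |(p⁻¹).toReal - 1 / 2| = 1 - 1 / r := by
      have : 1 / p.toReal ≤ 1 / 2 := one_div_le_one_div_of_le (by norm_num) hp2
      rw [e0, abs_of_nonpos (by linarith), hr]
      field_simp
      ring
    have e2 : D.γ * (D.op ^ (r - 1) * D.hs) = D.op ^ (r - 1) * (D.γ * D.hs) := by ring
    have e3 : (r - 1) * (1 / r) = 1 - 1 / r := by field_simp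
    have e4 : (D.op ^ (r - 1) * (D.γ * D.hs)) ^ (1 / r)
        = D.op ^ (1 - 1 / r) * (D.γ * D.hs) ^ (1 / r) := by
      rw [Real.mul_rpow (by positivity) (by positivity), ← Real.rpow_mul hop.le, e3]
    rw [e1, sub_sub_cancel, e2, e4, Real.mul_rpow (by positivity) hop.le]
    ring

/-- For `p < 2` the roles are exchanged: the multiplier acts on the matrix of the integrals of `conj
h * g`, estimated in `S_p`, and the image is paired with the matrix `D.a`. The linear form on
symbols is the same, and so is the bound. -/
theorem norm_sum_le_of_lt_two (D : TestData ν I K) (hM : MemLp M ∞ (μ.prod μ))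
    (hp1 : 1 ≤ p) (hp : p < 2) (hc : SchurContractive p μ M) (hS : ∀ i, MeasurableSet (S i))
    (hT : ∀ k, MeasurableSet (T k)) (hSd : Pairwise fun i j => Disjoint (S i) (S j))
    (hTd : Pairwise fun i j => Disjoint (T i) (T j)) (hSpos : ∀ i, 0 < μ.real (S i))
    (hTpos : ∀ i, 0 < μ.real (T i)) :
    ‖∑ i, ∑ k, D.coeff i k * blockMean μ M (S i) (T k)‖ ≤ D.bound |(p⁻¹).toReal - 1 / 2| := by
  set e := fun i => unitIndicator μ (S i) (hS i) with he_def
  set e' := fun k => unitIndicator μ (T k) (hT k) with he'_def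
  have he : Orthonormal ℂ e := orthonormal_unitIndicator hS hSd hSpos
  have he' : Orthonormal ℂ e' := orthonormal_unitIndicator hT hTd hTpos
  have hptop : p ≠ ∞ := (hp.trans (by norm_num)).ne
  have hp1' : 1 ≤ p.toReal := by
    have := ENNReal.toReal_mono hptop hp1
    simpa using this
  have hp2' : p.toReal < 2 := by
    have := (ENNReal.toReal_lt_toReal hptop (by norm_num)).2 hp
    simpa using this
  have hn : 0 ≤ ν.real univ := measureReal_nonneg
  have hG := D.G_nonneg
  have hγ := D.γ_nonneg
  have hop := D.op_pos
  have hhs := D.hs_pos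
  set t : I → K → ℂ := fun i k => ∫ w, starRingEnd ℂ (D.h w i) * D.g w k ∂ν with ht
  obtain ⟨B, hAB, hB⟩ := exists_isSchurImage hS hT t hM
  set X' := finOp e fun i => ∑ k, starRingEnd ℂ (t i k) • e' k with hX'
  have hMi : Integrable M (μ.prod μ) := hM.integrable le_top
  have hcoef : ∀ i k, inner ℂ (e i) (B (e' k)) = t i k * blockMean μ M (S i) (T k) :=
    inner_isSchurImage hS hT hSd hTd hSpos hTpos t hMi hB
  have hconj : ∀ f : K → ℂ, ∀ c : K → ℂ, ‖∑ k, starRingEnd ℂ (c k) * f k‖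
      = ‖∑ k, c k * starRingEnd ℂ (f k)‖ := by
    intro f c
    rw [← RCLike.norm_conj, map_sum]
    simp
  -- the operator which is tested
  set c : I → K → ℂ := fun i k => starRingEnd ℂ (D.a i k) with hcdef
  set A := finOp e fun i => ∑ k, starRingEnd ℂ (c i k) • e' k with hA
  have hAn : ‖A‖ ^ 2 ≤ D.op := by
    refine norm_finOp_sq_le he he' hop.le fun f => ?_
    simp_rw [hcdef, hconj]
    refine (D.op_le _).trans (le_of_eq ?_)
    simp
  have hAtr : posTrace (star A * A) ≤ ENNReal.ofReal D.hs := by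
    refine posTrace_finOp_le he he' (le_of_eq_of_le ?_ D.hs_le)
    simp [hcdef]
  have hgB : IsBesselFamily ν (fun w => ∑ k, starRingEnd ℂ (D.g w k) • e' k) D.G D.γ := by
    refine isBesselFamily_sum he' (fun k => Complex.continuous_conj.comp_aestronglyMeasurable
      (D.meas_g k)) hγ (fun w => ?_) fun f => ?_
    · simpa using D.norm_g w
    · have := D.bessel fun k => starRingEnd ℂ (f k)
      simp_rw [hconj] at this ⊢
      simpa using this
  have hhm : AEStronglyMeasurable (fun w => ∑ i, starRingEnd ℂ (D.h w i) • e i) ν :=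
    Finset.aestronglyMeasurable_fun_sum _ fun k _ =>
      (Complex.continuous_conj.comp_aestronglyMeasurable (D.meas_h k)).smul_const _
  have hhz : ∫⁻ w, ENNReal.ofReal (‖∑ i, starRingEnd ℂ (D.h w i) • e i‖ ^ 2) ∂ν
      ≤ ENNReal.ofReal D.z := by
    simp_rw [norm_sum_smul_sq he, RCLike.norm_conj]; exact D.norm_h
  obtain ⟨τ, hτ0, hτ, hτle⟩ := exists_absTrace_finOp_le he he' (t := t)
    (hc := fun w i => starRingEnd ℂ (D.h w i)) (gc := fun w k => starRingEnd ℂ (D.g w k))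
    (fun i k => by simpa using D.integrable i k) (fun i k => by simp [ht]) hG hγ D.z_nonneg
    hgB hhm hhz hp1' hp2'
  have h1 := hc X' B hAB (by
    rw [MemSchatten, if_neg hptop, schattenNorm_eq_absTrace hptop, hτ]
    exact ENNReal.rpow_lt_top_of_nonneg (by positivity) ENNReal.ofReal_ne_top)
  rw [schattenNorm_eq_absTrace hptop, schattenNorm_eq_absTrace hptop,
    ENNReal.rpow_le_rpow_iff (by positivity), hτ] at h1
  have hsum : ∑ i, ∑ k, D.coeff i k * blockMean μ M (S i) (T k)
      = ∑ k, inner ℂ (A (e' k)) (B (e' k)) := by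
    rw [Finset.sum_comm]
    refine Finset.sum_congr rfl fun k _ => ?_
    rw [hA, finOp_apply_basis e he', sum_inner]
    refine Finset.sum_congr rfl fun i _ => ?_
    rw [inner_smul_left, hcoef, coeff]
    simp only [hcdef, ht, RCLike.conj_conj]
    ring
  rw [hsum]
  refine (norm_sum_inner_le_absTrace he' A B hp1' hp2' hop hhs hτ0 hAn hAtr h1).trans ?_
  rw [bound]
  refine mul_le_mul_of_nonneg_left ?_ (by norm_num)
  have hp0 : 0 < p.toReal := by linarith
  have e0 : (p⁻¹).toReal = 1 / p.toReal := by rw [ENNReal.toReal_inv, one_div]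
  have hh : 1 / 2 ≤ 1 / p.toReal := one_div_le_one_div_of_le hp0 hp2'.le
  have e1 : 2 * |(p⁻¹).toReal - 1 / 2| = 2 / p.toReal - 1 := by
    rw [e0, abs_of_nonneg (by linarith)]
    ring
  have e2 : 1 - (2 / p.toReal - 1) = 2 - 2 / p.toReal := by ring
  rw [e1, e2]
  calc D.op ^ (1 / p.toReal - 1 / 2) * D.hs ^ (1 - 1 / p.toReal) * τ ^ (1 / p.toReal)
      ≤ D.op ^ (1 / p.toReal - 1 / 2) * D.hs ^ (1 - 1 / p.toReal) *
        (Real.sqrt D.z * Real.sqrt ((ν.real univ * D.G) ^ (2 / p.toReal - 1) *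
          D.γ ^ (2 - 2 / p.toReal))) := by gcongr
    _ = _ := by
        have e3 : D.op ^ (1 / p.toReal - 1 / 2) = Real.sqrt (D.op ^ (2 / p.toReal - 1)) := by
          rw [Real.sqrt_eq_rpow, ← Real.rpow_mul hop.le]; ring_nf
        have e4 : D.hs ^ (1 - 1 / p.toReal) = Real.sqrt (D.hs ^ (2 - 2 / p.toReal)) := by
          rw [Real.sqrt_eq_rpow, ← Real.rpow_mul hhs.le]; ring_nf
        rw [e3, e4, Real.mul_rpow (by positivity) hop.le, Real.mul_rpow hγ hhs.le,
          Real.sqrt_mul (by positivity), Real.sqrt_mul (by positivity),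
          Real.sqrt_mul (by positivity), Real.sqrt_mul (by positivity)]
        ring

theorem norm_sum_le (D : TestData ν I K) (hM : MemLp M ∞ (μ.prod μ))
    (hp1 : 1 ≤ p) (hc : SchurContractive p μ M) (hS : ∀ i, MeasurableSet (S i))
    (hT : ∀ k, MeasurableSet (T k)) (hSd : Pairwise fun i j => Disjoint (S i) (S j))
    (hTd : Pairwise fun i j => Disjoint (T i) (T j)) (hSpos : ∀ i, 0 < μ.real (S i))
    (hTpos : ∀ i, 0 < μ.real (T i)) :
    ‖∑ i, ∑ k, D.coeff i k * blockMean μ M (S i) (T k)‖ ≤ D.bound |(p⁻¹).toReal - 1 / 2| := by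
  rcases lt_or_ge p 2 with h | h
  · exact D.norm_sum_le_of_lt_two hM hp1 h hc hS hT hSd hTd hSpos hTpos
  · exact D.norm_sum_le_of_two_le hM h hc hS hT hSd hTd hSpos hTpos

end TestData

end Transfer

/-! ### From disjoint cells to points, and from points to overlapping balls. -/

section Points

open Filter Topology Metric

variable {X : Type*} [MeasurableSpace X] {μ : Measure X} [IsFiniteMeasure μ]

open ProbabilityTheory in
theorem integral_prod_cond (M : X × X → ℂ) (S T : Set X) :
    ∫ z, M z ∂((μ[|S]).prod (μ[|T])) = blockMean μ M S T := by
  rw [blockMean, ProbabilityTheory.cond, ProbabilityTheory.cond, Measure.prod_smul_left,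
    Measure.prod_smul_right, integral_smul_measure, integral_smul_measure, Measure.prod_restrict,
    ENNReal.toReal_inv, ENNReal.toReal_inv, smul_smul]
  simp [Measure.real, Complex.real_smul]

variable [MetricSpace X] [BorelSpace X] [SecondCountableTopology X]

/-- Almost every pair is a Lebesgue point for the means over products of balls. -/
def HasLebesguePoints (μ : Measure X) (M : X × X → ℂ) : Prop :=
  ∀ᵐ z ∂(μ.prod μ), Tendsto (fun r => blockMean μ M (closedBall z.1 r) (closedBall z.2 r))
    (𝓝[>] 0) (𝓝 (M z))

omit [IsFiniteMeasure μ] in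
theorem ae_pi_ne [NullSingletonClass μ] {I : Type*} [Fintype I] {P : I → Measure X}
    [∀ i, IsProbabilityMeasure (P i)] (hP : ∀ i, P i ≪ μ) {i j : I} (hij : i ≠ j) :
    ∀ᵐ ω ∂(Measure.pi P), ω i ≠ ω j := by
  have hind := (ProbabilityTheory.iIndepFun_pi (μ := P) (X := fun i (x : X) => x)
    (fun i => aemeasurable_id)).indepFun hij
  rw [ProbabilityTheory.indepFun_iff_map_prod_eq_prod_map_map
    (measurable_pi_apply i).aemeasurable (measurable_pi_apply j).aemeasurable] at hind
  rw [(measurePreserving_eval P i).map_eq, (measurePreserving_eval P j).map_eq] at hind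
  have hdiag : ∀ᵐ z ∂((P i).prod (P j)), z.1 ≠ z.2 := by
    rw [ae_iff]
    have hm : MeasurableSet {z : X × X | ¬ z.1 ≠ z.2} := by
      convert measurableSet_diagonal (α := X) using 1
      ext z
      simp
    rw [Measure.measure_prod_null hm]
    refine Eventually.of_forall fun x => ?_
    refine hP j ?_
    have : Prod.mk x ⁻¹' {z : X × X | ¬ z.1 ≠ z.2} ⊆ {x} := by
      intro y hy
      simpa [eq_comm] using hy
    exact measure_mono_null this (measure_singleton x)
  rw [← hind] at hdiag
  exact ae_of_ae_map ((measurable_pi_apply i).prodMk (measurable_pi_apply j)).aemeasurable hdiag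

variable {W : Type*} [MeasurableSpace W] {ν : Measure W} [IsFiniteMeasure ν]
variable {I K : Type*} [Fintype I] [Fintype K]

theorem eventually_pairwise_disjoint_closedBall {X : Type*} [MetricSpace X] {x : I → X} (hx : Pairwise fun i j => x i ≠ x j) :
    ∀ᶠ r in 𝓝[>] (0 : ℝ), Pairwise fun i j =>
      Disjoint (closedBall (x i) r) (closedBall (x j) r) := by
  have h : ∀ i j, ∀ᶠ r in 𝓝[>] (0 : ℝ), i ≠ j →
      Disjoint (closedBall (x i) r) (closedBall (x j) r) := by
    intro i j
    by_cases hij : i = j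
    · exact Eventually.of_forall fun r h => absurd hij h
    · have h1 : 0 < dist (x i) (x j) / 2 := half_pos (dist_pos.2 (hx hij))
      filter_upwards [Ioo_mem_nhdsGT h1] with r hr _
      refine closedBall_disjoint_closedBall ?_
      linarith [hr.2]
  filter_upwards [eventually_all.2 fun i => eventually_all.2 (h i)] with r hr i j hij
  exact hr i j hij

omit [SecondCountableTopology X] in
-- Small balls around distinct points are disjoint, so they are admissible cells, and their radius
-- can be sent to 0.
theorem TestData.norm_sum_le_of_tendsto [μ.IsOpenPosMeasure] (D : TestData ν I K) {M : X × X → ℂ}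
    {p : ℝ≥0∞} (hM : MemLp M ∞ (μ.prod μ)) (hp1 : 1 ≤ p) (hc : SchurContractive p μ M)
    {x : I → X} {y : K → X} (hx : Pairwise fun i j => x i ≠ x j)
    (hy : Pairwise fun i j => y i ≠ y j)
    (hlim : ∀ i k, Tendsto (fun r => blockMean μ M (closedBall (x i) r) (closedBall (y k) r))
      (𝓝[>] 0) (𝓝 (M (x i, y k)))) :
    ‖∑ i, ∑ k, D.coeff i k * M (x i, y k)‖ ≤ D.bound |(p⁻¹).toReal - 1 / 2| := by
  have h1 : Tendsto (fun r => ‖∑ i, ∑ k, D.coeff i k *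
      blockMean μ M (closedBall (x i) r) (closedBall (y k) r)‖) (𝓝[>] 0)
      (𝓝 ‖∑ i, ∑ k, D.coeff i k * M (x i, y k)‖) :=
    (tendsto_finsetSum _ fun i _ => tendsto_finsetSum _ fun k _ =>
      (hlim i k).const_mul _).norm
  refine le_of_tendsto h1 ?_
  filter_upwards [eventually_pairwise_disjoint_closedBall hx,
    eventually_pairwise_disjoint_closedBall hy, self_mem_nhdsWithin] with r h1 h2 hr
  have hpos : ∀ z : X, 0 < μ.real (closedBall z r) := fun z =>
    ENNReal.toReal_pos (measure_closedBall_pos μ z hr).ne' (measure_ne_top _ _)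
  exact D.norm_sum_le hM hp1 hc (fun _ => measurableSet_closedBall)
    (fun _ => measurableSet_closedBall) h1 h2 (fun _ => hpos _) (fun _ => hpos _)

open ProbabilityTheory in
-- Here the balls may overlap or coincide, which disjoint cells do not allow. Points drawn
-- independently and uniformly in the balls are almost surely distinct and form Lebesgue pairs, so
-- the pointwise inequality applies to them; the expectation of the linear form is the form
-- evaluated at the ball means.
theorem TestData.norm_sum_closedBall_le [μ.IsOpenPosMeasure] [NullSingletonClass μ] (D : TestData ν I K)
    {M : X × X → ℂ} {p : ℝ≥0∞} (hM : MemLp M ∞ (μ.prod μ)) (hL : HasLebesguePoints μ M)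
    (hp1 : 1 ≤ p) (hc : SchurContractive p μ M) (x : I → X) (y : K → X) {r : ℝ} (hr : 0 < r) :
    ‖∑ i, ∑ k, D.coeff i k * blockMean μ M (closedBall (x i) r) (closedBall (y k) r)‖
      ≤ D.bound |(p⁻¹).toReal - 1 / 2| := by
  set P : I → Measure X := fun i => μ[|closedBall (x i) r] with hPdef
  set Q : K → Measure X := fun k => μ[|closedBall (y k) r] with hQdef
  have hP1 : ∀ i, IsProbabilityMeasure (P i) := fun i =>
    cond_isProbabilityMeasure (measure_closedBall_pos μ _ hr).ne'
  have hQ1 : ∀ k, IsProbabilityMeasure (Q k) := fun i =>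
    cond_isProbabilityMeasure (measure_closedBall_pos μ _ hr).ne'
  have hPac : ∀ i, P i ≪ μ := fun i => cond_absolutelyContinuous
  have hQac : ∀ k, Q k ≪ μ := fun i => cond_absolutelyContinuous
  have hmp : ∀ i k, MeasurePreserving (Prod.map (Function.eval i) (Function.eval k))
      ((Measure.pi P).prod (Measure.pi Q)) ((P i).prod (Q k)) := fun i k =>
    (measurePreserving_eval P i).prod (measurePreserving_eval Q k)
  have hac : ∀ i k, (P i).prod (Q k) ≪ μ.prod μ := fun i k => (hPac i).prod (hQac k)
  have hMb := hM.aestronglyMeasurable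
  have hMi : ∀ i k, Integrable M ((P i).prod (Q k)) := by
    intro i k
    have h1 : MemLp M ∞ ((P i).prod (Q k)) :=
      ⟨hMb.mono_ac (hac i k), (eLpNormEssSup_mono_measure M (hac i k)).trans_lt hM.2⟩
    exact h1.integrable le_top
  have hint : ∀ i k, ∫ ω, M (ω.1 i, ω.2 k) ∂((Measure.pi P).prod (Measure.pi Q))
      = blockMean μ M (closedBall (x i) r) (closedBall (y k) r) := by
    intro i k
    rw [← integral_prod_cond, ← (hmp i k).map_eq, integral_map (hmp i k).aemeasurable]
    · rfl
    · rw [(hmp i k).map_eq]; exact (hMi i k).1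
  have hint' : ∀ i k, Integrable (fun ω : (I → X) × (K → X) => M (ω.1 i, ω.2 k))
      ((Measure.pi P).prod (Measure.pi Q)) := fun i k => (hmp i k).integrable_comp_of_integrable (hMi i k)
  have hsum : ∑ i, ∑ k, D.coeff i k * blockMean μ M (closedBall (x i) r) (closedBall (y k) r)
      = ∫ ω, ∑ i, ∑ k, D.coeff i k * M (ω.1 i, ω.2 k) ∂((Measure.pi P).prod (Measure.pi Q)) := by
    rw [integral_finsetSum _ fun i _ => integrable_finsetSum _ fun k _ =>
      (hint' i k).const_mul _]
    refine Finset.sum_congr rfl fun i _ => ?_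
    rw [integral_finsetSum _ fun k _ => (hint' i k).const_mul _]
    refine Finset.sum_congr rfl fun k _ => ?_
    rw [integral_const_mul, hint]
  rw [hsum]
  have hae : ∀ᵐ ω ∂((Measure.pi P).prod (Measure.pi Q)),
      ‖∑ i, ∑ k, D.coeff i k * M (ω.1 i, ω.2 k)‖ ≤ D.bound |(p⁻¹).toReal - 1 / 2| := by
    have e1 : ∀ᵐ ω ∂((Measure.pi P).prod (Measure.pi Q)), ∀ i k,
        Tendsto (fun r => blockMean μ M (closedBall (ω.1 i) r) (closedBall (ω.2 k) r))
          (𝓝[>] 0) (𝓝 (M (ω.1 i, ω.2 k))) := by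
      rw [ae_all_iff]; intro i
      rw [ae_all_iff]; intro k
      exact (hmp i k).quasiMeasurePreserving.ae ((hac i k).ae_le hL)
    have e2 : ∀ᵐ ω ∂((Measure.pi P).prod (Measure.pi Q)), ∀ i j, i ≠ j → ω.1 i ≠ ω.1 j := by
      rw [ae_all_iff]; intro i
      rw [ae_all_iff]; intro j
      by_cases hij : i = j
      · exact Eventually.of_forall fun ω h => absurd hij h
      · filter_upwards [Measure.quasiMeasurePreserving_fst.ae (ae_pi_ne hPac hij)] with ω h _
        exact h
    have e3 : ∀ᵐ ω ∂((Measure.pi P).prod (Measure.pi Q)), ∀ i j, i ≠ j → ω.2 i ≠ ω.2 j := by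
      rw [ae_all_iff]; intro i
      rw [ae_all_iff]; intro j
      by_cases hij : i = j
      · exact Eventually.of_forall fun ω h => absurd hij h
      · filter_upwards [Measure.quasiMeasurePreserving_snd.ae (ae_pi_ne hQac hij)] with ω h _
        exact h
    filter_upwards [e1, e2, e3] with ω h1 h2 h3
    exact D.norm_sum_le_of_tendsto hM hp1 hc (fun i j => h2 i j) (fun i j => h3 i j) h1
  refine (norm_integral_le_of_norm_le_const hae).trans (le_of_eq ?_)
  simp

end Points

/-! ### Lebesgue points for products of balls. -/

section Sphere

open Filter Topology Metric

/-- The measure is pushed to the finite dimensional space `E × E`, where Besicovitch differentiation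
holds for every finite measure. Balls of the sup metric pull back to products of balls of the same
radius. -/
theorem hasLebesguePoints_of_isClosedEmbedding {X E : Type*} [MeasurableSpace X] [MetricSpace X]
    [BorelSpace X] [SecondCountableTopology X] [NormedAddCommGroup E] [NormedSpace ℝ E]
    [FiniteDimensional ℝ E] [MeasurableSpace E] [BorelSpace E] {μ : Measure X} [IsFiniteMeasure μ]
    {ι : X → E} (hι : Isometry ι) (hc : Topology.IsClosedEmbedding ι) {M : X × X → ℂ}
    (hM : Integrable M (μ.prod μ)) : HasLebesguePoints μ M := by
  set j : X × X → E × E := Prod.map ι ι with hj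
  have hji : Isometry j := hι.prodMap hι
  have hjc : Topology.IsClosedEmbedding j := hc.prodMap hc
  have hjm : MeasurableEmbedding j := hjc.measurableEmbedding
  set ρ : Measure (E × E) := (μ.prod μ).map j with hρ
  have : IsFiniteMeasure ρ := Measure.isFiniteMeasure_map _ _
  set f : E × E → ℂ := Function.extend j M 0 with hf
  have hfj : ∀ z, f (j z) = M z := fun z => hji.injective.extend_apply _ _ _
  have hfi : Integrable f ρ := by
    rw [hρ, hjm.integrable_map_iff]
    refine hM.congr (Eventually.of_forall fun z => ?_)
    exact (hfj z).symm
  have h1 := (Besicovitch.vitaliFamily ρ).ae_tendsto_average hfi.locallyIntegrable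
  have h2 := ae_of_ae_map hjm.measurable.aemeasurable h1
  filter_upwards [h2] with z hz
  rw [hfj] at hz
  refine (hz.comp (Besicovitch.tendsto_filterAt ρ (j z))).congr' ?_
  refine Eventually.of_forall fun r => ?_
  have hpre : j ⁻¹' closedBall (j z) r = closedBall z.1 r ×ˢ closedBall z.2 r := by
    rw [hji.preimage_closedBall, closedBall_prod_same]
  simp only [Function.comp_apply]
  rw [setAverage_eq, hρ, hjm.setIntegral_map, hpre, blockMean, Measure.real,
    Measure.map_apply hjm.measurable measurableSet_closedBall, hpre, Measure.prod_prod,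
    ENNReal.toReal_mul, mul_inv]
  simp only [hfj]
  rfl

end Sphere

/-! ### Rotation invariance, and null sets of angles. -/

section Sphere

open Filter Topology Metric
open scoped Pointwise

variable {d : ℕ}

/-- The map induced by a linear isometry on the unit sphere. -/
def sphereMap (U : EuclideanSpace ℝ (Fin (d + 1)) ≃ₗᵢ[ℝ] EuclideanSpace ℝ (Fin (d + 1)))
    (x : UnitSphere d) : UnitSphere d :=
  ⟨U x, by simp⟩

theorem isometry_sphereMap
    (U : EuclideanSpace ℝ (Fin (d + 1)) ≃ₗᵢ[ℝ] EuclideanSpace ℝ (Fin (d + 1))) :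
    Isometry (sphereMap U) := fun x y => U.isometry x y

instance : IsFiniteMeasure (sphereMeasure d) := by unfold sphereMeasure; infer_instance

instance : (sphereMeasure d).IsOpenPosMeasure := by unfold sphereMeasure; infer_instance

theorem sphereMeasure_apply {s : Set (UnitSphere d)} (hs : MeasurableSet s) :
    sphereMeasure d s = (d + 1 : ℕ) *
      (volume : Measure (EuclideanSpace ℝ (Fin (d + 1)))) (Ioo (0 : ℝ) 1 • (Subtype.val '' s)) := by
  rw [sphereMeasure, Measure.toSphere_apply' _ hs, finrank_euclideanSpace_fin]

theorem measurePreserving_sphereMap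
    (U : EuclideanSpace ℝ (Fin (d + 1)) ≃ₗᵢ[ℝ] EuclideanSpace ℝ (Fin (d + 1))) :
    MeasurePreserving (sphereMap U) (sphereMeasure d) (sphereMeasure d) := by
  have hm : Measurable (sphereMap U) := (isometry_sphereMap U).continuous.measurable
  refine ⟨hm, ?_⟩
  ext s hs
  rw [Measure.map_apply hm hs, sphereMeasure_apply hs, sphereMeasure_apply (hm hs)]
  congr 1
  have h : Ioo (0 : ℝ) 1 • ((↑) '' (sphereMap U ⁻¹' s) : Set (EuclideanSpace ℝ (Fin (d + 1))))
      = U ⁻¹' (Ioo (0 : ℝ) 1 • ((↑) '' s)) := by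
    ext v
    simp only [Set.mem_smul, mem_image, mem_preimage, exists_exists_and_eq_and]
    constructor
    · rintro ⟨r, hr, x, hx, rfl⟩
      exact ⟨r, hr, sphereMap U x, hx, by simp [sphereMap]⟩
    · rintro ⟨r, hr, y, hy, h⟩
      refine ⟨r, hr, sphereMap U.symm y, ?_, ?_⟩
      · convert hy
        ext1
        simp [sphereMap]
      · have := congrArg U.symm h
        simpa [sphereMap] using this
  rw [h]
  exact U.measurePreserving.measure_preimage_emb U.toHomeomorph.measurableEmbedding _

/-- Two reflections: the first sends `x` to `x'`, the second sends the image of `y` to `y'` and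
fixes `x'` because the inner products agree. -/
theorem exists_linearIsometryEquiv_pair {E : Type*} [NormedAddCommGroup E] [InnerProductSpace ℝ E]
    {x y x' y' : E} (hx : ‖x‖ = ‖x'‖) (hy : ‖y‖ = ‖y'‖) (h : inner ℝ x y = inner ℝ x' y') :
    ∃ U : E ≃ₗᵢ[ℝ] E, U x = x' ∧ U y = y' := by
  set U₁ := (Submodule.span ℝ {x - x'})ᗮ.reflection with hU₁
  have h1 : U₁ x = x' := Submodule.reflection_sub hx
  set y₁ := U₁ y with hy₁
  have hny : ‖y₁‖ = ‖y'‖ := by rw [hy₁, U₁.norm_map, hy]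
  have hin : inner ℝ x' y₁ = inner ℝ x' y' := by rw [← h, ← h1, hy₁, U₁.inner_map_map]
  set U₂ := (Submodule.span ℝ {y₁ - y'})ᗮ.reflection with hU₂
  have h2 : U₂ y₁ = y' := Submodule.reflection_sub hny
  have h3 : U₂ x' = x' := by
    rw [hU₂, Submodule.reflection_eq_self_iff, Submodule.mem_orthogonal_singleton_iff_inner_left,
      inner_sub_right, hin, sub_self]
  exact ⟨U₁.trans U₂, by simp [h1, h3], by simp [h2, ← hy₁]⟩

/-- The mean of a symbol over a product of two balls of the same radius. -/
def ballMean (M : UnitSphere d × UnitSphere d → ℂ) (r : ℝ) (x y : UnitSphere d) : ℂ :=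
  blockMean (sphereMeasure d) M (closedBall x r) (closedBall y r)

theorem ballMean_sphereMap (m : ℝ → ℂ) (r : ℝ) (x y : UnitSphere d)
    (U : EuclideanSpace ℝ (Fin (d + 1)) ≃ₗᵢ[ℝ] EuclideanSpace ℝ (Fin (d + 1))) :
    ballMean (zonalSymbol d m) r (sphereMap U x) (sphereMap U y)
      = ballMean (zonalSymbol d m) r x y := by
  have hU := measurePreserving_sphereMap U
  have hUU := hU.prod hU
  have hiso := isometry_sphereMap U
  have hemb : MeasurableEmbedding (Prod.map (sphereMap U) (sphereMap U)) :=
    (hiso.isClosedEmbedding.prodMap hiso.isClosedEmbedding).measurableEmbedding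
  have hb : ∀ z, (sphereMeasure d).real (closedBall (sphereMap U z) r)
      = (sphereMeasure d).real (closedBall z r) := by
    intro z
    rw [Measure.real, ← hU.measure_preimage measurableSet_closedBall.nullMeasurableSet,
      hiso.preimage_closedBall, Measure.real]
  rw [ballMean, ballMean, blockMean, blockMean, hb, hb,
    ← hUU.setIntegral_preimage_emb hemb, preimage_prod_map_prod, hiso.preimage_closedBall,
    hiso.preimage_closedBall]
  simp [zonalSymbol, sphereMap]

theorem ballMean_congr (m : ℝ → ℂ) (r : ℝ) {x y x' y' : UnitSphere d}
    (h : inner ℝ (x : EuclideanSpace ℝ (Fin (d + 1))) (y : EuclideanSpace ℝ (Fin (d + 1)))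
      = inner ℝ (x' : EuclideanSpace ℝ (Fin (d + 1))) (y' : EuclideanSpace ℝ (Fin (d + 1)))) :
    ballMean (zonalSymbol d m) r x y = ballMean (zonalSymbol d m) r x' y' := by
  obtain ⟨U, hx, hy⟩ := exists_linearIsometryEquiv_pair (by simp) (by simp) h
  have e1 : sphereMap U x = x' := Subtype.ext hx
  have e2 : sphereMap U y = y' := Subtype.ext hy
  rw [← e1, ← e2, ballMean_sphereMap]

/-- A great circle on the sphere. -/
def greatCircle (d : ℕ) (hd : 1 ≤ d) (s : ℝ) : UnitSphere d :=
  ⟨Real.cos s • EuclideanSpace.single 0 1 + Real.sin s • EuclideanSpace.single ⟨1, by omega⟩ 1, by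
    have h : inner ℝ (Real.cos s • (EuclideanSpace.single 0 1 : EuclideanSpace ℝ (Fin (d + 1))))
        (Real.sin s • EuclideanSpace.single ⟨1, by omega⟩ 1) = 0 := by
      simp [inner_smul_left, inner_smul_right, EuclideanSpace.inner_single_left, Fin.ext_iff]
    rw [mem_sphere_zero_iff_norm, ← sq_eq_sq₀ (norm_nonneg _) zero_le_one, pow_two,
      norm_add_sq_eq_norm_sq_add_norm_sq_of_inner_eq_zero _ _ h, norm_smul, norm_smul]
    simp only [PiLp.norm_single, norm_one, mul_one, Real.norm_eq_abs, abs_mul_abs_self]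
    nlinarith [Real.sin_sq_add_cos_sq s]⟩

theorem inner_greatCircle (hd : 1 ≤ d) (s : ℝ) :
    inner ℝ (greatCircle d hd 0 : EuclideanSpace ℝ (Fin (d + 1)))
      (greatCircle d hd s : EuclideanSpace ℝ (Fin (d + 1))) = Real.cos s := by
  simp [greatCircle, inner_add_right, inner_smul_right, EuclideanSpace.inner_single_left,
    Fin.ext_iff]

theorem continuous_greatCircle (hd : 1 ≤ d) : Continuous (greatCircle d hd) := by
  unfold greatCircle
  fun_prop

theorem nullSingletonClass_sphereMeasure (hd : 1 ≤ d) : NullSingletonClass (sphereMeasure d) where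
  measure_singleton x := by
    rw [sphereMeasure_apply (measurableSet_singleton x)]
    have h1 : Ioo (0 : ℝ) 1 • ((↑) '' {x} : Set (EuclideanSpace ℝ (Fin (d + 1))))
        ⊆ (Submodule.span ℝ {(x : EuclideanSpace ℝ (Fin (d + 1)))} : Set (EuclideanSpace ℝ (Fin (d + 1)))) := by
      rintro _ ⟨r, hr, _, ⟨y, rfl, rfl⟩, rfl⟩
      exact Submodule.smul_mem _ _ (Submodule.mem_span_singleton_self _)
    have h2 : Submodule.span ℝ {(x : EuclideanSpace ℝ (Fin (d + 1)))} ≠ ⊤ := by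
      intro h
      have h3 := finrank_span_singleton (K := ℝ) (v := (x : EuclideanSpace ℝ (Fin (d + 1))))
        (by intro h0; have := norm_eq_of_mem_sphere x; rw [h0] at this; simp at this)
      rw [h, finrank_top, finrank_euclideanSpace_fin] at h3
      omega
    rw [measure_mono_null h1 (Measure.addHaar_submodule _ _ h2), mul_zero]

/-- Fix a good `x`. The bad points form a null set on the sphere, so the cone over it is null, and
almost every line parallel to `x` meets this cone in a null set. Along such a line, at distance `a >
0` from the axis, the angle with `x` is a differentiable function of the parameter and takes every
value in (0, π); null sets of parameters go to null sets of angles. -/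
theorem ae_cos_of_ae_inner (hd : 1 ≤ d) {G : Set ℝ}
    (h : ∀ᵐ z ∂((sphereMeasure d).prod (sphereMeasure d)),
      inner ℝ (z.1 : EuclideanSpace ℝ (Fin (d + 1))) (z.2 : EuclideanSpace ℝ (Fin (d + 1))) ∈ G) :
    ∀ᵐ s : ℝ, Real.cos s ∈ G := by
  have : NeZero (sphereMeasure d) := ⟨by unfold sphereMeasure; exact Measure.toSphere_ne_zero _⟩
  obtain ⟨x, hx⟩ := (Measure.ae_ae_of_ae_prod h).exists
  have hx1 : ‖(x : EuclideanSpace ℝ (Fin (d + 1)))‖ = 1 := by simp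
  have hxx : inner ℝ (x : EuclideanSpace ℝ (Fin (d + 1))) (x : EuclideanSpace ℝ (Fin (d + 1)))
      = (1 : ℝ) := by rw [real_inner_self_eq_norm_sq, hx1, one_pow]
  set A := toMeasurable (sphereMeasure d) {y | ¬ inner ℝ (x : EuclideanSpace ℝ (Fin (d + 1)))
    (y : EuclideanSpace ℝ (Fin (d + 1))) ∈ G} with hA
  have hA0 : sphereMeasure d A = 0 := by rw [hA, measure_toMeasurable]; exact hx
  rw [sphereMeasure_apply (measurableSet_toMeasurable _ _), mul_eq_zero] at hA0
  have hA1 : volume (Ioo (0 : ℝ) 1 • ((↑) '' A : Set (EuclideanSpace ℝ (Fin (d + 1))))) = 0 :=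
    hA0.resolve_left (by simp)
  set C₀ : Set (EuclideanSpace ℝ (Fin (d + 1))) :=
    ⋃ n : ℕ, (n : ℝ) • (Ioo (0 : ℝ) 1 • ((↑) '' A)) with hC₀
  have hC₀0 : volume C₀ = 0 := by
    rw [hC₀, measure_iUnion_null_iff]
    intro n
    rw [Measure.addHaar_smul, hA1, mul_zero]
  set C := toMeasurable volume C₀ with hC
  have hC0 : ∀ᵐ v : EuclideanSpace ℝ (Fin (d + 1)), v ∈ Cᶜ := by
    exact measure_eq_zero_iff_ae_notMem.1 ((measure_toMeasurable _).trans hC₀0)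
  rw [← ae_ae_add_linearMap_mem_iff (LinearMap.toSpanSingleton ℝ _
    (x : EuclideanSpace ℝ (Fin (d + 1)))) volume volume
    (measurableSet_toMeasurable _ _).compl] at hC0
  have hspan : Submodule.span ℝ {(x : EuclideanSpace ℝ (Fin (d + 1)))} ≠ ⊤ := by
    intro h
    have h3 := finrank_span_singleton (K := ℝ) (v := (x : EuclideanSpace ℝ (Fin (d + 1))))
      (by intro h0; rw [h0] at hx1; simp at hx1)
    rw [h, finrank_top, finrank_euclideanSpace_fin] at h3
    omega
  have hns : ∀ᵐ v : EuclideanSpace ℝ (Fin (d + 1)),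
      v ∉ (Submodule.span ℝ {(x : EuclideanSpace ℝ (Fin (d + 1)))} : Set (EuclideanSpace ℝ (Fin (d + 1)))) :=
    measure_eq_zero_iff_ae_notMem.1 (Measure.addHaar_submodule _ _ hspan)
  obtain ⟨v, hv, hvs⟩ := (hC0.and hns).exists
  set b := inner ℝ (x : EuclideanSpace ℝ (Fin (d + 1))) v with hb
  set w := v - b • (x : EuclideanSpace ℝ (Fin (d + 1))) with hw
  have hw0 : w ≠ 0 := by
    intro h0
    refine hvs ?_
    rw [sub_eq_zero] at h0
    rw [h0]
    exact Submodule.smul_mem _ _ (Submodule.mem_span_singleton_self _)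
  have hxw : inner ℝ (x : EuclideanSpace ℝ (Fin (d + 1))) w = 0 := by
    rw [hw, inner_sub_right, inner_smul_right, hxx, ← hb]; ring
  set a := ‖w‖ with ha
  have ha0 : 0 < a := norm_pos_iff.2 hw0
  have hpos : ∀ t : ℝ, 0 < (t + b) ^ 2 + a ^ 2 := fun t => by positivity
  set q : ℝ → ℝ := fun t => (t + b) / Real.sqrt ((t + b) ^ 2 + a ^ 2) with hq
  have hqG : ∀ᵐ t : ℝ, q t ∈ G := by
    filter_upwards [hv] with t ht
    by_contra hcon
    refine ht ?_
    refine subset_toMeasurable _ _ ?_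
    set u := v + t • (x : EuclideanSpace ℝ (Fin (d + 1))) with hu
    have hu1 : u = (t + b) • (x : EuclideanSpace ℝ (Fin (d + 1))) + w := by
      rw [hu, hw]; module
    have hun : ‖u‖ = Real.sqrt ((t + b) ^ 2 + a ^ 2) := by
      rw [eq_comm, Real.sqrt_eq_iff_mul_self_eq (hpos t).le (norm_nonneg _), hu1,
        norm_add_sq_eq_norm_sq_add_norm_sq_of_inner_eq_zero _ _
          (by rw [inner_smul_left, hxw, mul_zero]), norm_smul, hx1, mul_one, ← ha]
      simp only [Real.norm_eq_abs, abs_mul_abs_self]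
      ring
    have hun0 : 0 < ‖u‖ := by rw [hun]; exact Real.sqrt_pos.2 (hpos t)
    have hux : inner ℝ (x : EuclideanSpace ℝ (Fin (d + 1))) u = t + b := by
      rw [hu1, inner_add_right, inner_smul_right, hxx, hxw]; ring
    obtain ⟨n, hn⟩ := exists_nat_gt ‖u‖
    have hn0 : (0 : ℝ) < n := hun0.trans hn
    refine mem_iUnion.2 ⟨n, ?_⟩
    refine ⟨(n : ℝ)⁻¹ • u, ?_, by simp [smul_smul, hn0.ne', hu]⟩
    refine ⟨(n : ℝ)⁻¹ * ‖u‖, ⟨by positivity, by rw [inv_mul_lt_iff₀ hn0]; simpa using hn⟩,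
      ‖u‖⁻¹ • u, ⟨⟨‖u‖⁻¹ • u, ?_⟩, ?_, rfl⟩, ?_⟩
    · rw [mem_sphere_zero_iff_norm, norm_smul, norm_inv, norm_norm, inv_mul_cancel₀ hun0.ne']
    · refine subset_toMeasurable _ _ ?_
      simp only [mem_ofPred_eq, inner_smul_right, hux, hun]
      rwa [inv_mul_eq_div]
    · simp only [smul_smul]
      congr 1
      field_simp
  set g : ℝ → ℝ := fun t => Real.arccos (q t) with hg
  have hqlt : ∀ t, |q t| < 1 := by
    intro t
    rw [hq, abs_div, abs_of_pos (Real.sqrt_pos.2 (hpos t)), div_lt_one (Real.sqrt_pos.2 (hpos t)),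
      ← Real.sqrt_sq_eq_abs]
    exact Real.sqrt_lt_sqrt (sq_nonneg _) (by nlinarith)
  have hgd : Differentiable ℝ g := by
    intro t
    have h1 : DifferentiableAt ℝ q t := by
      refine DifferentiableAt.div (by fun_prop) (DifferentiableAt.sqrt (by fun_prop) (hpos t).ne')
        (Real.sqrt_pos.2 (hpos t)).ne'
    have h2 := abs_lt.1 (hqlt t)
    exact (Real.differentiableAt_arccos.2 ⟨h2.1.ne', h2.2.ne⟩).comp t h1
  have hgnull : volume (g '' {t | q t ∉ G}) = 0 :=
    addHaar_image_eq_zero_of_differentiableOn_of_addHaar_eq_zero volume hgd.differentiableOn hqG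
  set Z : Set ℝ := g '' {t | q t ∉ G} ∪ {0, Real.pi} with hZ
  have hZ0 : volume Z = 0 :=
    measure_union_null hgnull (Set.Finite.measure_zero (Set.toFinite _) _)
  have hmain : ∀ s ∈ Icc 0 Real.pi, Real.cos s ∉ G → s ∈ Z := by
    intro s hs hsG
    rcases eq_or_lt_of_le hs.1 with h0 | h0
    · right; left; exact h0.symm
    rcases eq_or_lt_of_le hs.2 with h1 | h1
    · right; right; exact h1
    left
    have hsin := Real.sin_pos_of_pos_of_lt_pi h0 h1
    have e1 : q (a * Real.cos s / Real.sin s - b) = Real.cos s := by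
      simp only [hq, sub_add_cancel]
      have e2 : (a * Real.cos s / Real.sin s) ^ 2 + a ^ 2 = (a / Real.sin s) ^ 2 := by
        field_simp
        nlinarith [Real.sin_sq_add_cos_sq s]
      rw [e2, Real.sqrt_sq (by positivity)]
      field_simp
    refine ⟨a * Real.cos s / Real.sin s - b, by rw [mem_ofPred_eq, e1]; exact hsG, ?_⟩
    simp only [hg]
    rw [e1, Real.arccos_cos h0.le h1.le]
  -- Any real number is carried into [0, π] by one of these countably many measure preserving maps
  -- without changing its cosine.
  have hall : ∀ᵐ s : ℝ, ∀ k : ℤ, s - 2 * k * Real.pi ∉ Z ∧ 2 * k * Real.pi - s ∉ Z := by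
    rw [ae_all_iff]
    intro k
    have hZ' : ∀ᵐ s : ℝ, s ∉ Z := measure_eq_zero_iff_ae_notMem.1 hZ0
    exact ((measurePreserving_sub_right volume _).quasiMeasurePreserving.ae hZ').and
      ((volume.measurePreserving_sub_left _).quasiMeasurePreserving.ae hZ')
  filter_upwards [hall] with s hs
  by_contra hcon
  have h1 : Real.cos (Real.arccos (Real.cos s)) = Real.cos s :=
    Real.cos_arccos (Real.neg_one_le_cos s) (Real.cos_le_one s)
  have h2 := hmain (Real.arccos (Real.cos s)) ⟨Real.arccos_nonneg _, Real.arccos_le_pi _⟩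
    (by rwa [h1])
  obtain ⟨k, hk⟩ := Real.cos_eq_cos_iff.1 h1
  rcases hk with hk | hk
  · exact (hs k).1 (by rw [hk]; simpa using h2)
  · exact (hs k).2 (by rw [hk]; simpa using h2)

end Sphere

/-! ### Continuous symbols satisfying the tested inequalities. -/

section Tested

open Filter Topology Metric

/-- The continuous functions `φ`, with `φ(s)` depending only on `cos s`, for which the zonal
symbol equal to `φ(s)` at pairs of points at angle `s` satisfies the inequalities given by test data. -/
structure IsTestedSymbol (d : ℕ) (α : ℝ) (φ : ℝ → ℂ) : Prop where
  continuous : Continuous φ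
  congr_cos : ∀ {s t}, Real.cos s = Real.cos t → φ s = φ t
  test : ∀ {W I K : Type} [MeasurableSpace W] [Fintype I] [Fintype K] (ν : Measure W)
    [IsFiniteMeasure ν] (D : TestData ν I K) (x : I → UnitSphere d) (y : K → UnitSphere d)
    (θ : I → K → ℝ), (∀ i k, inner ℝ (x i : EuclideanSpace ℝ (Fin (d + 1)))
      (y k : EuclideanSpace ℝ (Fin (d + 1))) = Real.cos (θ i k)) →
    ‖∑ i, ∑ k, D.coeff i k * φ (θ i k)‖ ≤ D.bound α

/-- Test data for which the linear form is the evaluation at a single point. -/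
def TestData.unit : TestData (Measure.dirac ()) Unit Unit where
  a _ _ := 1
  h _ _ := 1
  g _ _ := 1
  op := 1
  hs := 1
  G := 1
  γ := 1
  z := 1
  op_pos := one_pos
  hs_pos := one_pos
  G_nonneg := zero_le_one
  γ_nonneg := zero_le_one
  z_nonneg := zero_le_one
  op_le f := by simp
  hs_le := by simp
  meas_h _ := aestronglyMeasurable_const
  meas_g _ := aestronglyMeasurable_const
  integrable _ _ := integrable_const _
  norm_g _ := by simp
  bessel f := by simp
  norm_h := by simp

theorem IsTestedSymbol.norm_le {d : ℕ} (hd : 1 ≤ d) {α : ℝ} {φ : ℝ → ℂ}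
    (h : IsTestedSymbol d α φ) (s : ℝ) : ‖φ s‖ ≤ 2 := by
  have h1 := h.test _ TestData.unit (fun _ => greatCircle d hd 0) (fun _ => greatCircle d hd s)
    (fun _ _ => s) fun _ _ => inner_greatCircle hd s
  simpa [TestData.coeff, TestData.bound, TestData.unit] using h1

variable {d : ℕ}

theorem sphereMeasure_preimage_dist (r : ℝ) (x x' : UnitSphere d) :
    sphereMeasure d {y | dist y x = r} = sphereMeasure d {y | dist y x' = r} := by
  obtain ⟨U, hx, -⟩ := exists_linearIsometryEquiv_pair
    (x := (x : EuclideanSpace ℝ (Fin (d + 1)))) (y := (x : EuclideanSpace ℝ (Fin (d + 1))))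
    (x' := (x' : EuclideanSpace ℝ (Fin (d + 1)))) (y' := (x' : EuclideanSpace ℝ (Fin (d + 1))))
    (by simp) (by simp) (by simp)
  have e1 : sphereMap U x = x' := Subtype.ext hx
  have hm : MeasurableSet {y | dist y x' = r} := by
    apply measurableSet_eq_fun (by fun_prop) (by fun_prop)
  rw [← (measurePreserving_sphereMap U).measure_preimage hm.nullMeasurableSet]
  congr 1
  ext y
  simp only [mem_preimage, mem_ofPred_eq]
  rw [← e1, (isometry_sphereMap U).dist_eq]

theorem sphereMeasure_closedBall (r : ℝ) (x x' : UnitSphere d) :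
    sphereMeasure d (closedBall x r) = sphereMeasure d (closedBall x' r) := by
  obtain ⟨U, hx, -⟩ := exists_linearIsometryEquiv_pair
    (x := (x : EuclideanSpace ℝ (Fin (d + 1)))) (y := (x : EuclideanSpace ℝ (Fin (d + 1))))
    (x' := (x' : EuclideanSpace ℝ (Fin (d + 1)))) (y' := (x' : EuclideanSpace ℝ (Fin (d + 1))))
    (by simp) (by simp) (by simp)
  have e1 : sphereMap U x = x' := Subtype.ext hx
  rw [← e1, ← (measurePreserving_sphereMap U).measure_preimage (s := closedBall (sphereMap U x) r)
    measurableSet_closedBall.nullMeasurableSet, (isometry_sphereMap U).preimage_closedBall]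

/-- When moving the centre, the indicator of the ball changes only near its boundary, which is null
by assumption; the normalization is constant by rotation invariance. -/
theorem continuous_ballMean {M : UnitSphere d × UnitSphere d → ℂ}
    (hM : Integrable M ((sphereMeasure d).prod (sphereMeasure d))) {r : ℝ}
    (hr : ∀ x, sphereMeasure d {y | dist y x = r} = 0) (x : UnitSphere d) :
    Continuous (ballMean M r x) := by
  have h1 : ballMean M r x = fun y => (((sphereMeasure d).real (closedBall x r))⁻¹ *
      ((sphereMeasure d).real (closedBall x r))⁻¹ : ℝ) *
      ∫ z, (closedBall x r ×ˢ closedBall y r).indicator M z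
        ∂((sphereMeasure d).prod (sphereMeasure d)) := by
    funext y
    rw [ballMean, blockMean, integral_indicator (measurableSet_closedBall.prod
      measurableSet_closedBall), Measure.real, Measure.real, sphereMeasure_closedBall r y x]
  rw [h1]
  refine continuous_const.mul ?_
  rw [continuous_iff_continuousAt]
  intro y
  refine continuousAt_of_dominated (bound := fun z => ‖M z‖) ?_ ?_ hM.norm ?_
  · exact Eventually.of_forall fun y => hM.1.indicator (measurableSet_closedBall.prod
      measurableSet_closedBall)
  · exact Eventually.of_forall fun y => Eventually.of_forall fun z => norm_indicator_le_norm_self _ _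
  · have h2 : ∀ᵐ z ∂((sphereMeasure d).prod (sphereMeasure d)), dist z.2 y ≠ r :=
      Measure.quasiMeasurePreserving_snd.ae (show ∀ᵐ z ∂(sphereMeasure d), dist z y ≠ r from by
        rw [ae_iff]; simpa using hr y)
    filter_upwards [h2] with z hz
    rcases lt_or_gt_of_ne hz with hlt | hlt
    · have h3 : ∀ᶠ y' in 𝓝 y, dist z.2 y' < r :=
        (continuous_const.dist continuous_id).continuousAt.eventually_lt_const hlt
      refine (continuousAt_const (y := (closedBall x r ×ˢ closedBall y r).indicator M z)).congr ?_
      filter_upwards [h3] with y' hy'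
      by_cases h : z.1 ∈ closedBall x r
      · rw [indicator_of_mem, indicator_of_mem]
        · exact ⟨h, hy'.le⟩
        · exact ⟨h, hlt.le⟩
      · rw [indicator_of_notMem fun h' => h h'.1, indicator_of_notMem fun h' => h h'.1]
    · have h3 : ∀ᶠ y' in 𝓝 y, r < dist z.2 y' :=
        (continuous_const.dist continuous_id).continuousAt.eventually_const_lt hlt
      refine (continuousAt_const (y := 0)).congr ?_
      filter_upwards [h3] with y' hy'
      rw [indicator_of_notMem fun h' => absurd h'.2 (not_le.2 hy')]

/-- The means over balls of radius `r n` depend only on the angle between the centres, so they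
define functions of the angle. All but countably many radii have null boundary spheres, which gives
continuity; Lebesgue differentiation gives convergence. -/
theorem exists_isTestedSymbol_tendsto (hd : 1 ≤ d) {m : ℝ → ℂ} {p : ℝ≥0∞} (hp : 1 ≤ p)
    (hM : MemLp (zonalSymbol d m) ∞ ((sphereMeasure d).prod (sphereMeasure d)))
    (hc : SchurContractive p (sphereMeasure d) (zonalSymbol d m)) :
    ∃ φ : ℕ → ℝ → ℂ, (∀ n, IsTestedSymbol d |(p⁻¹).toReal - 1 / 2| (φ n)) ∧
      ∀ᵐ s : ℝ, Tendsto (fun n => φ n s) atTop (𝓝 (m (Real.cos s))) := by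
  have hMi : Integrable (zonalSymbol d m) ((sphereMeasure d).prod (sphereMeasure d)) :=
    hM.integrable le_top
  have := nullSingletonClass_sphereMeasure hd
  have hL : HasLebesguePoints (sphereMeasure d) (zonalSymbol d m) :=
    hasLebesguePoints_of_isClosedEmbedding isometry_subtype_coe
      isClosed_sphere.isClosedEmbedding_subtypeVal hMi
  set e := greatCircle d hd 0 with he
  have hcount : {r : ℝ | 0 < sphereMeasure d {y | dist y e = r}}.Countable :=
    Measure.countable_meas_level_set_pos (by fun_prop)
  obtain ⟨r, -, hr, hr0⟩ := (hcount.dense_compl ℝ).exists_seq_strictAnti_tendsto 0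
  have hrpos : ∀ n, 0 < r n := fun n => (hr n).1
  have hnull : ∀ n x, sphereMeasure d {y | dist y x = r n} = 0 := fun n x => by
    rw [sphereMeasure_preimage_dist (r n) x e]
    simpa using (hr n).2
  have hin : ∀ (s : ℝ) (x y : UnitSphere d), inner ℝ (x : EuclideanSpace ℝ (Fin (d + 1)))
      (y : EuclideanSpace ℝ (Fin (d + 1))) = Real.cos s → ∀ n,
      ballMean (zonalSymbol d m) (r n) x y
        = ballMean (zonalSymbol d m) (r n) e (greatCircle d hd s) := fun s x y h n =>
    ballMean_congr m _ (h.trans (inner_greatCircle hd s).symm)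
  refine ⟨fun n s => ballMean (zonalSymbol d m) (r n) e (greatCircle d hd s), fun n => ?_, ?_⟩
  · refine ⟨(continuous_ballMean hMi (hnull n) e).comp (continuous_greatCircle hd), fun {s t} hst => ?_, ?_⟩
    · exact hin t e _ (by rw [inner_greatCircle, hst]) n
    · intro W I K _ _ _ ν _ D x y θ hθ
      simp_rw [← hin _ _ _ (hθ _ _) n]
      exact D.norm_sum_closedBall_le hM hL hp hc x y (hrpos n)
  · have hG := ae_cos_of_ae_inner hd (G := {t : ℝ | Tendsto (fun n =>
      ballMean (zonalSymbol d m) (r n) e (greatCircle d hd (Real.arccos t))) atTop (𝓝 (m t))}) (by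
      have hr' : Tendsto r atTop (𝓝[>] 0) :=
        tendsto_nhdsWithin_iff.2 ⟨hr0, Eventually.of_forall hrpos⟩
      filter_upwards [hL] with z hz
      have h1 : Tendsto (fun n => ballMean (zonalSymbol d m) (r n) z.1 z.2) atTop
        (𝓝 (zonalSymbol d m z)) := hz.comp hr'
      refine Tendsto.congr (fun n => ?_) h1
      refine hin _ z.1 z.2 ?_ n
      rw [Real.cos_arccos]
      · have := neg_le_of_abs_le (abs_real_inner_le_norm (z.1 : EuclideanSpace ℝ (Fin (d + 1))) z.2)
        simpa using this
      · have := real_inner_le_norm (z.1 : EuclideanSpace ℝ (Fin (d + 1))) z.2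
        simpa using this)
    filter_upwards [hG] with s hs
    refine Tendsto.congr (fun n => ?_) hs
    refine (hin _ _ _ ?_ n).symm
    rw [inner_greatCircle, Real.cos_arccos (Real.neg_one_le_cos s) (Real.cos_le_one s)]

end Tested

/-! ### Kernels with quadratic decay and perturbed changes of variable. -/

section Kernel

open Filter Topology

/-- Kernels with quadratic decay, satisfying a Lipschitz estimate with the same decay. -/
structure HasQuadraticDecay (k : ℝ → ℂ) (C : ℝ) : Prop where
  continuous : Continuous k
  norm_le : ∀ x, ‖k x‖ ≤ C * (1 + x ^ 2)⁻¹
  norm_sub_le : ∀ x t, |t| ≤ 1 → ‖k (x + t) - k x‖ ≤ C * |t| * (1 + x ^ 2)⁻¹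

/-- The bounds on `k` act near 0 and those on the numerator `n = x² k` act at infinity, both for the
size and for the increments. -/
theorem HasQuadraticDecay.of_numerator {k n : ℝ → ℂ} {B : ℝ} (hk : ∀ x, ‖k x‖ ≤ B)
    (hk' : ∀ x y, ‖k x - k y‖ ≤ B * |x - y|) (hkn : ∀ x : ℝ, (x : ℂ) ^ 2 * k x = n x)
    (hn : ∀ x, ‖n x‖ ≤ B) (hn' : ∀ x y, ‖n x - n y‖ ≤ B * |x - y|) :
    HasQuadraticDecay k (10 * B) := by
  have hB : 0 ≤ B := (norm_nonneg _).trans (hk 0)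
  have h1 : ∀ x, (1 + x ^ 2) * ‖k x‖ ≤ 2 * B := by
    intro x
    have h2 : x ^ 2 * ‖k x‖ ≤ B := by
      have := hn x
      rw [← hkn, norm_mul, norm_pow, Complex.norm_real, Real.norm_eq_abs, sq_abs] at this
      exact this
    linarith [hk x]
  refine ⟨?_, fun x => ?_, fun x t ht => ?_⟩
  · refine (LipschitzWith.of_dist_le_mul (K := ⟨B, hB⟩) fun x y => ?_).continuous
    rw [dist_eq_norm, Real.dist_eq]
    exact hk' x y
  · rw [← div_eq_mul_inv, le_div_iff₀ (by positivity)]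
    linarith [h1 x]
  · rw [← div_eq_mul_inv, le_div_iff₀ (by positivity)]
    have h3 : (x : ℂ) ^ 2 * (k (x + t) - k x)
        = (n (x + t) - n x) - ((2 * x * t + t ^ 2 : ℝ) : ℂ) * k (x + t) := by
      rw [← hkn, ← hkn]; push_cast; ring
    have h4 : x ^ 2 * ‖k (x + t) - k x‖ ≤ B * |t| + |t| * (2 * |x| + 1) * ‖k (x + t)‖ := by
      have e1 : x ^ 2 * ‖k (x + t) - k x‖ = ‖(x : ℂ) ^ 2 * (k (x + t) - k x)‖ := by
        rw [norm_mul, norm_pow, Complex.norm_real, Real.norm_eq_abs, sq_abs]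
      rw [e1, h3]
      refine (_root_.norm_sub_le _ _).trans (add_le_add ?_ ?_)
      · simpa using hn' (x + t) x
      · rw [norm_mul, Complex.norm_real, Real.norm_eq_abs]
        refine mul_le_mul_of_nonneg_right ?_ (norm_nonneg _)
        rw [show 2 * x * t + t ^ 2 = t * (2 * x + t) by ring, abs_mul]
        refine mul_le_mul_of_nonneg_left ?_ (abs_nonneg _)
        refine (abs_add_le _ _).trans ?_
        rw [abs_mul, abs_two]
        linarith
    have h5 : (2 * |x| + 1) * ‖k (x + t)‖ ≤ 8 * B := by
      have e2 : 2 * |x| + 1 ≤ 4 * (1 + (x + t) ^ 2) := by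
        have : |x| ≤ |x + t| + |t| := by
          have := abs_sub (x + t) t
          simpa using this
        nlinarith [sq_nonneg (|x + t| - 1), sq_abs (x + t)]
      calc _ ≤ 4 * (1 + (x + t) ^ 2) * ‖k (x + t)‖ := by gcongr
        _ ≤ _ := by linarith [h1 (x + t)]
    have h6 : ‖k (x + t) - k x‖ ≤ B * |t| := by simpa using hk' (x + t) x
    nlinarith [mul_le_mul_of_nonneg_left h5 (abs_nonneg t)]

variable {k : ℝ → ℂ} {C : ℝ}

theorem HasQuadraticDecay.const_nonneg (hk : HasQuadraticDecay k C) : 0 ≤ C := by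
  have := (norm_nonneg _).trans (hk.norm_le 0)
  simpa using this

theorem HasQuadraticDecay.integrable_mul (hk : HasQuadraticDecay k C) {ψ : ℝ → ℂ}
    (hψ : Continuous ψ) {c : ℝ} (hc : ∀ x, ‖ψ x‖ ≤ c) : Integrable fun x => k x * ψ x := by
  refine ((integrable_inv_one_add_sq.const_mul C).mul_const c).mono'
    (hk.continuous.mul hψ).aestronglyMeasurable (Eventually.of_forall fun x => ?_)
  rw [norm_mul]
  exact mul_le_mul (hk.norm_le x) (hc x) (norm_nonneg _) ((norm_nonneg _).trans (hk.norm_le x))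

theorem HasQuadraticDecay.integrable (hk : HasQuadraticDecay k C) : Integrable k := by
  simpa using hk.integrable_mul (ψ := fun _ => 1) continuous_const (c := 1) (by simp)

theorem HasQuadraticDecay.norm_integral_mul_le (hk : HasQuadraticDecay k C) {ψ : ℝ → ℂ}
    {c : ℝ} (hc : ∀ x, ‖ψ x‖ ≤ c) : ‖∫ x, k x * ψ x‖ ≤ C * c * Real.pi := by
  rw [← integral_univ_inv_one_add_sq, ← integral_const_mul]
  refine norm_integral_le_of_norm_le (integrable_inv_one_add_sq.const_mul _)
    (Eventually.of_forall fun x => ?_)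
  rw [norm_mul, mul_right_comm]
  exact mul_le_mul (hk.norm_le x) (hc x) (norm_nonneg _) ((norm_nonneg _).trans (hk.norm_le x))

theorem setIntegral_compl_Icc_inv_one_add_sq_le {r : ℝ} (hr : 0 < r) :
    ∫ x in (Icc (-r) r)ᶜ, (1 + x ^ 2)⁻¹ ≤ 2 / r := by
  have h1 : (Icc (-r) r)ᶜ = Iio (-r) ∪ Ioi r := by
    ext x; simp only [mem_compl_iff, mem_Icc, mem_union, mem_Iio, mem_Ioi]; grind
  have h2 : Disjoint (Iio (-r)) (Ioi r) := by
    rw [Set.disjoint_left]; intro x hx hx'; simp only [mem_Iio, mem_Ioi] at hx hx'; linarith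
  have h3 : Real.arctan (-r) = -Real.arctan r := Real.arctan_neg r
  have h4 : Real.pi / 2 - Real.arctan r ≤ 1 / r := by
    rw [← Real.arctan_inv_of_pos hr, one_div]
    have h5 := Real.lt_tan (Real.arctan_pos.2 (inv_pos.2 hr)) (Real.arctan_lt_pi_div_two _)
    rw [Real.tan_arctan] at h5
    exact h5.le
  rw [h1, setIntegral_union h2 measurableSet_Ioi integrable_inv_one_add_sq.integrableOn
    integrable_inv_one_add_sq.integrableOn, integral_Ioi_inv_one_add_sq,
    ← integral_Iic_eq_integral_Iio, integral_Iic_inv_one_add_sq, h3]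
  have : 2 / r = 1 / r + 1 / r := by ring
  linarith

/-- Comparison of integrals under a change of variable which is close to the identity. -/
theorem HasQuadraticDecay.norm_sub_integral_le (hk : HasQuadraticDecay k C) {ψ : ℝ → ℂ}
    (hψ : Continuous ψ) (hψ2 : ∀ x, ‖ψ x‖ ≤ 2) {A₁ A₂ r D η : ℝ} (hr : 0 < r) (hA₁ : A₁ ≤ -(2 * r))
    (hA₂ : 2 * r ≤ A₂) {w w' : ℝ → ℝ} (hw : ∀ x ∈ Icc A₁ A₂, HasDerivAt w (w' x) x)
    (hD : ∀ x ∈ Icc A₁ A₂, |w x - x| ≤ D) (hη : ∀ x ∈ Icc A₁ A₂, |w' x - 1| ≤ η)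
    (hD1 : D ≤ 1) (hDr : D ≤ r) (hη1 : η < 1) :
    ‖(∫ x in Icc A₁ A₂, k x * ψ (w x)) - ∫ x, k x * ψ x‖
      ≤ C * (2 * Real.pi * (D + 2 * η) + 4 / r) := by
  have hC := hk.const_nonneg
  have hA : A₁ ≤ A₂ := by linarith
  have hwc : ContinuousOn w (Icc A₁ A₂) := fun x hx => (hw x hx).continuousAt.continuousWithinAt
  have hw'pos : ∀ x ∈ Icc A₁ A₂, 0 < w' x := fun x hx => by
    have := abs_lt.1 ((hη x hx).trans_lt hη1); linarith
  have hmono : StrictMonoOn w (Icc A₁ A₂) := by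
    refine strictMonoOn_of_deriv_pos (convex_Icc _ _) hwc fun x hx => ?_
    rw [interior_Icc] at hx
    rw [(hw x (Ioo_subset_Icc_self hx)).deriv]
    exact hw'pos x (Ioo_subset_Icc_self hx)
  have hint := hk.integrable_mul hψ hψ2
  have hchange := integral_image_eq_integral_abs_deriv_smul (f := w) (f' := w')
    (measurableSet_Icc (a := A₁) (b := A₂)) (fun x hx => (hw x hx).hasDerivWithinAt) hmono.injOn
    (fun x => k x * ψ x)
  have hchangei := (integrableOn_image_iff_integrableOn_abs_deriv_smul (f := w) (f' := w')
    (measurableSet_Icc (a := A₁) (b := A₂)) (fun x hx => (hw x hx).hasDerivWithinAt) hmono.injOn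
    (fun x => k x * ψ x)).1 hint.integrableOn
  have hE : MeasurableSet (w '' Icc A₁ A₂) :=
    (isCompact_Icc.image_of_continuousOn hwc).isClosed.measurableSet
  have hsub : Icc (-r) r ⊆ w '' Icc A₁ A₂ := by
    refine Subset.trans ?_ (intermediate_value_Icc hA hwc)
    have e1 := abs_le.1 (hD A₁ (left_mem_Icc.2 hA))
    have e2 := abs_le.1 (hD A₂ (right_mem_Icc.2 hA))
    exact Icc_subset_Icc (by linarith) (by linarith)
  have hi : IntegrableOn (fun x => k x * ψ (w x)) (Icc A₁ A₂) :=
    (hk.continuous.continuousOn.mul (hψ.comp_continuousOn hwc)).integrableOn_Icc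
  -- The integral over the line is split at the image of `w`. On the image the variable is changed
  -- and `k` is compared with `w' · k ∘ w`; the complement lies outside `[-r, r]` and only
  -- contributes a tail.
  rw [← integral_add_compl hE hint, hchange, ← sub_sub,
    ← integral_sub hi hchangei]
  refine (_root_.norm_sub_le _ _).trans ?_
  rw [mul_add]
  refine add_le_add ?_ ?_
  · have h1 : ∀ x ∈ Icc A₁ A₂, ‖k x * ψ (w x) - |w' x| • (k (w x) * ψ (w x))‖
        ≤ 2 * C * (D + 2 * η) * (1 + x ^ 2)⁻¹ := by
      intro x hx
      have e0 : 0 ≤ (1 + x ^ 2)⁻¹ := by positivity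
      have hη0 : 0 ≤ η := (abs_nonneg _).trans (hη x hx)
      have e1 : ‖k (w x) - k x‖ ≤ C * D * (1 + x ^ 2)⁻¹ := by
        have := hk.norm_sub_le x (w x - x) ((hD x hx).trans hD1)
        rw [add_sub_cancel] at this
        refine this.trans ?_
        gcongr
        exact hD x hx
      have e2 : ‖k (w x)‖ ≤ 2 * C * (1 + x ^ 2)⁻¹ := by
        have h3 := hk.norm_le x
        have h4 : ‖k (w x)‖ ≤ ‖k (w x) - k x‖ + ‖k x‖ := norm_le_norm_sub_add _ _
        have h5 : C * D * (1 + x ^ 2)⁻¹ ≤ C * 1 * (1 + x ^ 2)⁻¹ := by gcongr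
        linarith
      rw [abs_of_pos (hw'pos x hx), Complex.real_smul]
      have e3 : k x * ψ (w x) - (w' x : ℂ) * (k (w x) * ψ (w x))
          = (-(k (w x) - k x) - ((w' x - 1 : ℝ) : ℂ) * k (w x)) * ψ (w x) := by
        push_cast; ring
      rw [e3, norm_mul]
      have e4 : ‖-(k (w x) - k x) - ((w' x - 1 : ℝ) : ℂ) * k (w x)‖
          ≤ C * D * (1 + x ^ 2)⁻¹ + η * (2 * C * (1 + x ^ 2)⁻¹) := by
        refine (_root_.norm_sub_le _ _).trans (add_le_add (by rw [norm_neg]; exact e1) ?_)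
        rw [norm_mul, Complex.norm_real, Real.norm_eq_abs]
        exact mul_le_mul (hη x hx) e2 (norm_nonneg _) hη0
      have hD0 : 0 ≤ D := (abs_nonneg _).trans (hD x hx)
      calc _ ≤ (C * D * (1 + x ^ 2)⁻¹ + η * (2 * C * (1 + x ^ 2)⁻¹)) * 2 :=
            mul_le_mul e4 (hψ2 _) (norm_nonneg _) (by positivity)
        _ = _ := by ring
    have hx0 : A₁ ∈ Icc A₁ A₂ := left_mem_Icc.2 hA
    have hη0 : 0 ≤ η := (abs_nonneg _).trans (hη _ hx0)
    have hD0 : 0 ≤ D := (abs_nonneg _).trans (hD _ hx0)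
    calc _ ≤ ∫ x in Icc A₁ A₂, 2 * C * (D + 2 * η) * (1 + x ^ 2)⁻¹ :=
          norm_integral_le_of_norm_le (integrable_inv_one_add_sq.const_mul _).integrableOn
            ((ae_restrict_iff' measurableSet_Icc).2 (Eventually.of_forall h1))
      _ ≤ ∫ x, 2 * C * (D + 2 * η) * (1 + x ^ 2)⁻¹ :=
          setIntegral_le_integral (integrable_inv_one_add_sq.const_mul _)
            (Eventually.of_forall fun x => by positivity)
      _ = _ := by rw [integral_const_mul, integral_univ_inv_one_add_sq]; ring
  · calc _ ≤ ∫ x in (w '' Icc A₁ A₂)ᶜ, 2 * C * (1 + x ^ 2)⁻¹ := by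
          refine norm_integral_le_of_norm_le (integrable_inv_one_add_sq.const_mul _).integrableOn
            (Eventually.of_forall fun x => ?_)
          rw [norm_mul]
          calc _ ≤ (C * (1 + x ^ 2)⁻¹) * 2 := mul_le_mul (hk.norm_le x) (hψ2 x) (norm_nonneg _)
                (by positivity)
            _ = _ := by ring
      _ ≤ ∫ x in (Icc (-r) r)ᶜ, 2 * C * (1 + x ^ 2)⁻¹ :=
          setIntegral_mono_set (integrable_inv_one_add_sq.const_mul _).integrableOn
            (Eventually.of_forall fun x => by positivity)
            (compl_subset_compl.2 hsub).eventuallyLE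
      _ ≤ 2 * C * (2 / r) := by
          rw [integral_const_mul]
          gcongr
          exact setIntegral_compl_Icc_inv_one_add_sq_le hr
      _ = _ := by ring

theorem HasQuadraticDecay.norm_integral_sub_comp_add_le (hk : HasQuadraticDecay k C) {ψ : ℝ → ℂ}
    (hψ2 : ∀ x, ‖ψ x‖ ≤ 2) {t : ℝ} (ht : |t| ≤ 1) :
    ‖∫ x, (k (x + t) - k x) * ψ x‖ ≤ 2 * Real.pi * C * |t| := by
  have : 2 * Real.pi * C * |t| = ∫ x : ℝ, 2 * C * |t| * (1 + x ^ 2)⁻¹ := by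
    rw [integral_const_mul, integral_univ_inv_one_add_sq]; ring
  rw [this]
  refine norm_integral_le_of_norm_le (integrable_inv_one_add_sq.const_mul _)
    (Eventually.of_forall fun x => ?_)
  rw [norm_mul]
  calc _ ≤ (C * |t| * (1 + x ^ 2)⁻¹) * 2 := mul_le_mul (hk.norm_sub_le x t ht) (hψ2 x)
        (norm_nonneg _) ((norm_nonneg _).trans (hk.norm_sub_le x t ht))
    _ = _ := by ring

end Kernel

/-! ### Block kernels. -/

section Block

open Complex

/-- The Fourier transform of the interval `[a, a + 1/2]`. -/
def blockChar (a x : ℝ) : ℂ := ∫ s in Icc a (a + 1 / 2), cexp (I * (s * x : ℝ))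

/-- The kernel attached to the intervals `[a, a + 1/2]` and `[b, b + 1/2]`. -/
def blockKernel (a b x : ℝ) : ℂ := blockChar a x * starRingEnd ℂ (blockChar b x)

theorem norm_cexp_I_mul (t : ℝ) : ‖cexp (I * t)‖ = 1 := by
  rw [mul_comm, norm_exp_ofReal_mul_I]

theorem norm_cexp_I_mul_sub_le (s t : ℝ) : ‖cexp (I * s) - cexp (I * t)‖ ≤ |s - t| := by
  have h : cexp (I * s) - cexp (I * t) = cexp (I * t) * (cexp (I * (s - t : ℝ)) - 1) := by
    rw [mul_sub, ← Complex.exp_add]; push_cast; ring_nf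
  rw [h, norm_mul, norm_cexp_I_mul, one_mul]
  exact Real.norm_exp_I_mul_ofReal_sub_one_le

theorem norm_blockChar_le (a x : ℝ) : ‖blockChar a x‖ ≤ 1 / 2 := by
  refine (norm_setIntegral_le_of_norm_le_const (C := 1) (by simp) fun s _ =>
    (norm_cexp_I_mul _).le).trans ?_
  simp

theorem norm_blockChar_sub_le {a : ℝ} (ha : |a| ≤ 3) (x y : ℝ) :
    ‖blockChar a x - blockChar a y‖ ≤ 2 * |x - y| := by
  have hi : ∀ x : ℝ, IntegrableOn (fun s : ℝ => cexp (I * (s * x : ℝ))) (Icc a (a + 1 / 2)) :=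
    fun x => Continuous.integrableOn_Icc (by fun_prop)
  rw [blockChar, blockChar, ← integral_sub (hi x) (hi y)]
  refine (norm_setIntegral_le_of_norm_le_const (C := 4 * |x - y|) (by simp) fun s hs => ?_).trans ?_
  · refine (norm_cexp_I_mul_sub_le _ _).trans ?_
    rw [← mul_sub, abs_mul]
    refine mul_le_mul_of_nonneg_right ?_ (abs_nonneg _)
    have := abs_le.1 ha
    rw [abs_le]
    constructor <;> linarith [hs.1, hs.2]
  · simp only [measureReal_def, Real.volume_Icc, add_sub_cancel_left]
    rw [ENNReal.toReal_ofReal (by norm_num)]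
    linarith [abs_nonneg (x - y)]

theorem mul_blockChar (a x : ℝ) : (x : ℂ) * blockChar a x
    = -I * (cexp (I * ((a + 1 / 2) * x : ℝ)) - cexp (I * (a * x : ℝ))) := by
  rw [blockChar, integral_Icc_eq_integral_Ioc,
    ← intervalIntegral.integral_of_le (by linarith), ← intervalIntegral.integral_const_mul]
  have h : ∀ s ∈ uIcc a (a + 1 / 2), HasDerivAt (fun s : ℝ => -I * cexp (I * (s * x : ℝ)))
      (x * cexp (I * (s * x : ℝ))) s := by
    intro s _
    have h1 : HasDerivAt (fun s : ℝ => I * ((s * x : ℝ) : ℂ)) (I * x) s := by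
      have := ((hasDerivAt_id s).mul_const x).ofReal_comp.const_mul I
      simpa using this
    refine (h1.cexp.const_mul (-I)).congr_deriv ?_
    linear_combination (-(x : ℂ) * cexp (I * (s * x : ℝ))) * I_mul_I
  rw [intervalIntegral.integral_eq_sub_of_hasDerivAt h
    (Continuous.intervalIntegrable (by fun_prop) _ _)]
  ring

theorem norm_mul_sub_mul_le {a b c d : ℂ} : ‖a * b - c * d‖ ≤ ‖a - c‖ * ‖b‖ + ‖c‖ * ‖b - d‖ := by
  have : a * b - c * d = (a - c) * b + c * (b - d) := by ring
  rw [this]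
  exact (norm_add_le _ _).trans (by rw [norm_mul, norm_mul])

theorem hasQuadraticDecay_blockKernel {a b : ℝ} (ha : |a| ≤ 3) (hb : |b| ≤ 3) :
    HasQuadraticDecay (blockKernel a b) 320 := by
  set e : ℝ → ℝ → ℂ := fun a x => -I * (cexp (I * ((a + 1 / 2) * x : ℝ)) - cexp (I * (a * x : ℝ)))
    with he
  have he2 : ∀ a x, ‖e a x‖ ≤ 2 := by
    intro a x
    rw [he, norm_mul, norm_neg, norm_I, one_mul]
    refine (norm_sub_le _ _).trans ?_
    rw [norm_cexp_I_mul, norm_cexp_I_mul]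
    norm_num
  have he8 : ∀ a, |a| ≤ 3 → ∀ x y, ‖e a x - e a y‖ ≤ 7 * |x - y| := by
    intro a ha x y
    have h1 : e a x - e a y = -I * ((cexp (I * ((a + 1 / 2) * x : ℝ)) -
      cexp (I * ((a + 1 / 2) * y : ℝ))) - (cexp (I * (a * x : ℝ)) - cexp (I * (a * y : ℝ)))) := by
      simp only [he]; ring
    rw [h1, norm_mul, norm_neg, norm_I, one_mul]
    refine (norm_sub_le _ _).trans ?_
    have h2 := norm_cexp_I_mul_sub_le ((a + 1 / 2) * x) ((a + 1 / 2) * y)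
    have h3 := norm_cexp_I_mul_sub_le (a * x) (a * y)
    rw [← mul_sub, abs_mul] at h2 h3
    have h4 : |a + 1 / 2| ≤ 4 := by
      have := abs_le.1 ha
      rw [abs_le]; constructor <;> linarith
    nlinarith [abs_nonneg (x - y)]
  have := HasQuadraticDecay.of_numerator (k := blockKernel a b)
    (n := fun x => e a x * starRingEnd ℂ (e b x)) (B := 32) ?_ ?_ ?_ ?_ ?_
  · norm_num at this; exact this
  · intro x
    rw [blockKernel, norm_mul, RCLike.norm_conj]
    nlinarith [norm_blockChar_le a x, norm_blockChar_le b x, norm_nonneg (blockChar a x),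
      norm_nonneg (blockChar b x)]
  · intro x y
    rw [blockKernel, blockKernel]
    refine norm_mul_sub_mul_le.trans ?_
    rw [← map_sub, RCLike.norm_conj, RCLike.norm_conj]
    have h1 := norm_blockChar_sub_le ha x y
    have h2 := norm_blockChar_sub_le hb x y
    nlinarith [norm_blockChar_le a y, norm_blockChar_le b x, norm_nonneg (blockChar a y),
      norm_nonneg (blockChar b x), abs_nonneg (x - y), norm_nonneg (blockChar a x - blockChar a y)]
  · intro x
    simp only [he]
    rw [← mul_blockChar, ← mul_blockChar, blockKernel, map_mul, conj_ofReal]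
    ring
  · intro x
    rw [norm_mul, RCLike.norm_conj]
    nlinarith [he2 a x, he2 b x, norm_nonneg (e a x), norm_nonneg (e b x)]
  · intro x y
    refine norm_mul_sub_mul_le.trans ?_
    rw [← map_sub, RCLike.norm_conj, RCLike.norm_conj]
    have h1 := he8 a ha x y
    have h2 := he8 b hb x y
    nlinarith [he2 a y, he2 b x, norm_nonneg (e a y), norm_nonneg (e b x), abs_nonneg (x - y),
      norm_nonneg (e a x - e a y), norm_nonneg (e b x - e b y)]

/-- A Fejér kernel modulated by the difference of the positions of the two intervals: on the
frequency side, a tent of half-width 1/2 centred at `a - b`. -/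
theorem blockKernel_eq {a b x : ℝ} (hx : x ≠ 0) :
    blockKernel a b x = cexp (I * ((a - b) * x : ℝ)) * (2 * (1 - Real.cos (x / 2)) / x ^ 2 : ℝ) := by
  have hx' : (x : ℂ) ≠ 0 := ofReal_ne_zero.2 hx
  have h1 : (x : ℂ) ^ 2 * blockKernel a b x
      = (x * blockChar a x) * starRingEnd ℂ (x * blockChar b x) := by
    rw [blockKernel, map_mul, conj_ofReal]; ring
  have hc : ∀ t : ℝ, starRingEnd ℂ (cexp (I * t)) = cexp (-(I * t)) := by
    intro t; rw [← Complex.exp_conj, map_mul, conj_I, conj_ofReal, neg_mul]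
  have h2 : (x : ℂ) ^ 2 * blockKernel a b x
      = cexp (I * ((a - b) * x : ℝ)) * (2 * (1 - Real.cos (x / 2)) : ℝ) := by
    rw [h1, mul_blockChar, mul_blockChar, map_mul, map_sub, map_neg, conj_I, hc, hc]
    have h3 : (2 * (1 - Real.cos (x / 2)) : ℝ) = (2 - (cexp (I * (x / 2 : ℝ)) +
        cexp (-(I * (x / 2 : ℝ)))) : ℂ) := by
      push_cast
      rw [Complex.cos]
      ring_nf
    rw [h3]
    have h4 : ∀ A B C D : ℂ, -I * (A - B) * (- -I * (C - D)) = A * C + B * D - A * D - B * C := by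
      intro A B C D
      linear_combination (-(A - B) * (C - D)) * I_mul_I
    rw [h4]
    simp only [mul_sub, mul_add, ← Complex.exp_add]
    push_cast
    ring_nf
  push_cast at h2 ⊢
  rw [← mul_div_assoc, eq_div_iff (pow_ne_zero 2 hx'), mul_comm, h2]

end Block

/-! ### Angles between points near a great circle. -/

section Angle

open Real

/-- These are polar coordinates of the point `(√(1 - β), z)`, whose argument is `z` up to an error
of second order. -/
theorem exists_phase_of_nonneg {β z : ℝ} (hβ : β ≤ 1 / 2) (hz0 : 0 ≤ z) (hz : z ^ 2 ≤ β) :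
    ∃ N σ : ℝ, 0 < N ∧ N ≤ 1 ∧ 1 - N ^ 2 ≤ β ∧ N * cos σ = √(1 - β) ∧ N * sin σ = z ∧
      |σ - z| ≤ β := by
  have hβ0 : 0 ≤ β := (sq_nonneg z).trans hz
  set c := √(1 - β) with hc
  have hc2 : c ^ 2 = 1 - β := sq_sqrt (by linarith)
  have hc0 : 0 < c := sqrt_pos.2 (by linarith)
  set N := √(c ^ 2 + z ^ 2) with hN
  have hN2 : N ^ 2 = c ^ 2 + z ^ 2 := sq_sqrt (by positivity)
  have hN0 : 0 < N := sqrt_pos.2 (by positivity)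
  have hN1 : N ≤ 1 := by
    exact (sqrt_le_sqrt (by linarith)).trans_eq sqrt_one
  set σ := arctan (z / c) with hσ
  have h1 : √(1 + (z / c) ^ 2) = N / c := by
    rw [sqrt_eq_iff_mul_self_eq (by positivity) (by positivity)]
    field_simp
    linarith
  have hcos : N * cos σ = c := by
    rw [hσ, cos_arctan, h1]; field_simp
  have hsin : N * sin σ = z := by
    rw [hσ, sin_arctan, h1]; field_simp
  have hσ0 : 0 ≤ σ := arctan_nonneg.2 (by positivity)
  refine ⟨N, σ, hN0, hN1, by linarith [sq_nonneg z], hcos, hsin, ?_⟩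
  have hup : σ ≤ z / c := by
    rcases hσ0.eq_or_lt with h | h
    · rw [← h]; positivity
    · have := lt_tan h (arctan_lt_pi_div_two _)
      rw [hσ, tan_arctan] at this
      exact this.le
  have hlow : z ≤ σ := by
    have := sin_le hσ0
    have h2 : 0 ≤ sin σ := by
      rw [← mul_nonneg_iff_of_pos_left hN0, hsin]; exact hz0
    nlinarith
  have hz1 : z ≤ 1 := by nlinarith
  have hzc : z / c ≤ z + β := by
    have h3 : 1 ≤ c * (1 + β) := by
      have : 1 ^ 2 ≤ (c * (1 + β)) ^ 2 := by
        rw [mul_pow, hc2]; nlinarith [mul_nonneg hβ0 hβ0]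
      exact le_of_sq_le_sq (by simpa using this) (by positivity)
    rw [div_le_iff₀ hc0]
    nlinarith [mul_nonneg hz0 hβ0, mul_nonneg (mul_nonneg hc0.le hβ0) (sub_nonneg.2 hz1),
      mul_le_mul_of_nonneg_left h3 hz0]
  rw [abs_of_nonneg (by linarith)]
  linarith

theorem exists_phase {β z : ℝ} (hβ : β ≤ 1 / 2) (hz : z ^ 2 ≤ β) :
    ∃ N σ : ℝ, 0 < N ∧ N ≤ 1 ∧ 1 - N ^ 2 ≤ β ∧ N * cos σ = √(1 - β) ∧ N * sin σ = z ∧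
      |σ - z| ≤ β := by
  rcases le_total 0 z with h | h
  · exact exists_phase_of_nonneg hβ h hz
  · obtain ⟨N, σ, h1, h2, h3, h4, h5, h6⟩ :=
      exists_phase_of_nonneg (z := -z) hβ (by linarith) (by simpa using hz)
    refine ⟨N, -σ, h1, h2, h3, by rwa [cos_neg], by rw [sin_neg]; linarith, ?_⟩
    rw [← abs_neg]
    convert h6 using 2
    ring

variable {N β s τ : ℝ}

/-- The cosines differ by at most `β`. Their difference is a product of sines: the one at the
midpoint is at least `s / 2`, the other is bounded below by Jordan's inequality. -/
theorem abs_arccos_mul_cos_sub_le (hN : 0 < N) (hN1 : N ≤ 1) (hβ : 1 - N ^ 2 ≤ β) (hs : 0 < s)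
    (hτ0 : 0 ≤ τ) (hτ1 : τ ≤ π) (hτ : s ≤ sin τ) :
    |arccos (N * cos τ) - τ| ≤ π * β / s := by
  set t := arccos (N * cos τ) with ht
  have ht0 : 0 ≤ t := arccos_nonneg _
  have ht1 : t ≤ π := arccos_le_pi _
  have h1 : |N * cos τ| ≤ 1 := by
    rw [abs_mul, abs_of_pos hN]
    exact mul_le_one₀ hN1 (abs_nonneg _) (abs_cos_le_one τ)
  have hcos : cos t = N * cos τ := cos_arccos (abs_le.1 h1).1 (abs_le.1 h1).2
  have hdiff : |cos t - cos τ| ≤ β := by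
    have : cos t - cos τ = -((1 - N) * cos τ) := by rw [hcos]; ring
    rw [this, abs_neg, abs_mul, abs_of_nonneg (by linarith)]
    calc (1 - N) * |cos τ| ≤ (1 - N) * 1 :=
          mul_le_mul_of_nonneg_left (abs_cos_le_one τ) (by linarith)
      _ ≤ β := by nlinarith
  rw [cos_sub_cos] at hdiff
  have h2 : s / 2 ≤ sin ((t + τ) / 2) := by
    have h3 : sin t + sin τ = 2 * sin ((t + τ) / 2) * cos ((t - τ) / 2) := sin_add_sin t τ
    have h4 : 0 ≤ sin t := sin_nonneg_of_nonneg_of_le_pi ht0 ht1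
    have h5 : 0 ≤ sin ((t + τ) / 2) :=
      sin_nonneg_of_nonneg_of_le_pi (by linarith) (by linarith)
    nlinarith [cos_le_one ((t - τ) / 2)]
  have h6 : 2 / π * |(t - τ) / 2| ≤ |sin ((t - τ) / 2)| := by
    refine mul_abs_le_abs_sin ?_
    rw [abs_le]
    constructor <;> linarith
  rw [abs_mul, abs_mul, abs_of_nonneg (by linarith : 0 ≤ sin ((t + τ) / 2))] at hdiff
  have h7 : |t - τ| * s ≤ π * β := by
    have h8 : 2 / π * |(t - τ) / 2| = |t - τ| / π := by
      rw [abs_div, abs_two]; ring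
    rw [h8] at h6
    have h9 : |t - τ| / π * s ≤ β := by
      have e1 : 0 ≤ |t - τ| / π := by positivity
      have e2 : |(-2 : ℝ)| = 2 := by norm_num
      rw [e2] at hdiff
      nlinarith [mul_le_mul h2 h6 e1 (by linarith : 0 ≤ sin ((t + τ) / 2))]
    rw [div_mul_eq_mul_div, div_le_iff₀ pi_pos] at h9
    linarith
  rw [le_div_iff₀ hs]
  exact h7

theorem hasDerivAt_arccos_mul_cos (hN : 0 < N) (hN1 : N ≤ 1) (hτ : 0 < sin τ) :
    HasDerivAt (fun τ => arccos (N * cos τ)) (N * sin τ / √(1 - (N * cos τ) ^ 2)) τ := by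
  have h1 : (N * cos τ) ^ 2 < 1 := by
    have h2 : (N * cos τ) ^ 2 ≤ cos τ ^ 2 := by
      rw [mul_pow]
      exact mul_le_of_le_one_left (sq_nonneg _) (pow_le_one₀ hN.le hN1)
    nlinarith [sin_sq_add_cos_sq τ]
  have h3 := abs_lt.1 ((sq_lt_one_iff_abs_lt_one _).1 h1)
  have h4 := (hasDerivAt_arccos h3.1.ne' h3.2.ne).comp τ ((hasDerivAt_cos τ).const_mul N)
  refine h4.congr_deriv ?_
  ring

theorem abs_deriv_arccos_mul_cos_sub_one_le (hN : 0 < N) (hN1 : N ≤ 1) (hβ : 1 - N ^ 2 ≤ β)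
    (hs : 0 < s) (hτ : s ≤ sin τ) :
    |N * sin τ / √(1 - (N * cos τ) ^ 2) - 1| ≤ β / s ^ 2 := by
  have hsc := sin_sq_add_cos_sq τ
  have hN2 : N ^ 2 ≤ 1 := pow_le_one₀ hN.le hN1
  have hs2 : s ^ 2 ≤ sin τ ^ 2 := pow_le_pow_left₀ hs.le hτ 2
  set D := √(1 - (N * cos τ) ^ 2) with hD
  have h1 : s ^ 2 ≤ 1 - (N * cos τ) ^ 2 := by
    rw [mul_pow]; nlinarith [sq_nonneg (cos τ)]
  have hD2 : D ^ 2 = 1 - (N * cos τ) ^ 2 := sq_sqrt ((sq_nonneg s).trans h1)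
  have hD0 : 0 < D := sqrt_pos.2 ((by positivity : 0 < s ^ 2).trans_le h1)
  set q := N * sin τ / D with hq
  have hq0 : 0 ≤ q := div_nonneg (mul_nonneg hN.le (hs.le.trans hτ)) hD0.le
  have hq2 : 1 - q ^ 2 = (1 - N ^ 2) / D ^ 2 := by
    rw [hq, div_pow, eq_div_iff (by positivity), sub_mul, div_mul_cancel₀ _ (by positivity), hD2]
    linear_combination (-N ^ 2) * hsc
  have h2 : 0 ≤ 1 - q ^ 2 := by
    rw [hq2]; exact div_nonneg (by linarith) (sq_nonneg _)
  have hq1 : q ≤ 1 := by nlinarith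
  rw [abs_sub_comm, abs_of_nonneg (by linarith)]
  calc 1 - q ≤ 1 - q ^ 2 := by nlinarith
    _ = (1 - N ^ 2) / D ^ 2 := hq2
    _ ≤ β / s ^ 2 := by
      rw [hD2]
      exact div_le_div₀ (by linarith) hβ (by positivity) h1

/-- The change of variables which turns the angle between points near a great circle into
an affine function. -/
theorem exists_angle_change {θ ρ y β A₁ A₂ : ℝ} (hθ0 : 0 < θ) (hθπ : θ < π) (hρ : ρ ≠ 0)
    (hz : (ρ * y) ^ 2 ≤ β) (hβs : β ≤ sin θ / 16) (hzs : |ρ * y| ≤ sin θ / 8)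
    (hA : ∀ x ∈ Icc A₁ A₂, |ρ * (x + y)| ≤ sin θ / 8) :
    ∃ w w' : ℝ → ℝ, ∀ x ∈ Icc A₁ A₂, HasDerivAt w (w' x) x ∧
      |w x - x| ≤ 8 * β / (|ρ| * sin θ) ∧ |w' x - 1| ≤ 4 * β / sin θ ^ 2 ∧
      cos (θ + ρ * w x) = cos (θ + ρ * (x + y)) * √(1 - β) + sin (θ + ρ * (x + y)) * (ρ * y) := by
  have hS : 0 < sin θ := sin_pos_of_pos_of_lt_pi hθ0 hθπ
  have hS1 : sin θ ≤ 1 := sin_le_one θ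
  have hβ0 : 0 ≤ β := (sq_nonneg _).trans hz
  obtain ⟨N, σ, hN, hN1, hNβ, hcos, hsin, hσ⟩ := exists_phase (by linarith) hz
  have hρ0 : 0 < |ρ| := abs_pos.2 hρ
  set f : ℝ → ℝ := fun τ => arccos (N * cos τ) with hf
  -- With `N cos σ = √(1 - β)` and `N sin σ = ρ y`, the right hand side of the cosine identity is `N
  -- cos τ` for `τ = θ + ρ (x + y) - σ`, so the exact angle is `arccos (N cos τ)`. It is close to `θ
  -- + ρ x` since `N` is close to 1 and `σ` to `ρ y`.
  refine ⟨fun x => (f (θ + ρ * (x + y) - σ) - θ) / ρ, fun x =>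
    N * sin (θ + ρ * (x + y) - σ) / √(1 - (N * cos (θ + ρ * (x + y) - σ)) ^ 2), fun x hx => ?_⟩
  set τ := θ + ρ * (x + y) - σ with hτ
  have hτθ : |τ - θ| ≤ sin θ / 2 := by
    have e1 : τ - θ = ρ * (x + y) - (σ - ρ * y) - ρ * y := by rw [hτ]; ring
    rw [e1]
    refine (abs_sub _ _).trans ?_
    have := abs_sub (ρ * (x + y)) (σ - ρ * y)
    linarith [hA x hx]
  have hτs : sin θ / 2 ≤ sin τ := by
    have h1 : |sin θ - sin τ| ≤ |θ - τ| := by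
      have := abs_sin_sub_sin_le θ τ
      exact this
    rw [abs_sub_comm θ τ] at h1
    have := (abs_le.1 (h1.trans hτθ)).2
    linarith
  have hτ0 : 0 ≤ τ := by
    have := (abs_le.1 hτθ).1
    have h2 := sin_le hθ0.le
    linarith
  have hτπ : τ ≤ π := by
    have := (abs_le.1 hτθ).2
    have h2 := sin_le (sub_nonneg.2 hθπ.le)
    rw [sin_pi_sub] at h2
    linarith
  have hs2 : 0 < sin θ / 2 := by linarith
  refine ⟨?_, ?_, ?_, ?_⟩
  · have h1 : HasDerivAt (fun x => θ + ρ * (x + y) - σ) ρ x := by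
      have := ((((hasDerivAt_id x).add_const y).const_mul ρ).const_add θ).sub_const σ
      simpa using this
    have h2 := hasDerivAt_arccos_mul_cos hN hN1 (hs2.trans_le hτs)
    have h3 := ((h2.comp x h1).sub_const θ).div_const ρ
    refine h3.congr_deriv ?_
    rw [mul_div_assoc, div_self hρ, mul_one]
  · have h1 := abs_arccos_mul_cos_sub_le hN hN1 hNβ hs2 hτ0 hτπ hτs
    have e1 : (f τ - θ) / ρ - x = ((f τ - τ) - (σ - ρ * y)) / ρ := by
      field_simp
      rw [hτ]
      ring
    rw [e1, abs_div, mul_comm |ρ|, ← div_div]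
    gcongr
    refine (abs_sub _ _).trans ?_
    have h2 : π * β / (sin θ / 2) ≤ 7 * β / sin θ := by
      rw [div_div_eq_mul_div]
      refine div_le_div_of_nonneg_right ?_ hS.le
      nlinarith [pi_lt_d2]
    have h3 : β ≤ β / sin θ := by
      rw [le_div_iff₀ hS]; nlinarith
    have h4 : 8 * β / sin θ = 7 * β / sin θ + β / sin θ := by ring
    rw [h4]
    exact add_le_add (h1.trans h2) (hσ.trans h3)
  · refine (abs_deriv_arccos_mul_cos_sub_one_le hN hN1 hNβ hs2 hτs).trans (le_of_eq ?_)
    field_simp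
    ring
  · have h1 : |N * cos τ| ≤ 1 := by
      rw [abs_mul, abs_of_pos hN]
      exact mul_le_one₀ hN1 (abs_nonneg _) (abs_cos_le_one τ)
    have h2 : cos (f τ) = N * cos τ := cos_arccos (abs_le.1 h1).1 (abs_le.1 h1).2
    rw [mul_div_cancel₀ _ hρ, add_sub_cancel, h2, hτ, cos_sub, ← hcos, ← hsin]
    ring

end Angle

/-! ### Bessel inequalities for orthogonal systems. -/

section System
open Complex

variable {Ω ι : Type*} [MeasurableSpace Ω] [Fintype ι] {ν : Measure Ω}

/-- A finite orthogonal system of bounded functions, of common squared norm `κ`. -/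
structure IsOrthogonalSystem [DecidableEq ι] (ν : Measure Ω) (e : ι → Ω → ℂ) (κ : ℝ) : Prop where
  aesm : ∀ b, AEStronglyMeasurable (e b) ν
  norm_le : ∀ b w, ‖e b w‖ ≤ 1
  orthogonal : ∀ b b', ∫ w, e b w * starRingEnd ℂ (e b' w) ∂ν = if b = b' then (κ : ℂ) else 0

variable [DecidableEq ι] [IsFiniteMeasure ν] {e : ι → Ω → ℂ} {κ : ℝ}

theorem IsOrthogonalSystem.integral_norm_sum_sq (he : IsOrthogonalSystem ν e κ) (f : ι → ℂ) :
    ∫ w, ‖∑ b, f b * e b w‖ ^ 2 ∂ν = κ * ∑ b, ‖f b‖ ^ 2 := by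
  have hi : ∀ b b', Integrable (fun w => f b * starRingEnd ℂ (f b') *
      (e b w * starRingEnd ℂ (e b' w))) ν := by
    intro b b'
    refine Integrable.const_mul (Integrable.of_bound ((he.aesm b).mul
      (continuous_conj.comp_aestronglyMeasurable (he.aesm b'))) 1
      (Filter.Eventually.of_forall fun w => ?_)) _
    rw [Pi.mul_apply, norm_mul]
    refine mul_le_one₀ (he.norm_le b w) (norm_nonneg _) ?_
    simpa using he.norm_le b' w
  have h1 : ∀ w, ((‖∑ b, f b * e b w‖ ^ 2 : ℝ) : ℂ)
      = ∑ b, ∑ b', f b * starRingEnd ℂ (f b') * (e b w * starRingEnd ℂ (e b' w)) := by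
    intro w
    rw [ofReal_pow, ← Complex.mul_conj', map_sum, Finset.sum_mul_sum]
    refine Finset.sum_congr rfl fun b _ => Finset.sum_congr rfl fun b' _ => ?_
    rw [map_mul]
    ring
  rw [← Complex.ofReal_inj, ← integral_complex_ofReal]
  simp_rw [h1]
  rw [integral_finsetSum _ fun b _ => integrable_finsetSum _ fun b' _ => hi b b']
  simp_rw [fun b => integral_finsetSum Finset.univ fun b' _ => hi b b', integral_const_mul]
  simp_rw [he.orthogonal]
  simp only [mul_ite, mul_zero, Finset.sum_ite_eq, Finset.mem_univ, if_true]
  push_cast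
  rw [Finset.mul_sum]
  refine Finset.sum_congr rfl fun b _ => ?_
  rw [Complex.mul_conj']
  ring

theorem IsOrthogonalSystem.lintegral_norm_sum_sq (he : IsOrthogonalSystem ν e κ) (f : ι → ℂ) :
    ∫⁻ w, ENNReal.ofReal (‖∑ b, f b * e b w‖ ^ 2) ∂ν = ENNReal.ofReal (κ * ∑ b, ‖f b‖ ^ 2) := by
  rw [← he.integral_norm_sum_sq, ofReal_integral_eq_lintegral_ofReal _
    (Filter.Eventually.of_forall fun w => by positivity)]
  refine Integrable.of_bound ((Finset.aestronglyMeasurable_fun_sum _ fun b _ =>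
    (he.aesm b).const_mul _).norm.pow 2) ((∑ b, ‖f b‖) ^ 2) (Filter.Eventually.of_forall fun w => ?_)
  rw [norm_pow, norm_norm]
  refine pow_le_pow_left₀ (norm_nonneg _) ((norm_sum_le _ _).trans
    (Finset.sum_le_sum fun b _ => ?_)) 2
  rw [norm_mul]
  exact mul_le_of_le_one_right (norm_nonneg _) (he.norm_le b w)

/-- The sum of squares `S` is the pairing of `g` with the combination of the `e b` having the
conjugate coefficients, of squared norm `κ S`; Cauchy–Schwarz gives `S² ≤ κ S ‖g‖²`. -/
theorem IsOrthogonalSystem.sum_norm_integral_sq_le (he : IsOrthogonalSystem ν e κ) (hκ : 0 ≤ κ)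
    {g : Ω → ℂ} (hg : MemLp g 2 ν) :
    ∑ b, ‖∫ w, g w * e b w ∂ν‖ ^ 2 ≤ κ * ∫ w, ‖g w‖ ^ 2 ∂ν := by
  set c : ι → ℂ := fun b => starRingEnd ℂ (∫ w, g w * e b w ∂ν) with hc
  set S := ∑ b, ‖∫ w, g w * e b w ∂ν‖ ^ 2 with hS
  have hS0 : 0 ≤ S := Finset.sum_nonneg fun b _ => by positivity
  have hSc : ∑ b, ‖c b‖ ^ 2 = S := by simp [hc, hS]
  have hi : ∀ b, Integrable (fun w => g w * e b w) ν := fun b =>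
    (hg.integrable (by norm_num)).mul_bdd (he.aesm b) (Filter.Eventually.of_forall (he.norm_le b))
  have h1 : (S : ℂ) = ∫ w, inner ℂ (starRingEnd ℂ (g w)) (∑ b, c b * e b w) ∂ν := by
    have h2 : ∀ w, inner ℂ (starRingEnd ℂ (g w)) (∑ b, c b * e b w)
        = ∑ b, c b * (g w * e b w) := by
      intro w
      rw [RCLike.inner_apply, RCLike.conj_conj, Finset.sum_mul]
      exact Finset.sum_congr rfl fun b _ => by ring
    simp_rw [h2]
    rw [integral_finsetSum _ fun b _ => (hi b).const_mul _]
    simp_rw [integral_const_mul]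
    rw [hS]
    push_cast
    exact Finset.sum_congr rfl fun b _ => (Complex.conj_mul' _).symm
  have hG : 0 ≤ ∫ w, ‖g w‖ ^ 2 ∂ν := integral_nonneg fun w => by positivity
  have h3 : S ≤ √(∫ w, ‖g w‖ ^ 2 ∂ν) * √(κ * S) := by
    have h5 := norm_integral_inner_le (ν := ν) (f := fun w => starRingEnd ℂ (g w))
      (h := fun w => ∑ b, c b * e b w) (continuous_conj.comp_aestronglyMeasurable hg.1)
      (Finset.aestronglyMeasurable_fun_sum _ fun b _ => (he.aesm b).const_mul _) hG
      (mul_nonneg hκ hS0) (by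
        simp_rw [RCLike.norm_conj]
        rw [ofReal_integral_eq_lintegral_ofReal hg.norm.integrable_sq
          (Filter.Eventually.of_forall fun w => by positivity)])
      (by rw [he.lintegral_norm_sum_sq, hSc])
    rw [← h1, Complex.norm_real, Real.norm_of_nonneg hS0] at h5
    exact h5
  rw [← Real.sqrt_mul hG] at h3
  have h4 : S ^ 2 ≤ (∫ w, ‖g w‖ ^ 2 ∂ν) * (κ * S) := by
    refine (pow_le_pow_left₀ hS0 h3 2).trans_eq (Real.sq_sqrt (by positivity))
  rcases hS0.eq_or_lt with h0 | h0
  · rw [← h0]; positivity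
  · refine le_of_mul_le_mul_right ?_ h0
    nlinarith

end System

/-! ### Exponentials with frequencies in a lattice of mesh h. -/

section LatticeBessel

open Complex

theorem integral_cexp_int_mul {h : ℝ} (hh : 0 < h) (k : ℤ) :
    ∫ x in Icc (-(Real.pi / h)) (Real.pi / h), cexp (I * ((h * k * x : ℝ) : ℂ))
      = if k = 0 then ((2 * Real.pi / h : ℝ) : ℂ) else 0 := by
  have hp : 0 ≤ Real.pi / h := by positivity
  rw [integral_Icc_eq_integral_Ioc, ← intervalIntegral.integral_of_le (by linarith)]
  split_ifs with hk
  · subst hk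
    simp
    ring
  · have hc : (I * (h * k) : ℂ) ≠ 0 := by
      simp [hh.ne', hk]
    have e1 : ∀ x : ℝ, cexp (I * ((h * k * x : ℝ) : ℂ)) = cexp ((I * (h * k)) * x) := by
      intro x; push_cast; ring_nf
    simp_rw [e1]
    rw [integral_exp_mul_complex hc, div_eq_zero_iff]
    left
    rw [sub_eq_zero, Complex.exp_eq_exp_iff_exists_int]
    refine ⟨k, ?_⟩
    have : (h : ℂ) ≠ 0 := ofReal_ne_zero.2 hh.ne'
    push_cast
    field_simp
    ring

/-- The exponential with frequency the lattice point `h b`. -/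
def latticeChar {d n : ℕ} (h : ℝ) (w : EuclideanSpace ℝ (Fin d)) (b : Fin d → Fin n) : ℂ :=
  cexp (I * ((∑ l, h * (b l : ℕ) * w l : ℝ) : ℂ))

theorem norm_latticeChar {d n : ℕ} (h : ℝ) (w : EuclideanSpace ℝ (Fin d)) (b : Fin d → Fin n) :
    ‖latticeChar h w b‖ = 1 := norm_cexp_I_mul _

theorem continuous_latticeChar {d n : ℕ} (h : ℝ) (b : Fin d → Fin n) :
    Continuous fun w : EuclideanSpace ℝ (Fin d) => latticeChar h w b := by
  unfold latticeChar
  fun_prop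

theorem conj_cexp_I_mul (t : ℝ) : starRingEnd ℂ (cexp (I * t)) = cexp (-(I * t)) := by
  rw [← Complex.exp_conj, map_mul, conj_I, conj_ofReal, neg_mul]

theorem integral_latticeChar_mul_conj {d n : ℕ} {h : ℝ} (hh : 0 < h) (b b' : Fin d → Fin n) :
    ∫ w in {w : EuclideanSpace ℝ (Fin d) | ∀ l, w l ∈ Icc (-(Real.pi / h)) (Real.pi / h)},
      latticeChar h w b * starRingEnd ℂ (latticeChar h w b')
      = if b = b' then (((2 * Real.pi / h) ^ d : ℝ) : ℂ) else 0 := by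
  have hvp := PiLp.volume_preserving_toLp (Fin d)
  have hemb : MeasurableEmbedding (WithLp.toLp 2 : (Fin d → ℝ) → EuclideanSpace ℝ (Fin d)) :=
    (MeasurableEquiv.toLp 2 (Fin d → ℝ)).measurableEmbedding
  have h1 := hvp.setIntegral_preimage_emb hemb
    (fun w : EuclideanSpace ℝ (Fin d) => latticeChar h w b * starRingEnd ℂ (latticeChar h w b'))
    {w | ∀ l, w l ∈ Icc (-(Real.pi / h)) (Real.pi / h)}
  rw [← h1]
  have h2 : (WithLp.toLp 2 : (Fin d → ℝ) → EuclideanSpace ℝ (Fin d)) ⁻¹'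
      {w | ∀ l, w l ∈ Icc (-(Real.pi / h)) (Real.pi / h)}
      = univ.pi fun _ => Icc (-(Real.pi / h)) (Real.pi / h) := by
    ext w; simp [Pi.le_def, forall_and]
  have h3 : ∀ w : Fin d → ℝ, latticeChar h (WithLp.toLp 2 w) b *
      starRingEnd ℂ (latticeChar h (WithLp.toLp 2 w) b')
      = ∏ l, cexp (I * ((h * (((b l : ℕ) : ℤ) - ((b' l : ℕ) : ℤ) : ℤ) * w l : ℝ) : ℂ)) := by
    intro w
    rw [latticeChar, latticeChar, conj_cexp_I_mul, ← Complex.exp_add, ← Complex.exp_sum,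
      ← Finset.mul_sum]
    congr 1
    push_cast
    rw [← sub_eq_add_neg, ← mul_sub, ← Finset.sum_sub_distrib]
    congr 1
    refine Finset.sum_congr rfl fun l _ => ?_
    ring
  rw [h2, volume_pi, Measure.restrict_pi_pi]
  simp_rw [h3]
  rw [integral_fintype_prod_eq_prod (𝕜 := ℂ) (fun l (x : ℝ) =>
    cexp (I * ((h * (((b l : ℕ) : ℤ) - ((b' l : ℕ) : ℤ) : ℤ) * x : ℝ) : ℂ)))]
  simp_rw [integral_cexp_int_mul hh]
  by_cases hb : b = b'
  · subst hb
    simp [div_pow]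
  · rw [if_neg hb]
    obtain ⟨l, hl⟩ := Function.ne_iff.1 hb
    refine Finset.prod_eq_zero (Finset.mem_univ l) (if_neg ?_)
    have : (b l : ℕ) ≠ (b' l : ℕ) := fun h => hl (Fin.ext h)
    omega

theorem volume_lattice_box_lt_top {d : ℕ} (h : ℝ) :
    volume {w : EuclideanSpace ℝ (Fin d) | ∀ l, w l ∈ Icc (-(Real.pi / h)) (Real.pi / h)} < ∞ := by
  refine Bornology.IsBounded.measure_lt_top ((Metric.isBounded_closedBall
    (x := (0 : EuclideanSpace ℝ (Fin d))) (r := √(∑ _ : Fin d, (Real.pi / h) ^ 2))).subset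
    fun w hw => ?_)
  rw [mem_closedBall_zero_iff, EuclideanSpace.norm_eq]
  refine Real.sqrt_le_sqrt (Finset.sum_le_sum fun l _ => ?_)
  rw [Real.norm_eq_abs, sq_abs]
  exact sq_le_sq' (hw l).1 (hw l).2

theorem isOrthogonalSystem_latticeChar {d n : ℕ} {h : ℝ} (hh : 0 < h) :
    IsOrthogonalSystem (volume.restrict
      {w : EuclideanSpace ℝ (Fin d) | ∀ l, w l ∈ Icc (-(Real.pi / h)) (Real.pi / h)})
      (fun (b : Fin d → Fin n) w => latticeChar h w b) ((2 * Real.pi / h) ^ d) where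
  aesm b := (continuous_latticeChar h b).aestronglyMeasurable
  norm_le b w := (norm_latticeChar h w b).le
  orthogonal b b' := integral_latticeChar_mul_conj hh b b'

theorem lintegral_norm_sum_latticeChar_sq_le {d n : ℕ} {h : ℝ} (hh : 0 < h)
    {S : Set (EuclideanSpace ℝ (Fin d))}
    (hS : ∀ w ∈ S, ∀ l, w l ∈ Icc (-(Real.pi / h)) (Real.pi / h)) (f : (Fin d → Fin n) → ℂ) :
    ∫⁻ w in S, ENNReal.ofReal (‖∑ b, f b * latticeChar h w b‖ ^ 2)
      ≤ ENNReal.ofReal ((2 * Real.pi / h) ^ d * ∑ b, ‖f b‖ ^ 2) := by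
  have : IsFiniteMeasure (volume.restrict
      {w : EuclideanSpace ℝ (Fin d) | ∀ l, w l ∈ Icc (-(Real.pi / h)) (Real.pi / h)}) :=
    ⟨by simpa using volume_lattice_box_lt_top h⟩
  rw [← (isOrthogonalSystem_latticeChar hh).lintegral_norm_sum_sq]
  exact lintegral_mono_set hS

/-- Used with `V` the cross-section of a tube, for the frequencies along its axis. The offset `X₀`
cancels in the products, which allows the lattice of axial frequencies to be translated later. -/
theorem isOrthogonalSystem_cexp {n : ℕ} {h : ℝ} (hh : 0 < h) (X₀ : ℝ) {V : Type*}
    [MeasurableSpace V] (ρ : Measure V) [IsFiniteMeasure ρ] :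
    IsOrthogonalSystem ((volume.restrict (Icc (-(Real.pi / h)) (Real.pi / h))).prod ρ)
      (fun (a : Fin n) z => cexp (I * ((z.1 * (X₀ + h * (a : ℕ)) : ℝ) : ℂ)))
      (2 * Real.pi / h * ρ.real univ) where
  aesm a := (Continuous.aestronglyMeasurable (by fun_prop) :
    AEStronglyMeasurable (fun s : ℝ => cexp (I * ((s * (X₀ + h * (a : ℕ)) : ℝ) : ℂ))) _).comp_fst
  norm_le a z := (norm_cexp_I_mul _).le
  orthogonal a a' := by
    have h1 : ∀ z : ℝ × V, cexp (I * ((z.1 * (X₀ + h * (a : ℕ)) : ℝ) : ℂ)) *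
        starRingEnd ℂ (cexp (I * ((z.1 * (X₀ + h * (a' : ℕ)) : ℝ) : ℂ)))
        = cexp (I * ((h * (((a : ℕ) : ℤ) - ((a' : ℕ) : ℤ) : ℤ) * z.1 : ℝ) : ℂ)) * 1 := by
      intro z
      rw [conj_cexp_I_mul, ← Complex.exp_add, mul_one]
      push_cast
      ring_nf
    simp_rw [h1]
    rw [integral_prod_mul (fun s : ℝ => cexp (I * ((h * (((a : ℕ) : ℤ) - ((a' : ℕ) : ℤ) : ℤ) * s : ℝ)
      : ℂ))) (fun _ : V => (1 : ℂ)), integral_cexp_int_mul hh]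
    by_cases ha : a = a'
    · subst ha
      simp
    · have : (a : ℕ) ≠ (a' : ℕ) := fun h => ha (Fin.ext h)
      rw [if_neg ha, if_neg (by omega), zero_mul]

end LatticeBessel

/-! ### Tube coordinates and wave packet coefficients. -/

section TubeParam

open Complex

variable {d : ℕ}

/-- The parametrization of `ℝ^d` by `ℝ × ℝ^(d-1)` given by an affine isometry. -/
def tubeParam (T : TubeModel d ≃ᵃⁱ[ℝ] EuclideanSpace ℝ (Fin d))
    (z : ℝ × EuclideanSpace ℝ (Fin (d - 1))) : EuclideanSpace ℝ (Fin d) := T (WithLp.toLp 2 z)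

/-- The direction of the axis of a tube. -/
def tubeDir (T : TubeModel d ≃ᵃⁱ[ℝ] EuclideanSpace ℝ (Fin d)) : EuclideanSpace ℝ (Fin d) :=
  T.linearIsometryEquiv (WithLp.toLp 2 (1, 0))

/-- The linear isometry parametrizing the cross-sections of a tube. -/
def tubeCross (T : TubeModel d ≃ᵃⁱ[ℝ] EuclideanSpace ℝ (Fin d))
    (v : EuclideanSpace ℝ (Fin (d - 1))) : EuclideanSpace ℝ (Fin d) :=
  T.linearIsometryEquiv (WithLp.toLp 2 (0, v))

variable (T : TubeModel d ≃ᵃⁱ[ℝ] EuclideanSpace ℝ (Fin d))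

theorem affineIsometryEquiv_apply_eq {E F : Type*} [NormedAddCommGroup E] [NormedSpace ℝ E]
    [NormedAddCommGroup F] [NormedSpace ℝ F] (T : E ≃ᵃⁱ[ℝ] F) (x : E) :
    T x = T 0 + T.linearIsometryEquiv x := by
  have := T.map_vadd 0 x
  simpa [add_comm] using this

theorem tubeParam_eq (z : ℝ × EuclideanSpace ℝ (Fin (d - 1))) :
    tubeParam T z = T 0 + z.1 • tubeDir T + tubeCross T z.2 := by
  rw [tubeParam, affineIsometryEquiv_apply_eq, add_assoc, tubeDir, tubeCross, ← map_smul, ← map_add]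
  congr 2
  rw [← WithLp.toLp_smul, ← WithLp.toLp_add]
  simp

theorem norm_tubeDir : ‖tubeDir T‖ = 1 := by
  rw [tubeDir, LinearIsometryEquiv.norm_map]
  simp

theorem norm_tubeCross (v : EuclideanSpace ℝ (Fin (d - 1))) : ‖tubeCross T v‖ = ‖v‖ := by
  rw [tubeCross, LinearIsometryEquiv.norm_map]
  simp

theorem continuous_tubeCross : Continuous (tubeCross T) :=
  T.linearIsometryEquiv.continuous.comp (by fun_prop)

theorem continuous_tubeParam : Continuous (tubeParam T) :=
  T.continuous.comp (by fun_prop)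

theorem measurePreserving_tubeParam : MeasurePreserving (tubeParam T) := by
  have h1 := (WithLp.volume_preserving_toLp ℝ (EuclideanSpace ℝ (Fin (d - 1))))
  have h2 : MeasurePreserving (fun x => T 0 + T.linearIsometryEquiv x) :=
    (measurePreserving_add_left volume (T 0)).comp T.linearIsometryEquiv.measurePreserving
  have h3 : tubeParam T = (fun x => T 0 + T.linearIsometryEquiv x) ∘ WithLp.toLp 2 := by
    funext z; exact affineIsometryEquiv_apply_eq T _
  rw [h3]
  exact h2.comp h1

theorem measurableEmbedding_tubeParam : MeasurableEmbedding (tubeParam T) := by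
  have h1 : Topology.IsClosedEmbedding (tubeParam T) :=
    T.toHomeomorph.isClosedEmbedding.comp
      (WithLp.homeomorphProd 2 ℝ (EuclideanSpace ℝ (Fin (d - 1)))).symm.isClosedEmbedding
  exact h1.measurableEmbedding

/-- Blocks of a tube, of length `1/2`. -/
def tubeBlock (δ a : ℝ) : Set (EuclideanSpace ℝ (Fin d)) :=
  tubeParam T '' (Icc a (a + 1 / 2) ×ˢ Metric.ball 0 δ)

theorem image_cylinder (a b δ : ℝ) :
    T '' cylinder d a b δ = tubeParam T '' (Icc a b ×ˢ Metric.ball 0 δ) := by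
  ext w
  constructor
  · rintro ⟨x, hx, rfl⟩
    exact ⟨(x.fst, x.snd), ⟨hx.1, by simpa using hx.2⟩, rfl⟩
  · rintro ⟨z, hz, rfl⟩
    exact ⟨WithLp.toLp 2 z, ⟨hz.1, by simpa using hz.2⟩, rfl⟩

theorem tubeBlock_subset_tube {δ a : ℝ} (ha0 : 0 ≤ a) (ha1 : a ≤ 1 / 2) :
    tubeBlock T δ a ⊆ tube δ T := by
  rw [tube, image_cylinder]
  exact image_mono (prod_mono (Icc_subset_Icc ha0 (by linarith)) subset_rfl)

theorem tubeBlock_subset_shiftedTube {δ a : ℝ} (ha0 : 2 ≤ a) (ha1 : a ≤ 5 / 2) :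
    tubeBlock T δ a ⊆ shiftedTube δ T := by
  rw [shiftedTube, image_cylinder]
  exact image_mono (prod_mono (Icc_subset_Icc ha0 (by linarith)) subset_rfl)

theorem measurableSet_tubeBlock (δ a : ℝ) : MeasurableSet (tubeBlock T δ a) :=
  (measurableEmbedding_tubeParam T).measurableSet_image.2
    (measurableSet_Icc.prod measurableSet_ball)

theorem volume_image_tubeParam (S : Set (ℝ × EuclideanSpace ℝ (Fin (d - 1)))) :
    volume (tubeParam T '' S) = volume S := by
  rw [← (measurePreserving_tubeParam T).measure_preimage_emb (measurableEmbedding_tubeParam T),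
    preimage_image_eq _ (measurableEmbedding_tubeParam T).injective]

theorem volume_tubeBlock (δ a : ℝ) : volume (tubeBlock T δ a)
    = ENNReal.ofReal (1 / 2) * volume (Metric.ball (0 : EuclideanSpace ℝ (Fin (d - 1))) δ) := by
  rw [tubeBlock, volume_image_tubeParam, Measure.volume_eq_prod, Measure.prod_prod,
    Real.volume_Icc, add_sub_cancel_left]

theorem volume_real_tube (δ : ℝ) : volume.real (tube δ T)
    = volume.real (Metric.ball (0 : EuclideanSpace ℝ (Fin (d - 1))) δ) := by
  rw [tube, image_cylinder, Measure.real, volume_image_tubeParam, Measure.volume_eq_prod,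
    Measure.prod_prod, Real.volume_Icc]
  simp [Measure.real]

theorem isBounded_tube (δ : ℝ) : Bornology.IsBounded (tube δ T) := by
  rw [tube, image_cylinder]
  refine ((isCompact_Icc.prod (isCompact_closedBall (0 : EuclideanSpace ℝ (Fin (d - 1))) δ)).image
    (continuous_tubeParam T)).isBounded.subset (image_mono (prod_mono subset_rfl
    Metric.ball_subset_closedBall))

theorem isBounded_shiftedTube (δ : ℝ) : Bornology.IsBounded (shiftedTube δ T) := by
  rw [shiftedTube, image_cylinder]
  refine ((isCompact_Icc.prod (isCompact_closedBall (0 : EuclideanSpace ℝ (Fin (d - 1))) δ)).image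
    (continuous_tubeParam T)).isBounded.subset (image_mono (prod_mono subset_rfl
    Metric.ball_subset_closedBall))

/-- The lattice point `h b`. -/
def latticePoint {n : ℕ} (h : ℝ) (b : Fin d → Fin n) : EuclideanSpace ℝ (Fin d) :=
  WithLp.toLp 2 fun l => h * (b l : ℕ)

theorem latticeChar_eq {n : ℕ} (h : ℝ) (w : EuclideanSpace ℝ (Fin d)) (b : Fin d → Fin n) :
    latticeChar h w b = cexp (I * (inner ℝ w (latticePoint h b) : ℝ)) := by
  rw [latticeChar, latticePoint, PiLp.inner_apply]
  rfl

theorem norm_latticePoint_le {n : ℕ} {h : ℝ} (hh : 0 ≤ h) (b : Fin d → Fin n) :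
    ‖latticePoint h b‖ ≤ d * (h * n) := by
  rw [EuclideanSpace.norm_eq]
  have h1 : ∑ l, ‖(latticePoint h b) l‖ ^ 2 ≤ ∑ _ : Fin d, (h * n) ^ 2 := by
    refine Finset.sum_le_sum fun l _ => pow_le_pow_left₀ (norm_nonneg _) ?_ 2
    have h0 : ((b l : ℕ) : ℝ) ≤ n := by exact_mod_cast (b l).2.le
    change ‖h * ((b l : ℕ) : ℝ)‖ ≤ h * n
    rw [Real.norm_of_nonneg (by positivity)]
    exact mul_le_mul_of_nonneg_left h0 hh
  refine (Real.sqrt_le_sqrt h1).trans ?_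
  rw [Finset.sum_const, Finset.card_univ, Fintype.card_fin, nsmul_eq_mul]
  rw [Real.sqrt_le_left (by positivity), mul_pow (d : ℝ)]
  refine mul_le_mul_of_nonneg_right ?_ (sq_nonneg _)
  rcases Nat.eq_zero_or_pos d with h0 | h0
  · simp [h0]
  · have : (1 : ℝ) ≤ d := by exact_mod_cast h0
    nlinarith

/-- The coordinate of a lattice point along the axis of a tube. -/
def axisCoord {n : ℕ} (h : ℝ) (b : Fin d → Fin n) : ℝ := inner ℝ (tubeDir T) (latticePoint h b)

/-- The Fourier transform of the cross-section of a tube at a lattice point. -/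
def crossChar {n : ℕ} (δ h : ℝ) (b : Fin d → Fin n) : ℂ :=
  ∫ v in Metric.ball (0 : EuclideanSpace ℝ (Fin (d - 1))) δ,
    cexp (I * (inner ℝ (tubeCross T v) (latticePoint h b) : ℝ))

/-- The coefficients of the wave packets attached to a tube. -/
def tubeCoeff {n : ℕ} (δ h a X : ℝ) (b : Fin d → Fin n) : ℂ :=
  ∫ z in Icc a (a + 1 / 2) ×ˢ Metric.ball (0 : EuclideanSpace ℝ (Fin (d - 1))) δ,
    cexp (I * (z.1 * X : ℝ)) * starRingEnd ℂ (latticeChar h (tubeParam T z) b)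

theorem tubeCoeff_eq {n : ℕ} (δ h a X : ℝ) (b : Fin d → Fin n) :
    tubeCoeff T δ h a X b = cexp (-(I * (inner ℝ (T 0) (latticePoint h b) : ℝ))) *
      (blockChar a (X - axisCoord T h b) * starRingEnd ℂ (crossChar T δ h b)) := by
  have h1 : ∀ z : ℝ × EuclideanSpace ℝ (Fin (d - 1)),
      cexp (I * (z.1 * X : ℝ)) * starRingEnd ℂ (latticeChar h (tubeParam T z) b)
      = cexp (-(I * (inner ℝ (T 0) (latticePoint h b) : ℝ))) *
        (cexp (I * (z.1 * (X - axisCoord T h b) : ℝ)) *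
        starRingEnd ℂ (cexp (I * (inner ℝ (tubeCross T z.2) (latticePoint h b) : ℝ)))) := by
    intro z
    rw [latticeChar_eq, conj_cexp_I_mul, conj_cexp_I_mul, ← Complex.exp_add, ← Complex.exp_add,
      ← Complex.exp_add, tubeParam_eq, inner_add_left, inner_add_left, inner_smul_left, axisCoord]
    congr 1
    simp
    ring
  rw [tubeCoeff]
  simp_rw [h1]
  rw [integral_const_mul, Measure.volume_eq_prod, setIntegral_prod_mul
    (fun s : ℝ => cexp (I * (s * (X - axisCoord T h b) : ℝ))) (fun v =>
    starRingEnd ℂ (cexp (I * (inner ℝ (tubeCross T v) (latticePoint h b) : ℝ)))), integral_conj]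
  rfl

/-- Both blocks belong to the same tube, so the phase due to its position cancels and the
cross-section only contributes a nonnegative weight. The remaining factor depends on `X` and the
lattice point through `X - axisCoord`: this is what makes the test see a directional multiplier. -/
theorem tubeCoeff_mul_conj {n : ℕ} (δ h a a' X : ℝ) (b : Fin d → Fin n) :
    tubeCoeff T δ h a X b * starRingEnd ℂ (tubeCoeff T δ h a' X b)
      = (‖crossChar T δ h b‖ ^ 2 : ℝ) * blockKernel a a' (X - axisCoord T h b) := by
  rw [tubeCoeff_eq, tubeCoeff_eq, map_mul, map_mul, RCLike.conj_conj, blockKernel]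
  have h1 : cexp (-(I * (inner ℝ (T 0) (latticePoint h b) : ℝ))) *
      starRingEnd ℂ (cexp (-(I * (inner ℝ (T 0) (latticePoint h b) : ℝ)))) = 1 := by
    rw [← conj_cexp_I_mul, RCLike.conj_conj, conj_cexp_I_mul, ← Complex.exp_add]
    simp
  have h2 : crossChar T δ h b * starRingEnd ℂ (crossChar T δ h b)
      = ((‖crossChar T δ h b‖ ^ 2 : ℝ) : ℂ) := by
    rw [Complex.mul_conj']; push_cast; rfl
  rw [← h2]
  linear_combination (blockChar a (X - axisCoord T h b) * starRingEnd ℂ (crossChar T δ h b) *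
    (starRingEnd ℂ (blockChar a' (X - axisCoord T h b)) * crossChar T δ h b)) * h1

/-- Frequencies up to `1 / δ` oscillate by at most one radian across the tube, where the cosine is
at least 1/2. -/
theorem norm_crossChar_ge {n : ℕ} {δ h : ℝ} (b : Fin d → Fin n)
    (hb : δ * ‖latticePoint h b‖ ≤ 1) :
    volume.real (Metric.ball (0 : EuclideanSpace ℝ (Fin (d - 1))) δ) / 2 ≤ ‖crossChar T δ h b‖ := by
  have hi : IntegrableOn (fun v => cexp (I * (inner ℝ (tubeCross T v) (latticePoint h b) : ℝ)))
      (Metric.ball (0 : EuclideanSpace ℝ (Fin (d - 1))) δ) := by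
    refine Measure.integrableOn_of_bounded (M := 1) measure_ball_lt_top.ne
      (Continuous.aestronglyMeasurable ?_) (Filter.Eventually.of_forall fun v =>
        (norm_cexp_I_mul _).le)
    have := continuous_tubeCross T
    fun_prop
  refine le_trans ?_ (Complex.re_le_norm _)
  have h1 : (crossChar T δ h b).re = ∫ v in Metric.ball (0 : EuclideanSpace ℝ (Fin (d - 1))) δ,
      Real.cos (inner ℝ (tubeCross T v) (latticePoint h b)) := by
    rw [crossChar, ← RCLike.re_eq_complex_re, ← integral_re hi]
    refine integral_congr_ae (Filter.Eventually.of_forall fun v => ?_)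
    simp only [RCLike.re_eq_complex_re]
    rw [mul_comm, exp_ofReal_mul_I_re]
  rw [h1]
  have h2 : volume.real (Metric.ball (0 : EuclideanSpace ℝ (Fin (d - 1))) δ) / 2
      = ∫ v in Metric.ball (0 : EuclideanSpace ℝ (Fin (d - 1))) δ, (1 / 2 : ℝ) := by
    simp
    ring
  rw [h2]
  refine setIntegral_mono_on (integrableOn_const measure_ball_lt_top.ne) ?_ measurableSet_ball
    fun v hv => ?_
  · refine Measure.integrableOn_of_bounded (M := 1) measure_ball_lt_top.ne
      (Continuous.aestronglyMeasurable ?_) (Filter.Eventually.of_forall fun v =>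
        Real.abs_cos_le_one _)
    have := continuous_tubeCross T
    fun_prop
  · have h3 : |inner ℝ (tubeCross T v) (latticePoint h b)| ≤ 1 := by
      refine (abs_real_inner_le_norm _ _).trans (le_trans ?_ hb)
      rw [norm_tubeCross]
      gcongr
      exact (mem_ball_zero_iff.1 hv).le
    have h4 := Real.one_sub_sq_div_two_le_cos (x := inner ℝ (tubeCross T v) (latticePoint h b))
    have h5 : (inner ℝ (tubeCross T v) (latticePoint h b)) ^ 2 ≤ 1 := by
      rw [← sq_abs]; exact pow_le_one₀ (abs_nonneg _) h3
    linarith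

end TubeParam

/-! ### Test data attached to a Kakeya family. -/

section TubeTest

open Complex

variable {d : ℕ}

/-- Bessel's inequality along the axis of one tube, for `F` cut off to the block; the resulting
bound involves `F` only on that block. -/
theorem sum_norm_integral_tubeBlock_le (T : TubeModel d ≃ᵃⁱ[ℝ] EuclideanSpace ℝ (Fin d))
    {n' : ℕ} {δ h a X₀ M : ℝ} (hh : 0 < h) (ha0 : -(Real.pi / h) ≤ a)
    (ha1 : a + 1 / 2 ≤ Real.pi / h) {F : EuclideanSpace ℝ (Fin d) → ℂ} (hF : Continuous F)
    (hM : ∀ w, ‖F w‖ ≤ M) :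
    ∑ i : Fin n', ‖∫ z in Icc a (a + 1 / 2) ×ˢ
        Metric.ball (0 : EuclideanSpace ℝ (Fin (d - 1))) δ,
        cexp (I * (z.1 * (X₀ + h * (i : ℕ)) : ℝ)) * F (tubeParam T z)‖ ^ 2
      ≤ 2 * Real.pi / h * volume.real (Metric.ball (0 : EuclideanSpace ℝ (Fin (d - 1))) δ) *
        ∫ w in tubeBlock T δ a, ‖F w‖ ^ 2 := by
  set B := Metric.ball (0 : EuclideanSpace ℝ (Fin (d - 1))) δ with hB
  have hfin : IsFiniteMeasure (volume.restrict B) :=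
    ⟨by simpa using measure_ball_lt_top⟩
  have he := isOrthogonalSystem_cexp (n := n') hh X₀ (volume.restrict B)
  set P := Icc (-(Real.pi / h)) (Real.pi / h) with hP
  set J := Icc a (a + 1 / 2) with hJ
  have hJP : J ⊆ P := Icc_subset_Icc ha0 ha1
  have hJB : MeasurableSet (J ×ˢ B) := measurableSet_Icc.prod measurableSet_ball
  set g : ℝ × EuclideanSpace ℝ (Fin (d - 1)) → ℂ :=
    (J ×ˢ B).indicator fun z => F (tubeParam T z) with hg
  have hsub : P ×ˢ B ∩ J ×ˢ B = J ×ˢ B := inter_eq_self_of_subset_right (prod_mono hJP subset_rfl)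
  have hgc : Continuous fun z => F (tubeParam T z) := hF.comp (continuous_tubeParam T)
  have hgL : MemLp g 2 ((volume.restrict P).prod (volume.restrict B)) := by
    refine MemLp.of_bound (hgc.aestronglyMeasurable.indicator hJB) M
      (Filter.Eventually.of_forall fun z => ?_)
    exact (norm_indicator_le_norm_self _ _).trans (hM _)
  have h1 := he.sum_norm_integral_sq_le (by positivity) hgL
  have e1 : ∀ i : Fin n', ∫ z, g z * cexp (I * ((z.1 * (X₀ + h * (i : ℕ)) : ℝ) : ℂ))
      ∂((volume.restrict P).prod (volume.restrict B))
      = ∫ z in J ×ˢ B, cexp (I * (z.1 * (X₀ + h * (i : ℕ)) : ℝ)) * F (tubeParam T z) := by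
    intro i
    rw [Measure.prod_restrict, ← Measure.volume_eq_prod]
    have : ∀ z, g z * cexp (I * ((z.1 * (X₀ + h * (i : ℕ)) : ℝ) : ℂ)) = (J ×ˢ B).indicator
        (fun z => cexp (I * (z.1 * (X₀ + h * (i : ℕ)) : ℝ)) * F (tubeParam T z)) z := by
      intro z
      by_cases hz : z ∈ J ×ˢ B
      · rw [hg, indicator_of_mem hz, indicator_of_mem hz, mul_comm]
      · rw [hg, indicator_of_notMem hz, indicator_of_notMem hz, zero_mul]
    simp_rw [this]
    rw [setIntegral_indicator hJB, hsub]
  have e2 : ∫ z, ‖g z‖ ^ 2 ∂((volume.restrict P).prod (volume.restrict B))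
      = ∫ w in tubeBlock T δ a, ‖F w‖ ^ 2 := by
    rw [Measure.prod_restrict, ← Measure.volume_eq_prod]
    have : ∀ z, ‖g z‖ ^ 2 = (J ×ˢ B).indicator (fun z => ‖F (tubeParam T z)‖ ^ 2) z := by
      intro z
      by_cases hz : z ∈ J ×ˢ B
      · rw [hg, indicator_of_mem hz, indicator_of_mem hz]
      · rw [hg, indicator_of_notMem hz, indicator_of_notMem hz, norm_zero, zero_pow two_ne_zero]
    simp_rw [this]
    rw [setIntegral_indicator hJB, hsub, tubeBlock,
      (measurePreserving_tubeParam T).setIntegral_image_emb (measurableEmbedding_tubeParam T)]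
  simp_rw [e1] at h1
  rw [e2] at h1
  simpa [Measure.real] using h1

/-- The geometric hypotheses on a family of tubes and on the mesh of the lattice. -/
structure TubeFamily (d N : ℕ) (δ h : ℝ) where
  T : Fin N → (TubeModel d ≃ᵃⁱ[ℝ] EuclideanSpace ℝ (Fin d))
  disjoint : Pairwise fun i j => Disjoint (shiftedTube δ (T i)) (shiftedTube δ (T j))
  h_pos : 0 < h
  h_le : 3 ≤ Real.pi / h
  box : ∀ j, ∀ w ∈ tube δ (T j) ∪ shiftedTube δ (T j), ∀ l,
    w l ∈ Icc (-(Real.pi / h)) (Real.pi / h)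

namespace TubeFamily

variable {N n n' : ℕ} {δ h a b X₀ : ℝ} (Θ : TubeFamily d N δ h)

/-- The union of the tubes. -/
def union : Set (EuclideanSpace ℝ (Fin d)) := ⋃ j, tube δ (Θ.T j)

theorem isFiniteMeasure : IsFiniteMeasure (volume.restrict Θ.union) := by
  refine ⟨?_⟩
  rw [Measure.restrict_apply_univ]
  exact ((Bornology.isBounded_iUnion).2 fun j => isBounded_tube (Θ.T j) δ).measure_lt_top

/-- The wave packets on the tubes. -/
def packet (b X₀ : ℝ) (w : EuclideanSpace ℝ (Fin d)) (i : Fin N × Fin n') : ℂ :=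
  (tubeBlock (Θ.T i.1) δ b).indicator
    (fun w => cexp (I * (((Θ.T i.1).symm w).fst * (X₀ + h * (i.2 : ℕ)) : ℝ))) w

theorem norm_packet_le (w : EuclideanSpace ℝ (Fin d)) (i : Fin N × Fin n') :
    ‖Θ.packet b X₀ w i‖ ≤ 1 :=
  (norm_indicator_le_norm_self _ _).trans (norm_cexp_I_mul _).le

theorem aestronglyMeasurable_packet (i : Fin N × Fin n') :
    AEStronglyMeasurable (fun w => Θ.packet b X₀ w i) (volume.restrict Θ.union) := by
  refine AEStronglyMeasurable.indicator (Continuous.aestronglyMeasurable ?_)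
    (measurableSet_tubeBlock _ _ _)
  have := (Θ.T i.1).symm.continuous
  fun_prop

theorem integral_packet_mul (hb0 : 0 ≤ b) (hb1 : b ≤ 1 / 2) (i : Fin N × Fin n')
    (k : Fin d → Fin n) :
    ∫ w in Θ.union, starRingEnd ℂ (Θ.packet b X₀ w i) * latticeChar h w k
      = starRingEnd ℂ (tubeCoeff (Θ.T i.1) δ h b (X₀ + h * (i.2 : ℕ)) k) := by
  set S := tubeBlock (Θ.T i.1) δ b with hS
  have hSU : S ⊆ Θ.union := (tubeBlock_subset_tube _ hb0 hb1).trans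
    (subset_iUnion (fun j => tube δ (Θ.T j)) i.1)
  have h1 : ∀ w, starRingEnd ℂ (Θ.packet b X₀ w i) * latticeChar h w k
      = S.indicator (fun w => starRingEnd ℂ (cexp (I * (((Θ.T i.1).symm w).fst *
        (X₀ + h * (i.2 : ℕ)) : ℝ))) * latticeChar h w k) w := by
    intro w
    by_cases hw : w ∈ S
    · rw [packet, indicator_of_mem hw, indicator_of_mem hw]
    · rw [packet, indicator_of_notMem hw, indicator_of_notMem hw, map_zero, zero_mul]
  simp_rw [h1]
  rw [setIntegral_indicator (measurableSet_tubeBlock _ _ _), inter_eq_self_of_subset_right hSU, hS,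
    tubeBlock, (measurePreserving_tubeParam _).setIntegral_image_emb
    (measurableEmbedding_tubeParam _), tubeCoeff, ← integral_conj]
  refine integral_congr_ae (Filter.Eventually.of_forall fun z => ?_)
  simp [tubeParam]

/-- Disjointness of the shifted tubes is used here: the local L² norms of the trigonometric
polynomial with coefficients `f` add up to at most its norm over the box, so the operator bound does
not depend on `N`. -/
theorem sum_norm_tubeCoeff_mul_le (ha0 : 2 ≤ a) (ha1 : a ≤ 5 / 2) (f : (Fin d → Fin n) → ℂ) :
    ∑ i : Fin N × Fin n', ‖∑ k, tubeCoeff (Θ.T i.1) δ h a (X₀ + h * (i.2 : ℕ)) k * f k‖ ^ 2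
      ≤ (2 * Real.pi / h) ^ (d + 1) *
        volume.real (Metric.ball (0 : EuclideanSpace ℝ (Fin (d - 1))) δ) * ∑ k, ‖f k‖ ^ 2 := by
  have hh := Θ.h_pos
  have hpi := Θ.h_le
  set B := Metric.ball (0 : EuclideanSpace ℝ (Fin (d - 1))) δ with hB
  set F : EuclideanSpace ℝ (Fin d) → ℂ := fun w => ∑ k, starRingEnd ℂ (latticeChar h w k) * f k
    with hF
  have hFc : Continuous F := continuous_finsetSum _ fun k _ =>
    (continuous_conj.comp (continuous_latticeChar h k)).mul continuous_const
  have hFM : ∀ w, ‖F w‖ ≤ ∑ k, ‖f k‖ := fun w => (norm_sum_le _ _).trans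
    (Finset.sum_le_sum fun k _ => by
      rw [norm_mul, RCLike.norm_conj, norm_latticeChar, one_mul])
  have h1 : ∀ i : Fin N × Fin n', ∑ k, tubeCoeff (Θ.T i.1) δ h a (X₀ + h * (i.2 : ℕ)) k * f k
      = ∫ z in Icc a (a + 1 / 2) ×ˢ B,
        cexp (I * (z.1 * (X₀ + h * (i.2 : ℕ)) : ℝ)) * F (tubeParam (Θ.T i.1) z) := by
    intro i
    have hi : ∀ k, IntegrableOn (fun z : ℝ × EuclideanSpace ℝ (Fin (d - 1)) =>
        cexp (I * (z.1 * (X₀ + h * (i.2 : ℕ)) : ℝ)) *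
          starRingEnd ℂ (latticeChar h (tubeParam (Θ.T i.1) z) k) * f k)
        (Icc a (a + 1 / 2) ×ˢ B) := by
      intro k
      refine Integrable.mul_const ?_ _
      refine Measure.integrableOn_of_bounded (M := 1) ?_ (Continuous.aestronglyMeasurable ?_)
        (Filter.Eventually.of_forall fun z => ?_)
      · rw [Measure.volume_eq_prod, Measure.prod_prod]
        exact ENNReal.mul_ne_top (by simp) measure_ball_lt_top.ne
      · have h2 := (continuous_latticeChar h k).comp (continuous_tubeParam (Θ.T i.1))
        exact (by fun_prop : Continuous fun z : ℝ × EuclideanSpace ℝ (Fin (d - 1)) =>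
          cexp (I * (z.1 * (X₀ + h * (i.2 : ℕ)) : ℝ))).mul (continuous_conj.comp h2)
      · rw [norm_mul, RCLike.norm_conj, norm_latticeChar, norm_cexp_I_mul, one_mul]
    simp_rw [hF, Finset.mul_sum, ← mul_assoc]
    rw [integral_finsetSum _ fun k _ => hi k]
    exact Finset.sum_congr rfl fun k _ => (integral_mul_const _ _).symm
  simp_rw [h1]
  rw [Fintype.sum_prod_type]
  set Q := {w : EuclideanSpace ℝ (Fin d) | ∀ l, w l ∈ Icc (-(Real.pi / h)) (Real.pi / h)} with hQ
  have : IsFiniteMeasure (volume.restrict Q) :=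
    ⟨by rw [Measure.restrict_apply_univ]; exact volume_lattice_box_lt_top h⟩
  have hFi : IntegrableOn (fun w => ‖F w‖ ^ 2) Q := by
    refine Integrable.of_bound (hFc.norm.pow 2).aestronglyMeasurable ((∑ k, ‖f k‖) ^ 2)
      (Filter.Eventually.of_forall fun w => ?_)
    rw [norm_pow, norm_norm]
    exact pow_le_pow_left₀ (norm_nonneg _) (hFM w) 2
  have hblock : ∀ j, tubeBlock (Θ.T j) δ a ⊆ Q := fun j w hw =>
    Θ.box j w (Or.inr (tubeBlock_subset_shiftedTube _ ha0 ha1 hw))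
  have hdisj : Pairwise fun i j =>
      Disjoint (tubeBlock (Θ.T i) δ a) (tubeBlock (Θ.T j) δ a) := fun i j hij =>
    (Θ.disjoint hij).mono (tubeBlock_subset_shiftedTube _ ha0 ha1)
      (tubeBlock_subset_shiftedTube _ ha0 ha1)
  calc _ ≤ ∑ j : Fin N, 2 * Real.pi / h * volume.real B * ∫ w in tubeBlock (Θ.T j) δ a, ‖F w‖ ^ 2 :=
        Finset.sum_le_sum fun j _ => sum_norm_integral_tubeBlock_le (Θ.T j) hh (by linarith)
          (by linarith) hFc hFM
    _ = 2 * Real.pi / h * volume.real B * ∫ w in ⋃ j, tubeBlock (Θ.T j) δ a, ‖F w‖ ^ 2 := by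
        rw [← Finset.mul_sum, integral_iUnion_fintype (fun j => measurableSet_tubeBlock _ _ _) hdisj
          fun j => hFi.mono_set (hblock j)]
    _ ≤ 2 * Real.pi / h * volume.real B * ∫ w in Q, ‖F w‖ ^ 2 := by
        refine mul_le_mul_of_nonneg_left ?_ (by positivity)
        exact setIntegral_mono_set hFi (Filter.Eventually.of_forall fun w => by positivity)
          (iUnion_subset hblock).eventuallyLE
    _ = 2 * Real.pi / h * volume.real B * ((2 * Real.pi / h) ^ d * ∑ k, ‖f k‖ ^ 2) := by
        have e1 : ∀ w, ‖F w‖ = ‖∑ k, starRingEnd ℂ (f k) * latticeChar h w k‖ := by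
          intro w
          rw [← RCLike.norm_conj, hF, map_sum]
          congr 1
          refine Finset.sum_congr rfl fun k _ => ?_
          rw [map_mul, RCLike.conj_conj, mul_comm]
        simp_rw [e1]
        rw [(isOrthogonalSystem_latticeChar hh).integral_norm_sum_sq]
        simp
    _ = _ := by ring

theorem sum_norm_tubeCoeff_sq_le (ha0 : 2 ≤ a) (ha1 : a ≤ 5 / 2) :
    ∑ i : Fin N × Fin n', ∑ k : Fin d → Fin n,
        ‖tubeCoeff (Θ.T i.1) δ h a (X₀ + h * (i.2 : ℕ)) k‖ ^ 2
      ≤ n ^ d * N * (2 * Real.pi / h) *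
        volume.real (Metric.ball (0 : EuclideanSpace ℝ (Fin (d - 1))) δ) ^ 2 := by
  have hh := Θ.h_pos
  have hpi := Θ.h_le
  set B := Metric.ball (0 : EuclideanSpace ℝ (Fin (d - 1))) δ with hB
  rw [Finset.sum_comm]
  have h1 : ∀ k : Fin d → Fin n, ∑ i : Fin N × Fin n',
      ‖tubeCoeff (Θ.T i.1) δ h a (X₀ + h * (i.2 : ℕ)) k‖ ^ 2
      ≤ N * (2 * Real.pi / h * volume.real B * volume.real B) := by
    intro k
    rw [Fintype.sum_prod_type]
    have h2 : ∀ j : Fin N, ∑ x : Fin n',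
        ‖tubeCoeff (Θ.T j) δ h a (X₀ + h * (x : ℕ)) k‖ ^ 2
        ≤ 2 * Real.pi / h * volume.real B * volume.real B := by
      intro j
      refine (sum_norm_integral_tubeBlock_le (Θ.T j) (M := 1)
        (F := fun w => starRingEnd ℂ (latticeChar h w k)) hh (by linarith)
        (by linarith) (continuous_conj.comp (continuous_latticeChar h k))
        (fun w => by rw [RCLike.norm_conj, norm_latticeChar])).trans ?_
      refine mul_le_mul_of_nonneg_left ?_ (by positivity)
      simp only [RCLike.norm_conj, norm_latticeChar, one_pow]
      rw [setIntegral_const, smul_eq_mul, mul_one, Measure.real, volume_tubeBlock,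
        ENNReal.toReal_mul, ENNReal.toReal_ofReal (by norm_num)]
      have : 0 ≤ volume.real B := measureReal_nonneg
      change 1 / 2 * volume.real B ≤ _
      linarith
    refine (Finset.sum_le_sum fun j _ => h2 j).trans (le_of_eq ?_)
    simp
  refine (Finset.sum_le_sum fun k _ => h1 k).trans (le_of_eq ?_)
  rw [Finset.sum_const, Finset.card_univ, Fintype.card_fun, Fintype.card_fin, Fintype.card_fin,
    nsmul_eq_mul]
  push_cast
  ring

theorem lintegral_packet_le :
    ∫⁻ w in Θ.union, ENNReal.ofReal (∑ i : Fin N × Fin n', ‖Θ.packet b X₀ w i‖ ^ 2)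
      ≤ ENNReal.ofReal (N * n' *
        volume.real (Metric.ball (0 : EuclideanSpace ℝ (Fin (d - 1))) δ)) := by
  set B := Metric.ball (0 : EuclideanSpace ℝ (Fin (d - 1))) δ with hB
  have h1 : ∀ w, ENNReal.ofReal (∑ i : Fin N × Fin n', ‖Θ.packet b X₀ w i‖ ^ 2)
      = ∑ i : Fin N × Fin n', (tubeBlock (Θ.T i.1) δ b).indicator 1 w := by
    intro w
    rw [ENNReal.ofReal_sum_of_nonneg fun i _ => by positivity]
    refine Finset.sum_congr rfl fun i _ => ?_
    by_cases hw : w ∈ tubeBlock (Θ.T i.1) δ b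
    · rw [packet, indicator_of_mem hw, indicator_of_mem hw, norm_cexp_I_mul]
      simp
    · rw [packet, indicator_of_notMem hw, indicator_of_notMem hw]
      simp
  simp_rw [h1]
  rw [lintegral_finsetSum _ fun i _ => (measurable_one.indicator (measurableSet_tubeBlock _ _ _))]
  have h2 : ∀ i : Fin N × Fin n', ∫⁻ w in Θ.union, (tubeBlock (Θ.T i.1) δ b).indicator 1 w
      ≤ ENNReal.ofReal (volume.real B) := by
    intro i
    rw [lintegral_indicator_one (measurableSet_tubeBlock _ _ _)]
    refine (Measure.restrict_apply_le _ _).trans ?_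
    rw [volume_tubeBlock, Measure.real, ENNReal.ofReal_toReal measure_ball_lt_top.ne]
    refine mul_le_of_le_one_left zero_le ?_
    rw [ENNReal.ofReal_le_one]
    norm_num
  refine (Finset.sum_le_sum fun i _ => h2 i).trans (le_of_eq ?_)
  rw [Finset.sum_const, Finset.card_univ, Fintype.card_prod, Fintype.card_fin, Fintype.card_fin,
    nsmul_eq_mul, ENNReal.ofReal_mul (by positivity), ← Nat.cast_mul, ENNReal.ofReal_natCast]

/-- The test data attached to a family of tubes. -/
def testData (n n' : ℕ) (X₀ : ℝ) (hN : 0 < N) (hn : 0 < n) (hδ : 0 < δ) (ha0 : 2 ≤ a)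
    (ha1 : a ≤ 5 / 2) : TestData (volume.restrict Θ.union) (Fin N × Fin n') (Fin d → Fin n) where
  a i k := tubeCoeff (Θ.T i.1) δ h a (X₀ + h * (i.2 : ℕ)) k
  h := Θ.packet b X₀
  g w k := latticeChar h w k
  op := (2 * Real.pi / h) ^ (d + 1) *
    volume.real (Metric.ball (0 : EuclideanSpace ℝ (Fin (d - 1))) δ)
  hs := n ^ d * N * (2 * Real.pi / h) *
    volume.real (Metric.ball (0 : EuclideanSpace ℝ (Fin (d - 1))) δ) ^ 2
  G := n ^ d
  γ := (2 * Real.pi / h) ^ d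
  z := N * n' * volume.real (Metric.ball (0 : EuclideanSpace ℝ (Fin (d - 1))) δ)
  op_pos := by
    have := Θ.h_pos
    have : 0 < volume.real (Metric.ball (0 : EuclideanSpace ℝ (Fin (d - 1))) δ) :=
      ENNReal.toReal_pos (Metric.measure_ball_pos _ _ hδ).ne' measure_ball_lt_top.ne
    positivity
  hs_pos := by
    have := Θ.h_pos
    have : 0 < volume.real (Metric.ball (0 : EuclideanSpace ℝ (Fin (d - 1))) δ) :=
      ENNReal.toReal_pos (Metric.measure_ball_pos _ _ hδ).ne' measure_ball_lt_top.ne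
    positivity
  G_nonneg := by positivity
  γ_nonneg := by have := Θ.h_pos; positivity
  z_nonneg := by positivity
  op_le := Θ.sum_norm_tubeCoeff_mul_le ha0 ha1
  hs_le := Θ.sum_norm_tubeCoeff_sq_le ha0 ha1
  meas_h := Θ.aestronglyMeasurable_packet
  meas_g k := (continuous_latticeChar h k).aestronglyMeasurable
  integrable i k := by
    have := Θ.isFiniteMeasure
    refine Integrable.of_bound ((continuous_conj.comp_aestronglyMeasurable
      (Θ.aestronglyMeasurable_packet i)).mul (continuous_latticeChar h k).aestronglyMeasurable) 1
      (Filter.Eventually.of_forall fun w => ?_)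
    rw [norm_mul, norm_latticeChar, mul_one, RCLike.norm_conj]
    exact Θ.norm_packet_le w i
  norm_g w := by simp [norm_latticeChar]
  bessel f := by
    have e1 : ∀ w, ‖∑ k, starRingEnd ℂ (latticeChar h w k) * f k‖
        = ‖∑ k, starRingEnd ℂ (f k) * latticeChar h w k‖ := by
      intro w
      rw [← RCLike.norm_conj, map_sum]
      congr 1
      refine Finset.sum_congr rfl fun k _ => ?_
      rw [map_mul, RCLike.conj_conj, mul_comm]
    simp_rw [e1]
    refine (lintegral_norm_sum_latticeChar_sq_le Θ.h_pos (fun w hw => ?_) _).trans (le_of_eq ?_)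
    · obtain ⟨j, hj⟩ := mem_iUnion.1 hw
      exact Θ.box j w (Or.inl hj)
    · simp
  norm_h := Θ.lintegral_packet_le

/-- The smallness of the union enters only through the total mass of `ν`. With `Q = γ hs`, it says
that `ν(univ) G op ≤ ε Q`, and the interpolated bound gains exactly `ε ^ α`. -/
theorem norm_sum_le_of_isTestedSymbol {α : ℝ} (hα0 : 0 ≤ α) {φ : ℝ → ℂ}
    (hφ : IsTestedSymbol d α φ) (n n' : ℕ) (X₀ : ℝ) (hN : 0 < N) (hn : 0 < n) (hδ : 0 < δ)
    (ha0 : 2 ≤ a) (ha1 : a ≤ 5 / 2) (hb0 : 0 ≤ b) (hb1 : b ≤ 1 / 2) {ε : ℝ} (hε : 0 < ε)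
    (hU : volume.real Θ.union
      ≤ ε * (N * volume.real (Metric.ball (0 : EuclideanSpace ℝ (Fin (d - 1))) δ)))
    (x : Fin N × Fin n' → UnitSphere d) (y : (Fin d → Fin n) → UnitSphere d)
    (θ : Fin N × Fin n' → (Fin d → Fin n) → ℝ)
    (hθ : ∀ i k, inner ℝ (x i : EuclideanSpace ℝ (Fin (d + 1)))
      (y k : EuclideanSpace ℝ (Fin (d + 1))) = Real.cos (θ i k)) :
    ‖∑ i : Fin N × Fin n', ∑ k, (‖crossChar (Θ.T i.1) δ h k‖ ^ 2 : ℝ) *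
      blockKernel a b (X₀ + h * (i.2 : ℕ) - axisCoord (Θ.T i.1) h k) * φ (θ i k)‖
      ≤ 2 * ε ^ α * (N * volume.real (Metric.ball (0 : EuclideanSpace ℝ (Fin (d - 1))) δ) *
        √(n' * volume.real (Metric.ball (0 : EuclideanSpace ℝ (Fin (d - 1))) δ) *
          (n ^ d * (2 * Real.pi / h) ^ (d + 1)))) := by
  have := Θ.isFiniteMeasure
  have hh := Θ.h_pos
  set D := Θ.testData n n' X₀ hN hn hδ ha0 ha1 with hD
  have h1 := hφ.test _ D x y θ hθ
  have hc : ∀ i k, D.coeff i k = (‖crossChar (Θ.T i.1) δ h k‖ ^ 2 : ℝ) *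
      blockKernel a b (X₀ + h * (i.2 : ℕ) - axisCoord (Θ.T i.1) h k) := by
    intro i k
    rw [← tubeCoeff_mul_conj, ← Θ.integral_packet_mul hb0 hb1 i k]
    rfl
  simp_rw [hc] at h1
  refine h1.trans ?_
  set B := volume.real (Metric.ball (0 : EuclideanSpace ℝ (Fin (d - 1))) δ) with hB
  have hB0 : 0 < B :=
    ENNReal.toReal_pos (Metric.measure_ball_pos _ _ hδ).ne' measure_ball_lt_top.ne
  set κ := 2 * Real.pi / h with hκ
  have hκ0 : 0 < κ := by positivity
  set Q : ℝ := N * B ^ 2 * (n ^ d * κ ^ (d + 1)) with hQ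
  have hQ0 : 0 < Q := by positivity
  have hb : D.bound α = 2 * (√(N * n' * B) *
      √((volume.real Θ.union * n ^ d * (κ ^ (d + 1) * B)) ^ (2 * α) *
        (κ ^ d * (n ^ d * N * κ * B ^ 2)) ^ (1 - 2 * α))) := by
    simp only [TestData.bound, hD, testData, measureReal_restrict_apply_univ]
    rfl
  rw [hb]
  have e1 : κ ^ d * (n ^ d * N * κ * B ^ 2) = Q := by rw [hQ]; ring
  have e2 : volume.real Θ.union * n ^ d * (κ ^ (d + 1) * B) ≤ ε * Q := by
    calc _ ≤ ε * (N * B) * n ^ d * (κ ^ (d + 1) * B) := by gcongr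
      _ = _ := by rw [hQ]; ring
  have e3 : (volume.real Θ.union * n ^ d * (κ ^ (d + 1) * B)) ^ (2 * α) * Q ^ (1 - 2 * α)
      ≤ (ε ^ α) ^ 2 * Q := by
    calc _ ≤ (ε * Q) ^ (2 * α) * Q ^ (1 - 2 * α) := by gcongr
      _ = ε ^ (2 * α) * (Q ^ (2 * α) * Q ^ (1 - 2 * α)) := by
          rw [Real.mul_rpow hε.le hQ0.le]; ring
      _ = _ := by
          rw [← Real.rpow_add hQ0, add_sub_cancel, Real.rpow_one, ← Real.rpow_mul_natCast hε.le]
          push_cast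
          ring_nf
  rw [e1]
  calc _ ≤ 2 * (√(N * n' * B) * √((ε ^ α) ^ 2 * Q)) := by gcongr
    _ = 2 * ε ^ α * √(N * n' * B * Q) := by
        rw [Real.sqrt_mul (x := (ε ^ α) ^ 2) (by positivity), Real.sqrt_sq (by positivity),
          Real.sqrt_mul (x := N * n' * B) (by positivity) Q]
        ring
    _ = 2 * ε ^ α * √((N * B) ^ 2 * (n' * B * (n ^ d * κ ^ (d + 1)))) := by
        rw [hQ]; ring_nf
    _ = _ := by rw [Real.sqrt_mul (by positivity), Real.sqrt_sq (by positivity)]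

end TubeFamily

end TubeTest

/-! ### Averages against block kernels, for a given family of tubes. -/

section MainEstimate

/-- The point of the sphere with first coordinate `c` and other coordinates `v`. -/
def sphereJoin {d : ℕ} (c : ℝ) (v : EuclideanSpace ℝ (Fin d)) (h : c ^ 2 + ‖v‖ ^ 2 = 1) :
    UnitSphere d :=
  ⟨WithLp.toLp 2 (Fin.cons c fun l => v l), by
    rw [mem_sphere_zero_iff_norm, EuclideanSpace.norm_eq, Fin.sum_univ_succ]
    rw [EuclideanSpace.norm_sq_eq] at h
    simpa using h⟩

theorem inner_sphereJoin {d : ℕ} {c c' : ℝ} {v v' : EuclideanSpace ℝ (Fin d)}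
    (h : c ^ 2 + ‖v‖ ^ 2 = 1) (h' : c' ^ 2 + ‖v'‖ ^ 2 = 1) :
    inner ℝ (sphereJoin c v h : EuclideanSpace ℝ (Fin (d + 1)))
      (sphereJoin c' v' h' : EuclideanSpace ℝ (Fin (d + 1))) = c * c' + inner ℝ v v' := by
  simp only [sphereJoin, PiLp.inner_apply, Fin.sum_univ_succ]
  simp [mul_comm]

/-- Averaging the tests over translations of the lattice of axial frequencies turns sums into exact
integrals, with no discretization error. -/
theorem integral_sum_shift {G : ℝ → ℂ} {A h : ℝ} (hh : 0 ≤ h) (n : ℕ)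
    (hG : ContinuousOn G (Icc A (A + n * h))) :
    ∫ s in (0 : ℝ)..h, ∑ a : Fin n, G (A + s + h * (a : ℕ)) = ∫ x in Icc A (A + n * h), G x := by
  have hsub : ∀ a : ℕ, a < n → uIcc (A + a * h) (A + (a + 1 : ℕ) * h) ⊆ Icc A (A + n * h) := by
    intro a ha
    have h1 : ((a + 1 : ℕ) : ℝ) ≤ n := by exact_mod_cast ha
    push_cast at h1 ⊢
    rw [uIcc_of_le (by nlinarith)]
    exact Icc_subset_Icc (by nlinarith [mul_nonneg (Nat.cast_nonneg (α := ℝ) a) hh])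
      (by nlinarith)
  have hint : ∀ a : ℕ, a < n → IntervalIntegrable G volume (A + a * h) (A + (a + 1 : ℕ) * h) :=
    fun a ha => (hG.mono (hsub a ha)).intervalIntegrable
  have hint' : ∀ a : ℕ, a < n → IntervalIntegrable (fun s => G (A + s + h * a)) volume 0 h := by
    intro a ha
    have := (hint a ha).comp_add_left (A + a * h)
    push_cast at this
    ring_nf at this ⊢
    exact this
  have hterm : ∀ a : ℕ, ∫ s in (0 : ℝ)..h, G (A + s + h * a)
      = ∫ x in (A + a * h)..(A + (a + 1 : ℕ) * h), G x := by
    intro a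
    have h1 : ∀ s, G (A + s + h * a) = G ((A + a * h) + s) := fun s => by congr 1; ring
    simp_rw [h1]
    rw [intervalIntegral.integral_comp_add_left]
    congr 1
    · ring
    · push_cast; ring
  rw [intervalIntegral.integral_finsetSum fun (a : Fin n) _ => hint' (a : ℕ) a.2]
  simp_rw [hterm]
  rw [Fin.sum_univ_eq_sum_range
    (fun a => ∫ x in (A + (a : ℕ) * h)..(A + (a + 1 : ℕ) * h), G x) n,
    intervalIntegral.sum_integral_adjacent_intervals (a := fun k : ℕ => A + k * h) fun k hk =>
      hint k hk, integral_Icc_eq_integral_Ioc, ← intervalIntegral.integral_of_le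
    (by nlinarith [mul_nonneg (Nat.cast_nonneg (α := ℝ) n) hh])]
  simp

variable {θ ρ δ C : ℝ} {k φ : ℝ → ℂ}

/-- The frequencies in play are at most of order `1 / δ`, so `β ≤ (ρ / δ)²`. Dividing by `|ρ| sin θ`
gives an error of order `E` in the rescaled angle, while truncating at `1 / δ` costs a tail of order
`δ`. -/
theorem exists_angle_comparison (hk : HasQuadraticDecay k C) (hφ : Continuous φ)
    (hφ2 : ∀ x, ‖φ x‖ ≤ 2) (hθ0 : 0 < θ) (hθπ : θ < Real.pi) (hρ : ρ ≠ 0) (hδ0 : 0 < δ)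
    (hδ1 : δ ≤ 1) {E : ℝ} (hE : E = |ρ| / (δ ^ 2 * Real.sin θ)) (hE1 : E ≤ 1 / 16) {y β : ℝ}
    (hy : |y| ≤ 1 / δ) (hyβ : (ρ * y) ^ 2 ≤ β) (hβ : β ≤ (ρ / δ) ^ 2) :
    ∃ w : ℝ → ℝ, ContinuousOn w (Icc (-(2 / δ) - y) (2 / δ - y)) ∧
      (∀ x ∈ Icc (-(2 / δ) - y) (2 / δ - y), Real.cos (θ + ρ * w x) =
        Real.cos (θ + ρ * (x + y)) * √(1 - β) + Real.sin (θ + ρ * (x + y)) * (ρ * y)) ∧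
      ‖(∫ x in Icc (-(2 / δ) - y) (2 / δ - y), k x * φ (θ + ρ * w x)) -
        ∫ x, k x * φ (θ + ρ * x)‖ ≤ C * (20 * Real.pi * E + 8 * δ) := by
  have hS : 0 < Real.sin θ := Real.sin_pos_of_pos_of_lt_pi hθ0 hθπ
  have hS1 : Real.sin θ ≤ 1 := Real.sin_le_one θ
  set S := Real.sin θ with hSdef
  have hρ0 : 0 < |ρ| := abs_pos.2 hρ
  have hE0 : 0 ≤ E := by rw [hE]; positivity
  have hρE : |ρ| = E * δ ^ 2 * S := by rw [hE]; field_simp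
  have hβ0 : 0 ≤ β := (sq_nonneg _).trans hyβ
  have hβ' : β ≤ (E * δ * S) ^ 2 := by
    refine hβ.trans (le_of_eq ?_)
    rw [div_pow, ← sq_abs, hρE]
    field_simp
  have hEδ : E * δ ≤ 1 / 16 := by nlinarith
  have hEδS0 : 0 ≤ E * δ * S := by positivity
  have hβ16 : β ≤ S / 16 := by
    refine hβ'.trans ?_
    have : E * δ * S ≤ 1 / 16 * S := by gcongr
    nlinarith
  have hρy : |ρ * y| ≤ S / 8 := by
    rw [abs_mul]
    calc |ρ| * |y| ≤ |ρ| * (1 / δ) := by gcongr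
      _ = E * δ * S := by rw [hρE]; field_simp
      _ ≤ S / 8 := by nlinarith
  have hA : ∀ x ∈ Icc (-(2 / δ) - y) (2 / δ - y), |ρ * (x + y)| ≤ S / 8 := by
    intro x hx
    have h1 : |x + y| ≤ 2 / δ := abs_le.2 ⟨by linarith [hx.1], by linarith [hx.2]⟩
    rw [abs_mul]
    calc |ρ| * |x + y| ≤ |ρ| * (2 / δ) := by gcongr
      _ = 2 * (E * δ * S) := by rw [hρE]; field_simp
      _ ≤ S / 8 := by nlinarith
  obtain ⟨w, w', hw⟩ := exists_angle_change hθ0 hθπ hρ hyβ hβ16 hρy hA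
  have hDle : 8 * β / (|ρ| * S) ≤ 8 * E := by
    rw [div_le_iff₀ (by positivity), hρE]
    calc 8 * β ≤ 8 * (E * δ * S) ^ 2 := by gcongr
      _ = _ := by ring
  have hηle : 4 * β / S ^ 2 ≤ E := by
    rw [div_le_iff₀ (by positivity)]
    calc 4 * β ≤ 4 * (E * δ * S) ^ 2 := by gcongr
      _ = (4 * (E * δ) * δ) * (E * S ^ 2) := by ring
      _ ≤ 1 * (E * S ^ 2) := by
        refine mul_le_mul_of_nonneg_right ?_ (by positivity)
        nlinarith
      _ = _ := one_mul _
  have hδinv : 1 ≤ 1 / δ := by rw [le_div_iff₀ hδ0]; linarith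
  have hy' := abs_le.1 hy
  have h2δ : 2 / δ = 2 * (1 / δ) := by ring
  refine ⟨w, fun x hx => (hw x hx).1.continuousAt.continuousWithinAt, fun x hx => (hw x hx).2.2.2, ?_⟩
  have hψ : Continuous fun x => φ (θ + ρ * x) := hφ.comp (by fun_prop)
  refine (hk.norm_sub_integral_le (ψ := fun x => φ (θ + ρ * x)) hψ (fun x => hφ2 _)
    (r := 1 / (2 * δ)) (D := 8 * E) (η := E) (by positivity) ?_ ?_ (fun x hx => (hw x hx).1)
    (fun x hx => (hw x hx).2.1.trans hDle) (fun x hx => (hw x hx).2.2.1.trans hηle)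
    (by linarith) ?_ (by linarith)).trans (le_of_eq ?_)
  · have : 2 * (1 / (2 * δ)) = 1 / δ := by field_simp
    rw [this]; linarith
  · have : 2 * (1 / (2 * δ)) = 1 / δ := by field_simp
    rw [this]; linarith
  · have : 1 / (2 * δ) = 1 / 2 * (1 / δ) := by field_simp
    rw [this]; linarith
  · field_simp
    ring

/-- After averaging over shifts, each pair of a tube and a lattice point contributes its weight
times nearly the same integral. Dividing by the total weight `W`, bounded below by
`norm_crossChar_ge`, isolates that integral. -/
theorem TubeFamily.norm_integral_blockKernel_le {d N n : ℕ} {h : ℝ} (Θ : TubeFamily d N δ h)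
    {α : ℝ} (hα0 : 0 ≤ α) (hφ : IsTestedSymbol d α φ) (hd : 1 ≤ d) (hN : 0 < N) (hn : 0 < n)
    (hh : h * (d * n) = 1 / δ) {a b : ℝ} (ha0 : 2 ≤ a) (ha1 : a ≤ 5 / 2) (hb0 : 0 ≤ b)
    (hb1 : b ≤ 1 / 2) {ε : ℝ} (hε : 0 < ε)
    (hU : volume.real Θ.union
      ≤ ε * (N * volume.real (Metric.ball (0 : EuclideanSpace ℝ (Fin (d - 1))) δ)))
    (hθ0 : 0 < θ) (hθπ : θ < Real.pi) (hρ : ρ ≠ 0) (hδ0 : 0 < δ)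
    (hδ1 : δ ≤ 1) {E : ℝ} (hE : E = |ρ| / (δ ^ 2 * Real.sin θ)) (hE1 : E ≤ 1 / 16) :
    ‖∫ x, blockKernel a b x * φ (θ + ρ * x)‖ ≤
      h * (2 * ε ^ α * (N * volume.real (Metric.ball (0 : EuclideanSpace ℝ (Fin (d - 1))) δ) *
        √((4 * d * n : ℕ) * volume.real (Metric.ball (0 : EuclideanSpace ℝ (Fin (d - 1))) δ) *
          (n ^ d * (2 * Real.pi / h) ^ (d + 1))))) /
        (N * (n ^ d * (volume.real (Metric.ball (0 : EuclideanSpace ℝ (Fin (d - 1))) δ) / 2) ^ 2))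
        + 320 * (20 * Real.pi * E + 8 * δ) := by
  set B := volume.real (Metric.ball (0 : EuclideanSpace ℝ (Fin (d - 1))) δ) with hB
  have hB0 : 0 < B :=
    ENNReal.toReal_pos (Metric.measure_ball_pos _ _ hδ0).ne' measure_ball_lt_top.ne
  have hh0 := Θ.h_pos
  have hk := hasQuadraticDecay_blockKernel (a := a) (b := b)
    (abs_le.2 ⟨by linarith, by linarith⟩) (abs_le.2 ⟨by linarith, by linarith⟩)
  set S := Real.sin θ with hS
  have hS0 : 0 < S := Real.sin_pos_of_pos_of_lt_pi hθ0 hθπ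
  have hρδ : (ρ / δ) ^ 2 ≤ 1 := by
    rw [sq_le_one_iff_abs_le_one, abs_div, abs_of_pos hδ0, div_le_one hδ0]
    have h1 : |ρ| = E * (δ ^ 2 * S) := by rw [hE]; field_simp
    have h2 : S ≤ 1 := Real.sin_le_one θ
    rw [h1]
    calc E * (δ ^ 2 * S) ≤ 1 / 16 * (1 * δ * 1) := by
          rw [sq]; gcongr
      _ ≤ δ := by linarith
  have hnorm : ∀ c : Fin d → Fin n, ‖latticePoint h c‖ ≤ 1 / δ := fun c =>
    (norm_latticePoint_le hh0.le c).trans (by rw [← hh]; exact le_of_eq (by ring))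
  have hy : ∀ j c, |axisCoord (Θ.T j) h (n := n) c| ≤ ‖latticePoint h c‖ := fun j c => by
    refine (abs_real_inner_le_norm _ _).trans ?_
    rw [norm_tubeDir, one_mul]
  set β : (Fin d → Fin n) → ℝ := fun c => ρ ^ 2 * ‖latticePoint h c‖ ^ 2 with hβ
  have hβle : ∀ c, β c ≤ (ρ / δ) ^ 2 := fun c => by
    calc ρ ^ 2 * ‖latticePoint h c‖ ^ 2 ≤ ρ ^ 2 * (1 / δ) ^ 2 := by gcongr; exact hnorm c
      _ = _ := by ring
  have hyβ : ∀ j c, (ρ * axisCoord (Θ.T j) h (n := n) c) ^ 2 ≤ β c := fun j c => by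
    rw [mul_pow]
    refine mul_le_mul_of_nonneg_left ?_ (sq_nonneg _)
    rw [← sq_abs]
    exact pow_le_pow_left₀ (abs_nonneg _) (hy j c) 2
  choose w hwc hwcos hwint using fun j c => exists_angle_comparison hk hφ.continuous
    (hφ.norm_le hd) hθ0 hθπ hρ hδ0 hδ1 hE hE1 ((hy j c).trans (hnorm c)) (hyβ j c) (hβle c)
  set Iφ := ∫ x, blockKernel a b x * φ (θ + ρ * x) with hIφ
  set err := 320 * (20 * Real.pi * E + 8 * δ) with herr
  set A : Fin N → (Fin d → Fin n) → ℝ := fun j c => ‖crossChar (Θ.T j) δ h c‖ ^ 2 with hA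
  set bd := 2 * ε ^ α * (N * B * √((4 * d * n : ℕ) * B * (n ^ d * (2 * Real.pi / h) ^ (d + 1))))
    with hbd
  -- There are `4 d n` axial samples because they must cover an interval of length `4 / δ`.
  have hhn : ((4 * d * n : ℕ) : ℝ) * h = 4 / δ := by
    push_cast
    calc 4 * (d : ℝ) * n * h = 4 * (h * (d * n)) := by ring
      _ = _ := by rw [hh]; ring
  have hAlow : ∀ j c, (B / 2) ^ 2 ≤ A j c := fun j c => by
    refine pow_le_pow_left₀ (by positivity) (norm_crossChar_ge (Θ.T j) c ?_) 2
    calc δ * ‖latticePoint h c‖ ≤ δ * (1 / δ) := by gcongr; exact hnorm c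
      _ = 1 := by field_simp
  set W := ∑ j, ∑ c, A j c with hW
  have hWlow : N * (n ^ d * (B / 2) ^ 2) ≤ W := by
    calc N * (n ^ d * (B / 2) ^ 2) = ∑ _ : Fin N, ∑ _ : Fin d → Fin n, (B / 2) ^ 2 := by simp
      _ ≤ W := Finset.sum_le_sum fun j _ => Finset.sum_le_sum fun c _ => hAlow j c
  set G : Fin N → (Fin d → Fin n) → ℝ → ℂ := fun j c x =>
    blockKernel a b x * φ (θ + ρ * w j c x) with hG
  have hGc : ∀ j c, ContinuousOn (G j c) (Icc (-(2 / δ) - axisCoord (Θ.T j) h c)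
      (2 / δ - axisCoord (Θ.T j) h c)) := fun j c =>
    hk.continuous.continuousOn.mul (hφ.continuous.comp_continuousOn
      (continuousOn_const.add (continuousOn_const.mul (hwc j c))))
  have hend : ∀ j c, -(2 / δ) - axisCoord (Θ.T j) h (n := n) c + (4 * d * n : ℕ) * h
      = 2 / δ - axisCoord (Θ.T j) h c := fun j c => by rw [hhn]; ring
  have hmem : ∀ s ∈ Icc 0 h, ∀ (i : Fin N × Fin (4 * d * n)) (c : Fin d → Fin n),
      -(2 / δ) + s + h * (i.2 : ℕ) - axisCoord (Θ.T i.1) h c ∈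
        Icc (-(2 / δ) - axisCoord (Θ.T i.1) h c) (2 / δ - axisCoord (Θ.T i.1) h c) := by
    intro s hs i c
    have h1 : ((i.2 : ℕ) : ℝ) + 1 ≤ (4 * d * n : ℕ) := by exact_mod_cast i.2.2
    have h2 : h * ((i.2 : ℕ) : ℝ) + h ≤ 4 / δ := by rw [← hhn]; nlinarith
    have h3 : 0 ≤ h * ((i.2 : ℕ) : ℝ) := by positivity
    have h4 : 4 / δ = 2 / δ + 2 / δ := by ring
    constructor <;> linarith [hs.1, hs.2]
  have htest : ∀ s ∈ Icc 0 h, ‖∑ i : Fin N × Fin (4 * d * n), ∑ c, (A i.1 c : ℂ) *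
      G i.1 c (-(2 / δ) + s + h * (i.2 : ℕ) - axisCoord (Θ.T i.1) h c)‖ ≤ bd := by
    intro s hs
    -- The points of the sphere attached to frequencies are `(√(1-β), ρ ξ)`; those attached to a
    -- tube and an axial sample `X` are `(cos(θ+ρX), sin(θ+ρX) u)`, with `u` the direction of the
    -- tube.
    have hv : ∀ c : Fin d → Fin n, √(1 - β c) ^ 2 + ‖ρ • latticePoint h c‖ ^ 2 = 1 := fun c => by
      rw [Real.sq_sqrt (by linarith [hβle c]), norm_smul, mul_pow, Real.norm_eq_abs, sq_abs]
      simp only [hβ]; ring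
    have hu : ∀ i : Fin N × Fin (4 * d * n), Real.cos (θ + ρ * (-(2 / δ) + s + h * (i.2 : ℕ))) ^ 2
        + ‖Real.sin (θ + ρ * (-(2 / δ) + s + h * (i.2 : ℕ))) • tubeDir (Θ.T i.1)‖ ^ 2 = 1 :=
      fun i => by
        rw [norm_smul, norm_tubeDir, mul_one, Real.norm_eq_abs, sq_abs]
        exact Real.cos_sq_add_sin_sq _
    have := Θ.norm_sum_le_of_isTestedSymbol (a := a) (b := b) hα0 hφ n (4 * d * n) (-(2 / δ) + s)
      hN hn hδ0 ha0 ha1 hb0 hb1 hε hU (fun i => sphereJoin _ _ (hu i))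
      (fun c => sphereJoin _ _ (hv c)) (fun i c => θ + ρ * w i.1 c
        (-(2 / δ) + s + h * (i.2 : ℕ) - axisCoord (Θ.T i.1) h c)) fun i c => by
      rw [inner_sphereJoin, hwcos i.1 c _ (hmem s hs i c), inner_smul_left, inner_smul_right,
        sub_add_cancel, axisCoord]
      rfl
    simp only [mul_assoc] at this
    simpa only [hA, hG, hbd, mul_assoc] using this
  have hint : ∫ s in (0 : ℝ)..h, ∑ i : Fin N × Fin (4 * d * n), ∑ c, (A i.1 c : ℂ) *
      G i.1 c (-(2 / δ) + s + h * (i.2 : ℕ) - axisCoord (Θ.T i.1) h c)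
      = ∑ j, ∑ c, (A j c : ℂ) * ∫ x in Icc (-(2 / δ) - axisCoord (Θ.T j) h c)
        (2 / δ - axisCoord (Θ.T j) h c), G j c x := by
    have hci : ∀ (i : Fin N × Fin (4 * d * n)) (c : Fin d → Fin n), IntervalIntegrable
        (fun s => G i.1 c (-(2 / δ) + s + h * (i.2 : ℕ) - axisCoord (Θ.T i.1) h c)) volume 0 h := by
      intro i c
      refine ContinuousOn.intervalIntegrable ((hGc i.1 c).comp (by fun_prop) fun s hs => ?_)
      rw [uIcc_of_le hh0.le] at hs
      exact hmem s hs i c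
    have hci' : ∀ i : Fin N × Fin (4 * d * n), IntervalIntegrable (fun s => ∑ c, (A i.1 c : ℂ) *
        G i.1 c (-(2 / δ) + s + h * (i.2 : ℕ) - axisCoord (Θ.T i.1) h c)) volume 0 h := by
      intro i
      have := IntervalIntegrable.sum Finset.univ fun c _ => (hci i c).const_mul (A i.1 c : ℂ)
      rwa [Finset.sum_fn] at this
    rw [intervalIntegral.integral_finsetSum fun i _ => hci' i, Fintype.sum_prod_type]
    refine Finset.sum_congr rfl fun j _ => ?_
    have h1 : ∀ y : Fin (4 * d * n), ∫ s in (0 : ℝ)..h, ∑ c, (A j c : ℂ) *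
        G j c (-(2 / δ) + s + h * (y : ℕ) - axisCoord (Θ.T j) h c) = ∑ c, (A j c : ℂ) *
        ∫ s in (0 : ℝ)..h, G j c (-(2 / δ) + s + h * (y : ℕ) - axisCoord (Θ.T j) h c) := by
      intro y
      rw [intervalIntegral.integral_finsetSum fun c _ => (hci (j, y) c).const_mul _]
      exact Finset.sum_congr rfl fun c _ => intervalIntegral.integral_const_mul _ _
    simp_rw [h1]
    rw [Finset.sum_comm]
    refine Finset.sum_congr rfl fun c _ => ?_
    rw [← Finset.mul_sum, ← intervalIntegral.integral_finsetSum fun y _ => hci (j, y) c, ← hend,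
      ← integral_sum_shift hh0.le _ ((hend j c).symm ▸ hGc j c)]
    congr 1
    refine intervalIntegral.integral_congr fun s _ => Finset.sum_congr rfl fun y _ => ?_
    congr 1
    ring
  have hmain : ‖∑ j, ∑ c, (A j c : ℂ) * ∫ x in Icc (-(2 / δ) - axisCoord (Θ.T j) h c)
        (2 / δ - axisCoord (Θ.T j) h c), G j c x‖ ≤ h * bd := by
    rw [← hint]
    refine (intervalIntegral.norm_integral_le_of_norm_le_const (C := bd) fun s hs => ?_).trans ?_
    · rw [uIoc_of_le hh0.le] at hs
      exact htest s ⟨hs.1.le, hs.2⟩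
    · rw [sub_zero, abs_of_pos hh0, mul_comm]
  have hdiff : ‖(∑ j, ∑ c, (A j c : ℂ) * ∫ x in Icc (-(2 / δ) - axisCoord (Θ.T j) h c)
        (2 / δ - axisCoord (Θ.T j) h c), G j c x) - W * Iφ‖ ≤ W * err := by
    have e1 : (W : ℂ) * Iφ = ∑ j, ∑ c, (A j c : ℂ) * Iφ := by
      rw [hW]; push_cast; simp_rw [Finset.sum_mul]
    rw [e1, ← Finset.sum_sub_distrib, hW, Finset.sum_mul]
    refine (norm_sum_le _ _).trans (Finset.sum_le_sum fun j _ => ?_)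
    rw [← Finset.sum_sub_distrib, Finset.sum_mul]
    refine (norm_sum_le _ _).trans (Finset.sum_le_sum fun c _ => ?_)
    rw [← mul_sub, norm_mul, Complex.norm_real, Real.norm_of_nonneg (by positivity)]
    exact mul_le_mul_of_nonneg_left (hwint j c) (by positivity)
  have hn0 : (0 : ℝ) < n := by exact_mod_cast hn
  have hN0 : (0 : ℝ) < N := by exact_mod_cast hN
  have hlow0 : 0 < N * (n ^ d * (B / 2) ^ 2) := by positivity
  have hW0 : 0 < W := hlow0.trans_le hWlow
  have hfin : W * ‖Iφ‖ ≤ h * bd + W * err := by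
    have : W * ‖Iφ‖ = ‖(W : ℂ) * Iφ‖ := by
      rw [norm_mul, Complex.norm_real, Real.norm_of_nonneg hW0.le]
    rw [this]
    have h2 := norm_sub_norm_le ((W : ℂ) * Iφ) (∑ j, ∑ c, (A j c : ℂ) * ∫ x in
      Icc (-(2 / δ) - axisCoord (Θ.T j) h c) (2 / δ - axisCoord (Θ.T j) h c), G j c x)
    rw [norm_sub_rev] at h2
    linarith
  have hbd0 : 0 ≤ h * bd := by positivity
  calc ‖Iφ‖ ≤ h * bd / W + err := by
        rw [← mul_le_mul_iff_right₀ hW0, mul_add, mul_div_cancel₀ _ hW0.ne']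
        exact hfin
    _ ≤ _ := by gcongr

end MainEstimate

/-! ### Optimization over Kakeya families. -/

section KakeyaBound

open Filter Topology

variable {d : ℕ}

/-- The largest frequency is fixed by `h d n = 1 / δ`; taking `n` large makes the box of side `2π /
h` contain all tubes. -/
theorem exists_tubeFamily {N : ℕ} (hd : 1 ≤ d) {δ : ℝ} (hδ : 0 < δ)
    (T : Fin N → (TubeModel d ≃ᵃⁱ[ℝ] EuclideanSpace ℝ (Fin d)))
    (hT : Pairwise fun i j => Disjoint (shiftedTube δ (T i)) (shiftedTube δ (T j))) :
    ∃ (n : ℕ) (h : ℝ) (Θ : TubeFamily d N δ h), 0 < n ∧ h * (d * n) = 1 / δ ∧ Θ.T = T := by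
  have hd0 : (0 : ℝ) < d := by exact_mod_cast hd
  have hb : Bornology.IsBounded (⋃ j, (tube δ (T j) ∪ shiftedTube δ (T j))) :=
    Bornology.isBounded_iUnion.2 fun j => (isBounded_tube _ _).union (isBounded_shiftedTube _ _)
  obtain ⟨R, hR⟩ := hb.exists_norm_le
  obtain ⟨n, hn⟩ := exists_nat_ge (max 1 (max R 3 / (d * δ)))
  have hn1 : (1 : ℝ) ≤ n := (le_max_left _ _).trans hn
  have hn0 : (0 : ℝ) < n := by linarith
  have hdn : max R 3 ≤ d * δ * n := by
    have := (le_max_right _ _).trans hn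
    rwa [div_le_iff₀ (by positivity), mul_comm] at this
  have hpi : max R 3 ≤ Real.pi / (1 / (d * δ * n)) := by
    rw [div_div_eq_mul_div, div_one]
    have : 0 < d * δ * n := by positivity
    nlinarith [Real.pi_gt_three]
  refine ⟨n, 1 / (d * δ * n), ⟨T, hT, by positivity, (le_max_right _ _).trans hpi,
    fun j w hw l => ?_⟩, by exact_mod_cast hn0, by field_simp, rfl⟩
  have h1 : ‖w‖ ≤ R := hR w (mem_iUnion.2 ⟨j, hw⟩)
  have h2 : |w l| ≤ ‖w‖ := PiLp.norm_apply_le w l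
  exact abs_le.1 (h2.trans (h1.trans ((le_max_left _ _).trans hpi)))

theorem kakeyaFun_nonneg (d : ℕ) (δ : ℝ) : 0 ≤ kakeyaFun d δ :=
  Real.sInf_nonneg fun _ h => h.1.le

theorem exists_tubes_of_kakeyaFun_lt (hd : 1 ≤ d) {δ ε : ℝ} (hδ : 0 < δ)
    (h : kakeyaFun d δ < ε) :
    ∃ N : ℕ, 0 < N ∧ ∃ T : Fin N → (TubeModel d ≃ᵃⁱ[ℝ] EuclideanSpace ℝ (Fin d)),
      Pairwise (fun i j => Disjoint (shiftedTube δ (T i)) (shiftedTube δ (T j))) ∧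
      volume.real (⋃ j, tube δ (T j)) ≤
        ε * (N * volume.real (Metric.ball (0 : EuclideanSpace ℝ (Fin (d - 1))) δ)) := by
  have hfin : Module.finrank ℝ (TubeModel d) = d := by
    rw [(WithLp.linearEquiv 2 ℝ (ℝ × EuclideanSpace ℝ (Fin (d - 1)))).finrank_eq,
      Module.finrank_prod, finrank_euclideanSpace_fin, Module.finrank_self]
    omega
  set S := {ε : ℝ | 0 < ε ∧ ∃ N : ℕ, 0 < N ∧
    ∃ T : Fin N → (TubeModel d ≃ᵃⁱ[ℝ] EuclideanSpace ℝ (Fin d)),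
      Pairwise (fun i j => Disjoint (shiftedTube δ (T i)) (shiftedTube δ (T j))) ∧
      volume.real (⋃ j, tube δ (T j)) / ∑ j, volume.real (tube δ (T j)) ≤ ε} with hS
  -- An infimum over the empty set of reals would be 0; a single tube rules this out.
  have hne : S.Nonempty := by
    let T₀ : TubeModel d ≃ᵃⁱ[ℝ] EuclideanSpace ℝ (Fin d) :=
      ((stdOrthonormalBasis ℝ (TubeModel d)).reindex (finCongr hfin)).repr.toAffineIsometryEquiv
    refine ⟨max 1 (volume.real (⋃ _ : Fin 1, tube δ T₀) / ∑ _ : Fin 1, volume.real (tube δ T₀)),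
      lt_max_of_lt_left one_pos, 1, one_pos, fun _ => T₀, fun i j hij => ?_, le_max_right _ _⟩
    exact absurd (Subsingleton.elim i j) hij
  obtain ⟨ε', ⟨hε'0, N, hN, T, hT, hle⟩, hlt⟩ := exists_lt_of_csInf_lt hne h
  refine ⟨N, hN, T, hT, ?_⟩
  have hB0 : 0 < volume.real (Metric.ball (0 : EuclideanSpace ℝ (Fin (d - 1))) δ) :=
    ENNReal.toReal_pos (Metric.measure_ball_pos _ _ hδ).ne' measure_ball_lt_top.ne
  have hN0 : (0 : ℝ) < N := by exact_mod_cast hN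
  simp_rw [volume_real_tube] at hle
  rw [Finset.sum_const, Finset.card_univ, Fintype.card_fin, nsmul_eq_mul,
    div_le_iff₀ (by positivity)] at hle
  exact hle.trans (by gcongr)

/-- Everything is scale invariant: the number of tubes, the lattice and the width cancel, leaving a
constant that depends only on `d`. -/
theorem packet_constant_eq {n N : ℕ} {h δ B B₁ q : ℝ} (hd : 1 ≤ d) (hn : 0 < n) (hN : 0 < N)
    (hδ : 0 < δ) (hB₁ : 0 < B₁) (hB : B = δ ^ (d - 1) * B₁) (hh : h * (d * n) = 1 / δ) :
    h * (2 * q * (N * B * √((4 * d * n : ℕ) * B * (n ^ d * (2 * Real.pi / h) ^ (d + 1))))) /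
        (N * (n ^ d * (B / 2) ^ 2))
      = 8 * √(4 * d * (2 * Real.pi) ^ (d + 1) * d ^ (d - 1) / B₁) * q := by
  have hd0 : (0 : ℝ) < d := by exact_mod_cast hd
  have hn0 : (0 : ℝ) < n := by exact_mod_cast hn
  have hN0 : (0 : ℝ) < N := by exact_mod_cast hN
  have hh' : h = 1 / (δ * (d * n)) := by
    rw [← div_div, ← hh]; field_simp
  have hh0 : 0 < h := by rw [hh']; positivity
  have hB0 : 0 < B := by rw [hB]; positivity
  have h1 : h * √((4 * d * n : ℕ) * B * (n ^ d * (2 * Real.pi / h) ^ (d + 1)))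
      = √(4 * d * (2 * Real.pi) ^ (d + 1) * d ^ (d - 1) / B₁) * (n ^ d * B) := by
    rw [← Real.sqrt_sq hh0.le, ← Real.sqrt_mul (sq_nonneg _), Real.sqrt_sq hh0.le,
      ← Real.sqrt_sq (show 0 ≤ n ^ d * B by positivity), ← Real.sqrt_mul (by positivity)]
    congr 1
    obtain ⟨e, rfl⟩ : ∃ e, d = e + 1 := ⟨d - 1, by omega⟩
    have e1 : 2 * Real.pi / h = 2 * Real.pi * (δ * ((e + 1 : ℕ) * n)) := by
      rw [hh', div_div_eq_mul_div, div_one]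
    rw [e1, hB, hh', Nat.add_sub_cancel, Nat.cast_mul, Nat.cast_mul]
    generalize ((e + 1 : ℕ) : ℝ) = m at hd0
    simp only [mul_pow, div_pow, pow_succ, one_pow]
    field_simp
    norm_num
  calc _ = 2 * q * N * B * (h * √((4 * d * n : ℕ) * B * (n ^ d * (2 * Real.pi / h) ^ (d + 1)))) /
        (N * (n ^ d * (B / 2) ^ 2)) := by ring
    _ = _ := by rw [h1]; field_simp; ring

theorem exists_norm_integral_blockKernel_le (hd : 1 ≤ d) :
    ∃ C : ℝ, 0 ≤ C ∧ ∀ α : ℝ, 0 ≤ α → ∀ φ, IsTestedSymbol d α φ → ∀ θ ρ δ a b : ℝ,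
      0 < θ → θ < Real.pi → ρ ≠ 0 → 0 < δ → δ ≤ 1 → 2 ≤ a → a ≤ 5 / 2 → 0 ≤ b → b ≤ 1 / 2 →
      ‖∫ x, blockKernel a b x * φ (θ + ρ * x)‖ ≤
        C * (kakeyaFun d δ ^ α + δ + |ρ| / (δ ^ 2 * Real.sin θ)) := by
  set B₁ := volume.real (Metric.ball (0 : EuclideanSpace ℝ (Fin (d - 1))) 1) with hB₁
  have hB₁0 : 0 < B₁ :=
    ENNReal.toReal_pos (Metric.measure_ball_pos _ _ one_pos).ne' measure_ball_lt_top.ne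
  set C₁ := 8 * √(4 * d * (2 * Real.pi) ^ (d + 1) * d ^ (d - 1) / B₁) with hC₁
  have hC₁0 : 0 ≤ C₁ := by positivity
  have hpi := Real.pi_gt_three
  refine ⟨C₁ + 10240 * Real.pi, by positivity, fun α hα0 φ hφ θ ρ δ a b hθ0 hθπ hρ hδ0 hδ1 ha0 ha1
    hb0 hb1 => ?_⟩
  have hk := hasQuadraticDecay_blockKernel (a := a) (b := b)
    (abs_le.2 ⟨by linarith, by linarith⟩) (abs_le.2 ⟨by linarith, by linarith⟩)
  have hS0 : 0 < Real.sin θ := Real.sin_pos_of_pos_of_lt_pi hθ0 hθπ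
  set E := |ρ| / (δ ^ 2 * Real.sin θ) with hE
  have hE0 : 0 ≤ E := by positivity
  have hf0 := kakeyaFun_nonneg d δ
  have hfα : 0 ≤ kakeyaFun d δ ^ α := by positivity
  rcases le_or_gt E (1 / 16) with hE1 | hE1
  · have key : ∀ ε, kakeyaFun d δ < ε → ‖∫ x, blockKernel a b x * φ (θ + ρ * x)‖ ≤
        C₁ * ε ^ α + 320 * (20 * Real.pi * E + 8 * δ) := by
      intro ε hε
      obtain ⟨N, hN, T, hT, hU⟩ := exists_tubes_of_kakeyaFun_lt hd hδ0 hε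
      obtain ⟨n, h, Θ, hn, hh, rfl⟩ := exists_tubeFamily hd hδ0 T hT
      refine (Θ.norm_integral_blockKernel_le hα0 hφ hd hN hn hh ha0 ha1 hb0 hb1
        (hf0.trans_lt hε) hU hθ0 hθπ hρ hδ0 hδ1 hE hE1).trans (le_of_eq ?_)
      rw [packet_constant_eq (B₁ := B₁) hd hn hN hδ0 hB₁0 _ hh]
      rw [hB₁, Measure.real, Measure.addHaar_ball_of_pos _ _ hδ0, ENNReal.toReal_mul,
        ENNReal.toReal_ofReal (by positivity), finrank_euclideanSpace_fin]
      rfl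
    have hlim : Tendsto (fun ε => C₁ * ε ^ α + 320 * (20 * Real.pi * E + 8 * δ))
        (𝓝[>] (kakeyaFun d δ))
        (𝓝 (C₁ * kakeyaFun d δ ^ α + 320 * (20 * Real.pi * E + 8 * δ))) :=
      (((Real.continuous_rpow_const hα0).tendsto _).mono_left nhdsWithin_le_nhds).const_mul C₁
        |>.add_const _
    have h1 := ge_of_tendsto hlim (eventually_nhdsWithin_of_forall fun ε hε => key ε hε)
    refine h1.trans ?_
    nlinarith [mul_nonneg hC₁0 hE0, mul_nonneg hC₁0 hδ0.le]
  -- For `E > 1/16` the bound `‖φ‖ ≤ 2` suffices: `640 π` is at most `10240 π E`.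
  · refine (hk.norm_integral_mul_le (c := 2) fun x => hφ.norm_le hd _).trans ?_
    nlinarith [mul_nonneg hC₁0 hE0, mul_nonneg hC₁0 hδ0.le, mul_nonneg hC₁0 hfα]

end KakeyaBound

/-! ### Differences of means at consecutive scales. -/

section Telescoping

open Filter Topology

variable {k k' : ℝ → ℂ} {C C' : ℝ}

theorem HasQuadraticDecay.sub (hk : HasQuadraticDecay k C) (hk' : HasQuadraticDecay k' C') :
    HasQuadraticDecay (fun x => k x - k' x) (C + C') where
  continuous := hk.continuous.sub hk'.continuous
  norm_le x := by
    rw [add_mul]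
    exact (_root_.norm_sub_le _ _).trans (add_le_add (hk.norm_le x) (hk'.norm_le x))
  norm_sub_le x t ht := by
    have : k (x + t) - k' (x + t) - (k x - k' x) = (k (x + t) - k x) - (k' (x + t) - k' x) := by
      ring
    rw [this, add_mul, add_mul]
    exact (_root_.norm_sub_le _ _).trans (add_le_add (hk.norm_sub_le x t ht)
      (hk'.norm_sub_le x t ht))

theorem HasQuadraticDecay.comp_half (hk : HasQuadraticDecay k C) :
    HasQuadraticDecay (fun x => (1 / 4 : ℝ) * k (x / 2)) C := by
  have hC := hk.const_nonneg
  have h1 : ∀ x : ℝ, 1 / 4 * (1 + (x / 2) ^ 2)⁻¹ ≤ (1 + x ^ 2)⁻¹ := by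
    intro x
    rw [show (1 / 4 : ℝ) * (1 + (x / 2) ^ 2)⁻¹ = (4 * (1 + (x / 2) ^ 2))⁻¹ by
      rw [mul_inv]; norm_num]
    exact inv_anti₀ (by positivity) (by nlinarith)
  refine ⟨by have := hk.continuous; fun_prop, fun x => ?_, fun x t ht => ?_⟩
  · rw [norm_mul, Complex.norm_real, Real.norm_of_nonneg (by norm_num)]
    calc _ ≤ 1 / 4 * (C * (1 + (x / 2) ^ 2)⁻¹) := by gcongr; exact hk.norm_le _
      _ = C * (1 / 4 * (1 + (x / 2) ^ 2)⁻¹) := by ring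
      _ ≤ _ := by gcongr; exact h1 x
  · rw [← mul_sub, norm_mul, Complex.norm_real, Real.norm_of_nonneg (by norm_num), add_div]
    have ht2 : |t / 2| = |t| / 2 := by rw [abs_div, abs_of_pos (by norm_num : (0 : ℝ) < 2)]
    calc _ ≤ 1 / 4 * (C * |t / 2| * (1 + (x / 2) ^ 2)⁻¹) := by
          gcongr; exact hk.norm_sub_le _ _ (by rw [ht2]; linarith)
      _ = C * (|t| / 2) * (1 / 4 * (1 + (x / 2) ^ 2)⁻¹) := by rw [ht2]; ring
      _ ≤ C * |t| * (1 + x ^ 2)⁻¹ := by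
          gcongr
          · linarith [abs_nonneg t]
          · exact h1 x

/-- The kernel `x ↦ 2 (cos (x / 4) - cos (x / 2)) / x ^ 2` defining the averages `dilateMean`. -/
def annularKernel (x : ℝ) : ℂ := blockKernel 0 0 x - (1 / 4 : ℝ) * blockKernel 0 0 (x / 2)

theorem hasQuadraticDecay_annularKernel : HasQuadraticDecay annularKernel 640 := by
  have h := hasQuadraticDecay_blockKernel (a := 0) (b := 0) (by simp) (by simp)
  exact (by norm_num : (320 : ℝ) + 320 = 640) ▸ h.sub h.comp_half

theorem annularKernel_eq {x : ℝ} (hx : x ≠ 0) :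
    annularKernel x = (2 * (Real.cos (x / 4) - Real.cos (x / 2)) / x ^ 2 : ℝ) := by
  rw [annularKernel, blockKernel_eq hx, blockKernel_eq (div_ne_zero hx two_ne_zero)]
  have h1 : x / 2 / 2 = x / 4 := by ring
  simp only [sub_self, zero_mul, Complex.ofReal_zero, mul_zero, Complex.exp_zero, one_mul, h1]
  rw [← Complex.ofReal_mul, ← Complex.ofReal_sub]
  congr 1
  field_simp
  ring

theorem integral_annularKernel_ne_zero : ∫ x, annularKernel x ≠ 0 := by
  have hk := hasQuadraticDecay_blockKernel (a := 0) (b := 0) (by simp) (by simp)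
  have h1 : ∫ x, annularKernel x = (1 / 2 : ℝ) * ∫ x, blockKernel 0 0 x := by
    have e : ∀ x, annularKernel x = blockKernel 0 0 x - (1 / 4 : ℝ) * blockKernel 0 0 (x / 2) :=
      fun x => rfl
    simp_rw [e]
    rw [integral_sub hk.integrable hk.comp_half.integrable, integral_const_mul,
      Measure.integral_comp_div (fun x => blockKernel 0 0 x) 2]
    simp
    ring
  have h2 : ∀ x, blockKernel 0 0 x = (‖blockChar 0 x‖ ^ 2 : ℝ) := fun x => by
    rw [blockKernel, Complex.mul_conj']; push_cast; rfl
  have hi : Integrable fun x => ‖blockChar 0 x‖ ^ 2 := by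
    refine hk.integrable.re.congr (Eventually.of_forall fun x => ?_)
    simp only [h2, RCLike.re_eq_complex_re, Complex.ofReal_re]
  have hc : Continuous fun x => ‖blockChar 0 x‖ ^ 2 := by
    have := Complex.continuous_re.comp hk.continuous
    refine this.congr fun x => ?_
    simp only [Function.comp, h2, Complex.ofReal_re]
  have h3 : 0 < ∫ x, ‖blockChar 0 x‖ ^ 2 := by
    rw [integral_pos_iff_support_of_nonneg (fun x => by positivity) hi]
    refine (hc.isOpen_support).measure_pos _ ⟨0, ?_⟩
    simp [blockChar]
  rw [h1]
  simp_rw [h2]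
  rw [integral_complex_ofReal]
  refine mul_ne_zero (by norm_num) ?_
  exact_mod_cast h3.ne'

/-- On the frequency side `annularKernel` is a trapezoid, constant on |ξ| ≤ 1/4 and zero beyond 1/2.
The plateaus of the two dilates cancel; what remains lives on 1 ≤ |ξ| ≤ 3 and is piecewise linear
with nodes in ℤ/2. It is thus a sum of tents of half-width 1/2 centred at ±3/2, ±2, ±5/2, with
weights in the ratio 3 : 4 : 2. These centres are differences `a - b` with `a ∈ [2, 5/2]` and `b ∈
[0, 1/2]`, that is with one block in the shifted tube and one in the tube. -/
theorem annularKernel_dilation {x : ℝ} (hx : x ≠ 0) :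
    (3 / 2 : ℝ) * annularKernel (3 / 2 * (4 * x)) - annularKernel (4 * x) =
      (1 / 16 : ℝ) * (blockKernel 2 (1 / 2) x + blockKernel 2 (1 / 2) (-x)) +
      (1 / 12 : ℝ) * (blockKernel 2 0 x + blockKernel 2 0 (-x)) +
      (1 / 24 : ℝ) * (blockKernel (5 / 2) 0 x + blockKernel (5 / 2) 0 (-x)) := by
  have hsym : ∀ a b : ℝ, blockKernel a b x + blockKernel a b (-x)
      = (4 * Real.cos ((a - b) * x) * (1 - Real.cos (x / 2)) / x ^ 2 : ℝ) := by
    intro a b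
    rw [blockKernel_eq hx, blockKernel_eq (neg_ne_zero.2 hx), neg_div, Real.cos_neg, neg_sq,
      ← add_mul]
    have : Complex.exp (Complex.I * ((a - b) * x : ℝ)) + Complex.exp (Complex.I * ((a - b) * -x : ℝ))
        = (2 * Real.cos ((a - b) * x) : ℝ) := by
      push_cast
      rw [Complex.two_cos]
      ring_nf
    rw [this, ← Complex.ofReal_mul]
    congr 1
    ring
  rw [hsym, hsym, hsym, annularKernel_eq (by positivity), annularKernel_eq (by positivity)]
  norm_cast
  have hprod : ∀ v : ℝ, Real.cos (v * x) * Real.cos (x / 2)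
      = (Real.cos ((v + 1 / 2) * x) + Real.cos ((v - 1 / 2) * x)) / 2 := by
    intro v
    have e1 : (v + 1 / 2) * x = v * x + x / 2 := by ring
    have e2 : (v - 1 / 2) * x = v * x - x / 2 := by ring
    rw [e1, e2, Real.cos_add, Real.cos_sub]
    ring
  have p1 := hprod (2 - 1 / 2)
  have p2 := hprod (2 - 0)
  have p3 := hprod (5 / 2 - 0)
  norm_num at p1 p2 p3 ⊢
  have e1 : 3 / 2 * (4 * x) / 4 = 3 / 2 * x := by ring
  have e2 : 3 / 2 * (4 * x) / 2 = 3 * x := by ring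
  have e4 : 4 * x / 2 = 2 * x := by ring
  simp only [e1, e2, e4]
  field_simp
  ring_nf at p1 p2 p3 ⊢
  linear_combination 55296 * p1 + 73728 * p2 + 36864 * p3

/-- The average of `φ` around `s` at scale `ρ`, with weight `annularKernel`. -/
def dilateMean (φ : ℝ → ℂ) (ρ s : ℝ) : ℂ := ∫ x, annularKernel x * φ (s + ρ * x)

theorem tendsto_dilateMean {φ : ℝ → ℂ} (hφ : Continuous φ) (hφ2 : ∀ x, ‖φ x‖ ≤ 2) {ρ : ℕ → ℝ}
    (hρ : Tendsto ρ atTop (𝓝 0)) (s : ℝ) :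
    Tendsto (fun n => dilateMean φ (ρ n) s) atTop (𝓝 ((∫ x, annularKernel x) * φ s)) := by
  have hk := hasQuadraticDecay_annularKernel
  rw [← integral_mul_const]
  refine tendsto_integral_of_dominated_convergence (fun x => ‖annularKernel x‖ * 2)
    (fun n => (hk.continuous.mul (hφ.comp (by fun_prop))).aestronglyMeasurable)
    (hk.integrable.norm.mul_const 2) (fun n => Eventually.of_forall fun x => ?_)
    (Eventually.of_forall fun x => ?_)
  · rw [norm_mul]
    gcongr
    exact hφ2 _
  · refine Tendsto.const_mul _ ((hφ.tendsto s).comp ?_)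
    simpa using (hρ.mul_const x).const_add s

/-- The translation is moved from `φ`, of which only boundedness and continuity are known, to the
kernel, where it has size `(s - t) / ρ`. -/
theorem norm_dilateMean_sub_le {φ : ℝ → ℂ} (hφ : Continuous φ) (hφ2 : ∀ x, ‖φ x‖ ≤ 2) {ρ : ℝ}
    (hρ : 0 < ρ) (s t : ℝ) (hst : |s - t| ≤ ρ) :
    ‖dilateMean φ ρ s - dilateMean φ ρ t‖ ≤ 1280 * Real.pi * (|s - t| / ρ) := by
  have hk := hasQuadraticDecay_annularKernel
  have hψ : Continuous fun x => φ (s + ρ * x) := hφ.comp (by fun_prop)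
  have e1 : dilateMean φ ρ t = ∫ x, annularKernel (x + (s - t) / ρ) * φ (s + ρ * x) := by
    rw [dilateMean, ← integral_add_right_eq_self _ ((s - t) / ρ)]
    refine integral_congr_ae (Eventually.of_forall fun x => ?_)
    have : t + ρ * (x + (s - t) / ρ) = s + ρ * x := by field_simp; ring
    simp only [this]
  have hi : Integrable fun x => annularKernel (x + (s - t) / ρ) * φ (s + ρ * x) := by
    have h1 := (hk.integrable_mul (ψ := fun x => φ (t + ρ * x)) (hφ.comp (by fun_prop))
      fun x => hφ2 _).comp_add_right ((s - t) / ρ)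
    refine h1.congr (Eventually.of_forall fun x => ?_)
    have : t + ρ * (x + (s - t) / ρ) = s + ρ * x := by field_simp; ring
    simp only [this]
  rw [e1, dilateMean, norm_sub_rev, ← integral_sub hi (hk.integrable_mul hψ fun x => hφ2 _)]
  simp_rw [← sub_mul]
  have habs : |(s - t) / ρ| = |s - t| / ρ := by rw [abs_div, abs_of_pos hρ]
  refine (hk.norm_integral_sub_comp_add_le (fun x => hφ2 _) (t := (s - t) / ρ) ?_).trans
    (le_of_eq ?_)
  · rw [habs, div_le_one hρ]
    exact hst
  · rw [habs]; ring

/-- Both means are rescaled to the increment `4 ρ` of the angle; the tents at negative frequencies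
become averages with `ρ` replaced by `-ρ`. -/
theorem dilateMean_sub_dilateMean {φ : ℝ → ℂ} (hφ : Continuous φ) (hφ2 : ∀ x, ‖φ x‖ ≤ 2)
    (ρ s : ℝ) :
    dilateMean φ (2 / 3 * ρ) s - dilateMean φ ρ s = 4 *
      ((1 / 16 : ℝ) * ((∫ x, blockKernel 2 (1 / 2) x * φ (s + 4 * ρ * x)) +
          ∫ x, blockKernel 2 (1 / 2) x * φ (s + -(4 * ρ) * x)) +
        (1 / 12 : ℝ) * ((∫ x, blockKernel 2 0 x * φ (s + 4 * ρ * x)) +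
          ∫ x, blockKernel 2 0 x * φ (s + -(4 * ρ) * x)) +
        (1 / 24 : ℝ) * ((∫ x, blockKernel (5 / 2) 0 x * φ (s + 4 * ρ * x)) +
          ∫ x, blockKernel (5 / 2) 0 x * φ (s + -(4 * ρ) * x))) := by
  have hk := hasQuadraticDecay_annularKernel
  have hint : ∀ c : ℝ, c ≠ 0 → Integrable fun x => annularKernel (c * x) * φ (s + 4 * ρ * x) := by
    intro c hc
    have h1 := (hk.integrable_mul (ψ := fun x => φ (s + 4 * ρ * (x / c))) (hφ.comp (by fun_prop))
      fun x => hφ2 _).comp_mul_left' hc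
    refine h1.congr (Eventually.of_forall fun x => ?_)
    simp only
    rw [mul_div_cancel_left₀ _ hc]
  have hB : ∀ a b : ℝ, |a| ≤ 3 → |b| ≤ 3 → Integrable (fun x => blockKernel a b x *
      φ (s + 4 * ρ * x)) ∧ Integrable (fun x => blockKernel a b (-x) * φ (s + 4 * ρ * x)) ∧
      ∫ x, blockKernel a b (-x) * φ (s + 4 * ρ * x)
        = ∫ x, blockKernel a b x * φ (s + -(4 * ρ) * x) := by
    intro a b ha hb
    have hkb := hasQuadraticDecay_blockKernel ha hb
    refine ⟨hkb.integrable_mul (hφ.comp (by fun_prop)) fun x => hφ2 _, ?_, ?_⟩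
    · have := (hkb.integrable_mul (ψ := fun x => φ (s + -(4 * ρ) * x)) (hφ.comp (by fun_prop))
        fun x => hφ2 _).comp_neg
      refine this.congr (Eventually.of_forall fun x => ?_)
      simp
    · rw [← integral_neg_eq_self]
      simp
  have e1 : dilateMean φ (2 / 3 * ρ) s
      = 4 * ∫ x, (3 / 2 : ℝ) * annularKernel (3 / 2 * (4 * x)) * φ (s + 4 * ρ * x) := by
    have := Measure.integral_comp_mul_left
      (fun x => annularKernel x * φ (s + 2 / 3 * ρ * x)) (6 : ℝ)
    rw [dilateMean]
    simp_rw [mul_assoc ((3 / 2 : ℝ) : ℂ)]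
    rw [integral_const_mul]
    have e : ∀ x : ℝ, annularKernel (3 / 2 * (4 * x)) * φ (s + 4 * ρ * x)
        = annularKernel (6 * x) * φ (s + 2 / 3 * ρ * (6 * x)) := fun x => by
      congr 2 <;> ring
    simp_rw [e]
    rw [this]
    rw [abs_of_pos (by norm_num), Complex.real_smul]
    push_cast
    ring
  have e2 : dilateMean φ ρ s = 4 * ∫ x, annularKernel (4 * x) * φ (s + 4 * ρ * x) := by
    have := Measure.integral_comp_mul_left (fun x => annularKernel x * φ (s + ρ * x)) (4 : ℝ)
    rw [dilateMean]
    have e : ∀ x : ℝ, annularKernel (4 * x) * φ (s + 4 * ρ * x)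
        = annularKernel (4 * x) * φ (s + ρ * (4 * x)) := fun x => by
      congr 2; ring
    simp_rw [e]
    rw [this, abs_of_pos (by norm_num), Complex.real_smul]
    push_cast
    ring
  have i1 : Integrable fun x => (3 / 2 : ℝ) * annularKernel (3 / 2 * (4 * x)) *
      φ (s + 4 * ρ * x) := by
    refine ((hint 6 (by norm_num)).const_mul ((3 / 2 : ℝ) : ℂ)).congr
      (Eventually.of_forall fun x => ?_)
    simp only
    rw [show 3 / 2 * (4 * x) = 6 * x by ring]
    ring
  rw [e1, e2, ← mul_sub, ← integral_sub i1 (hint 4 (by norm_num))]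
  obtain ⟨a1, a2, a3⟩ := hB 2 (1 / 2) (by norm_num) (by norm_num [abs_of_pos])
  obtain ⟨b1, b2, b3⟩ := hB 2 0 (by norm_num) (by norm_num)
  obtain ⟨c1, c2, c3⟩ := hB (5 / 2) 0 (by norm_num [abs_of_pos]) (by norm_num)
  have hadd : ∀ (c : ℂ) {u v : ℝ → ℂ}, Integrable u → Integrable v →
      Integrable (fun x => c * (u x + v x)) ∧
        c * ((∫ x, u x) + ∫ x, v x) = ∫ x, c * (u x + v x) := fun c u v hu hv =>
    ⟨(hu.add hv).const_mul c, by rw [integral_const_mul, integral_add hu hv]⟩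
  obtain ⟨a4, a5⟩ := hadd (1 / 16 : ℝ) a1 a2
  obtain ⟨b4, b5⟩ := hadd (1 / 12 : ℝ) b1 b2
  obtain ⟨c4, c5⟩ := hadd (1 / 24 : ℝ) c1 c2
  rw [← a3, ← b3, ← c3, a5, b5, c5, ← integral_add' a4 b4, ← integral_add' (a4.add b4) c4]
  congr 1
  refine integral_congr_ae ?_
  filter_upwards [compl_mem_ae_iff.2 (measure_singleton (0 : ℝ))] with x hx
  rw [← sub_mul, annularKernel_dilation hx]
  simp only [Pi.add_apply]
  ring

theorem exists_norm_dilateMean_sub_le {d : ℕ} (hd : 1 ≤ d) :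
    ∃ C : ℝ, 0 ≤ C ∧ ∀ α : ℝ, 0 ≤ α → ∀ φ, IsTestedSymbol d α φ → ∀ s ρ δ : ℝ,
      0 < s → s < Real.pi → 0 < ρ → 0 < δ → δ ≤ 1 →
      ‖dilateMean φ (2 / 3 * ρ) s - dilateMean φ ρ s‖ ≤
        C * (kakeyaFun d δ ^ α + δ + ρ / (δ ^ 2 * Real.sin s)) := by
  obtain ⟨C, hC0, hC⟩ := exists_norm_integral_blockKernel_le hd
  refine ⟨6 * C, by positivity, fun α hα φ hφ s ρ δ hs0 hsπ hρ hδ0 hδ1 => ?_⟩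
  have hf := kakeyaFun_nonneg d δ
  have hS0 : 0 < Real.sin s := Real.sin_pos_of_pos_of_lt_pi hs0 hsπ
  rw [dilateMean_sub_dilateMean hφ.continuous (hφ.norm_le hd)]
  set X := C * (kakeyaFun d δ ^ α + δ + 4 * ρ / (δ ^ 2 * Real.sin s)) with hX
  have key : ∀ a b : ℝ, 2 ≤ a → a ≤ 5 / 2 → 0 ≤ b → b ≤ 1 / 2 →
      ‖(∫ x, blockKernel a b x * φ (s + 4 * ρ * x)) +
        ∫ x, blockKernel a b x * φ (s + -(4 * ρ) * x)‖ ≤ 2 * X := by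
    intro a b h1 h2 h3 h4
    refine (norm_add_le _ _).trans ?_
    rw [two_mul]
    have habs : |4 * ρ| = 4 * ρ := abs_of_pos (by positivity)
    refine add_le_add ((hC α hα φ hφ s (4 * ρ) δ a b hs0 hsπ (by positivity) hδ0 hδ1 h1 h2 h3
      h4).trans (by rw [habs])) ((hC α hα φ hφ s (-(4 * ρ)) δ a b hs0 hsπ
      (neg_ne_zero.2 (by positivity)) hδ0 hδ1 h1 h2 h3 h4).trans (by rw [abs_neg, habs]))
  have k1 := key 2 (1 / 2) (by norm_num) (by norm_num) (by norm_num) (by norm_num)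
  have k2 := key 2 0 (by norm_num) (by norm_num) (by norm_num) (by norm_num)
  have k3 := key (5 / 2) 0 (by norm_num) (by norm_num) (by norm_num) (by norm_num)
  rw [norm_mul]
  have h4 : ‖(4 : ℂ)‖ = 4 := by norm_num
  rw [h4]
  have hfα : 0 ≤ kakeyaFun d δ ^ α := by positivity
  have hq : 0 ≤ ρ / (δ ^ 2 * Real.sin s) := by positivity
  have hX' : X ≤ 4 * (C * (kakeyaFun d δ ^ α + δ + ρ / (δ ^ 2 * Real.sin s))) := by
    rw [hX, mul_div_assoc, mul_left_comm]
    refine mul_le_mul_of_nonneg_left ?_ hC0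
    linarith
  refine (mul_le_mul_of_nonneg_left (norm_add₃_le.trans (add_le_add (add_le_add
    (b := 1 / 16 * (2 * X)) (d := 1 / 12 * (2 * X)) ?_ ?_) (?_ : _ ≤ 1 / 24 * (2 * X))))
    (by norm_num)).trans (by linarith)
  all_goals
    rw [norm_mul, Complex.norm_real, Real.norm_of_nonneg (by norm_num)]
    gcongr

end Telescoping

/-! ### Summation over scales and the modulus of continuity. -/

section Modulus

open Filter Topology

/-- The width is a free parameter: the bound is averaged over a window of length at least `A / 10`,
on which `1 / A ≤ 1 / x`. This replaces values of `g` by an integral without any regularity of `g`.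
-/
theorem ofReal_le_add_lintegral {g : ℝ → ℝ} {C D E A r : ℝ} (hC : 0 ≤ C) (hA : 0 < A)
    (hr1 : r ≤ 9 / 10) (hD : 0 ≤ D)
    (h : ∀ x ∈ Ioo (A * r) A, 0 < x ∧ E ≤ C * (g x + D)) :
    ENNReal.ofReal E ≤ ENNReal.ofReal (C * D) +
      ENNReal.ofReal (10 * C) * ∫⁻ x in Ioo (A * r) A, ENNReal.ofReal (g x / x) := by
  rcases le_or_gt E (C * D) with hE | hE
  · exact (ENNReal.ofReal_le_ofReal hE).trans le_self_add
  have h1 : ENNReal.ofReal (E - C * D) ≤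
      ENNReal.ofReal (10 * C) * ∫⁻ x in Ioo (A * r) A, ENNReal.ofReal (g x / x) := by
    rw [← lintegral_const_mul' _ _ ENNReal.ofReal_ne_top]
    calc ENNReal.ofReal (E - C * D)
        ≤ ∫⁻ _ in Ioo (A * r) A, ENNReal.ofReal (10 * ((E - C * D) / A)) := by
          rw [setLIntegral_const, Real.volume_Ioo, ← ENNReal.ofReal_mul (by
            have : 0 < E - C * D := by linarith
            positivity)]
          refine ENNReal.ofReal_le_ofReal ?_
          have : 10 * ((E - C * D) / A) * (A - A * r) = (E - C * D) * (10 * (1 - r)) := by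
            field_simp
          rw [this]
          nlinarith
      _ ≤ _ := by
          refine setLIntegral_mono' measurableSet_Ioo fun x hx => ?_
          obtain ⟨hx0, hxE⟩ := h x hx
          rw [← ENNReal.ofReal_mul (by positivity)]
          refine ENNReal.ofReal_le_ofReal ?_
          rw [mul_assoc]
          refine mul_le_mul_of_nonneg_left ?_ (by norm_num)
          rw [← mul_div_assoc]
          have h2 : E - C * D ≤ C * g x := by linarith
          have h3 : 0 < E - C * D := by linarith
          exact div_le_div₀ (by linarith) h2 hx0 hx.2.le
  calc ENNReal.ofReal E = ENNReal.ofReal (C * D + (E - C * D)) := by ring_nf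
    _ ≤ _ := by
        rw [ENNReal.ofReal_add (by positivity) (by linarith)]
        gcongr

theorem sum_setLIntegral_Ioo_le (G : ℝ → ℝ≥0∞) {A r : ℝ} (hA : 0 < A) (hr0 : 0 < r) (hr1 : r ≤ 1)
    (K : ℕ) : ∑ k ∈ Finset.range K, ∫⁻ x in Ioo (A * r ^ k * r) (A * r ^ k), G x
      ≤ ∫⁻ x in Ioo 0 A, G x := by
  have hanti : Antitone fun k : ℕ => A * r ^ k := fun i j hij =>
    mul_le_mul_of_nonneg_left (pow_le_pow_of_le_one hr0.le hr1 hij) hA.le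
  have hd := hanti.pairwise_disjoint_on_Ioo_succ
  have e : ∀ k : ℕ, Ioo (A * r ^ k * r) (A * r ^ k) = Ioo (A * r ^ (Order.succ k)) (A * r ^ k) := by
    intro k
    rw [Nat.succ_eq_succ, Nat.succ_eq_add_one, pow_succ, mul_assoc]
  simp_rw [e]
  calc _ ≤ ∑' k : ℕ, ∫⁻ x in Ioo (A * r ^ (Order.succ k)) (A * r ^ k), G x := ENNReal.sum_le_tsum _
    _ = ∫⁻ x in ⋃ k : ℕ, Ioo (A * r ^ (Order.succ k)) (A * r ^ k), G x :=
        (lintegral_iUnion (fun _ => measurableSet_Ioo) hd _).symm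
    _ ≤ _ := lintegral_mono_set (iUnion_subset fun k => Ioo_subset_Ioo (by positivity) (by
        have := hanti (Nat.zero_le k)
        simpa using this))

theorem ofReal_norm_sub_dilateMean_le {d : ℕ} (hd : 1 ≤ d) :
    ∃ C : ℝ, 0 ≤ C ∧ ∀ α : ℝ, 0 ≤ α → ∀ φ, IsTestedSymbol d α φ → ∀ s R A : ℝ,
      0 < s → s < Real.pi → 0 < R → 0 < A → A ≤ 1 →
      ENNReal.ofReal ‖(∫ x, annularKernel x) * φ s - dilateMean φ R s‖ ≤
        ENNReal.ofReal (C * (A + R / (A ^ 2 * Real.sin s))) +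
        ENNReal.ofReal C * ∫⁻ δ in Ioo 0 A, ENNReal.ofReal (kakeyaFun d δ ^ α / δ) := by
  obtain ⟨C, hC0, hC⟩ := exists_norm_dilateMean_sub_le hd
  refine ⟨10 * C, by positivity, fun α hα φ hφ s R A hs0 hsπ hR hA0 hA1 => ?_⟩
  have hS0 : 0 < Real.sin s := Real.sin_pos_of_pos_of_lt_pi hs0 hsπ
  -- The angular scale shrinks by 2/3 and the tube width by 9/10 at each step. Since (2/3)/(9/10)² =
  -- 200/243 < 1, the errors `ρ / (δ² sin s)` are summable; the factor 100/81 comes from the lower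
  -- end of the window of widths.
  set ρ : ℕ → ℝ := fun k => R * (2 / 3) ^ k with hρ
  have hρ0 : ∀ k, 0 < ρ k := fun k => by positivity
  set a : ℕ → ℝ := fun k => A * (9 / 10) ^ k with ha
  have ha0 : ∀ k, 0 < a k := fun k => by positivity
  have ha1 : ∀ k, a k ≤ 1 := fun k => mul_le_one₀ hA1 (by positivity)
    (pow_le_one₀ (by norm_num) (by norm_num))
  set q := R / (A ^ 2 * Real.sin s) with hq
  have hq0 : 0 < q := by positivity
  set D : ℕ → ℝ := fun k => A * (9 / 10) ^ k + 100 / 81 * q * (200 / 243) ^ k with hD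
  have hD0 : ∀ k, 0 ≤ D k := fun k => by positivity
  have hDk : ∀ k, ρ k / ((a k * (9 / 10)) ^ 2 * Real.sin s) = 100 / 81 * q * (200 / 243) ^ k := by
    intro k
    simp only [hρ, ha, hq]
    have e : (200 / 243 : ℝ) ^ k = (2 / 3) ^ k / ((9 / 10) ^ k) ^ 2 := by
      rw [← pow_mul, mul_comm k 2, pow_mul, ← div_pow]
      norm_num
    rw [e]
    generalize (2 / 3 : ℝ) ^ k = x
    have : (0 : ℝ) < (9 / 10) ^ k := by positivity
    generalize (9 / 10 : ℝ) ^ k = y at this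
    field_simp
    ring
  have hstep : ∀ k, ENNReal.ofReal ‖dilateMean φ (ρ (k + 1)) s - dilateMean φ (ρ k) s‖ ≤
      ENNReal.ofReal (C * D k) + ENNReal.ofReal (10 * C) *
        ∫⁻ δ in Ioo (a k * (9 / 10)) (a k), ENNReal.ofReal (kakeyaFun d δ ^ α / δ) := by
    intro k
    refine ofReal_le_add_lintegral (g := fun δ => kakeyaFun d δ ^ α) hC0 (ha0 k) le_rfl (hD0 k)
      fun δ hδ => ?_
    have hδ0 : 0 < δ := lt_trans (by have := ha0 k; positivity) hδ.1
    refine ⟨hδ0, ?_⟩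
    have e : ρ (k + 1) = 2 / 3 * ρ k := by simp only [hρ, pow_succ]; ring
    rw [e]
    refine (hC α hα φ hφ s (ρ k) δ hs0 hsπ (hρ0 k) hδ0 (hδ.2.le.trans (ha1 k))).trans ?_
    refine mul_le_mul_of_nonneg_left ?_ hC0
    have h1 : ρ k / (δ ^ 2 * Real.sin s) ≤ 100 / 81 * q * (200 / 243) ^ k := by
      rw [← hDk]
      have := hρ0 k
      have := ha0 k
      gcongr
      exact hδ.1.le
    have h2 : δ ≤ A * (9 / 10) ^ k := hδ.2.le
    simp only [hD]
    linarith
  have hgeo : ∀ (r : ℝ) (K : ℕ), 0 ≤ r → r < 1 → ∑ k ∈ Finset.range K, r ^ k ≤ (1 - r)⁻¹ :=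
    fun r K h0 h1 => by
      rw [← tsum_geometric_of_lt_one h0 h1]
      exact (summable_geometric_of_lt_one h0 h1).sum_le_tsum _ fun _ _ => by positivity
  have hDsum : ∀ K, ∑ k ∈ Finset.range K, C * D k ≤ 10 * C * (A + q) := by
    intro K
    rw [← Finset.mul_sum]
    simp only [hD]
    rw [Finset.sum_add_distrib, ← Finset.mul_sum, ← Finset.mul_sum]
    have h1 := hgeo (9 / 10) K (by norm_num) (by norm_num)
    have h2 := hgeo (200 / 243) K (by norm_num) (by norm_num)
    have h3 : A * ∑ k ∈ Finset.range K, (9 / 10 : ℝ) ^ k ≤ A * 10 :=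
      mul_le_mul_of_nonneg_left (h1.trans (by norm_num)) hA0.le
    have h4 : 100 / 81 * q * ∑ k ∈ Finset.range K, (200 / 243 : ℝ) ^ k ≤ 100 / 81 * q * (243 / 43) :=
      mul_le_mul_of_nonneg_left (h2.trans (by norm_num)) (by positivity)
    calc _ ≤ C * (A * 10 + 100 / 81 * q * (243 / 43)) := by gcongr
      _ ≤ C * (10 * (A + q)) := by
          refine mul_le_mul_of_nonneg_left ?_ hC0
          linarith
      _ = _ := by ring
  set J := ∫⁻ δ in Ioo 0 A, ENNReal.ofReal (kakeyaFun d δ ^ α / δ) with hJ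
  have hpart : ∀ K, ENNReal.ofReal ‖dilateMean φ (ρ K) s - dilateMean φ R s‖ ≤
      ENNReal.ofReal (10 * C * (A + q)) + ENNReal.ofReal (10 * C) * J := by
    intro K
    have e0 : dilateMean φ R s = dilateMean φ (ρ 0) s := by simp [hρ]
    rw [e0, ← Finset.sum_range_sub fun k => dilateMean φ (ρ k) s]
    calc _ ≤ ENNReal.ofReal (∑ k ∈ Finset.range K,
          ‖dilateMean φ (ρ (k + 1)) s - dilateMean φ (ρ k) s‖) :=
          ENNReal.ofReal_le_ofReal (norm_sum_le _ _)
      _ = ∑ k ∈ Finset.range K,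
          ENNReal.ofReal ‖dilateMean φ (ρ (k + 1)) s - dilateMean φ (ρ k) s‖ :=
          ENNReal.ofReal_sum_of_nonneg fun _ _ => norm_nonneg _
      _ ≤ ∑ k ∈ Finset.range K, (ENNReal.ofReal (C * D k) + ENNReal.ofReal (10 * C) *
          ∫⁻ δ in Ioo (a k * (9 / 10)) (a k), ENNReal.ofReal (kakeyaFun d δ ^ α / δ)) :=
          Finset.sum_le_sum fun k _ => hstep k
      _ = ENNReal.ofReal (∑ k ∈ Finset.range K, C * D k) + ENNReal.ofReal (10 * C) *
          ∑ k ∈ Finset.range K,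
          ∫⁻ δ in Ioo (a k * (9 / 10)) (a k), ENNReal.ofReal (kakeyaFun d δ ^ α / δ) := by
          rw [Finset.sum_add_distrib, ENNReal.ofReal_sum_of_nonneg fun k _ =>
            mul_nonneg hC0 (hD0 k), Finset.mul_sum]
      _ ≤ _ := by
          gcongr
          · exact hDsum K
          · exact sum_setLIntegral_Ioo_le _ hA0 (by norm_num) (by norm_num) K
  have hlim : Tendsto (fun K => ENNReal.ofReal ‖dilateMean φ (ρ K) s - dilateMean φ R s‖) atTop
      (𝓝 (ENNReal.ofReal ‖(∫ x, annularKernel x) * φ s - dilateMean φ R s‖)) := by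
    refine (ENNReal.continuous_ofReal.tendsto _).comp (Tendsto.norm (Tendsto.sub_const
      (tendsto_dilateMean hφ.continuous (hφ.norm_le hd) ?_ s) _))
    simpa using (tendsto_pow_atTop_nhds_zero_of_lt_one (r := (2 / 3 : ℝ)) (by norm_num)
      (by norm_num)).const_mul R
  exact le_of_tendsto' hlim hpart

set_option maxHeartbeats 800000 in
-- Both `φ s` and `φ t` are compared with their means at a common scale `R`, and these two means
-- with each other. The lower bound on the norm is the nonzero integral of `annularKernel`, by which
-- one divides.
theorem exists_ofReal_norm_sub_le {d : ℕ} (hd : 1 ≤ d) :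
    ∃ C : ℝ, 0 ≤ C ∧ ∀ α : ℝ, 0 ≤ α → ∀ φ, IsTestedSymbol d α φ → ∀ s t τ : ℝ,
      0 < s → s < Real.pi → 0 < t → t < Real.pi → 0 < τ → |s - t| ≤ τ →
      ENNReal.ofReal ‖φ s - φ t‖ ≤ ENNReal.ofReal C *
        ((∫⁻ δ in Ioo 0 (τ ^ (1 / 3 : ℝ)), ENNReal.ofReal (kakeyaFun d δ ^ α / δ)) +
          ENNReal.ofReal (τ ^ (1 / 9 : ℝ) *
            (1 / Real.sin s ^ (1 / 3 : ℝ) + 1 / Real.sin t ^ (1 / 3 : ℝ)))) := by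
  obtain ⟨C, hC0, hC⟩ := ofReal_norm_sub_dilateMean_le hd
  set c := ‖∫ x, annularKernel x‖ with hc
  have hc0 : 0 < c := norm_pos_iff.2 integral_annularKernel_ne_zero
  set M := (4 * C + 1280 * Real.pi) / c + 4 with hM
  have hpi := Real.pi_pos
  have hM4 : 4 ≤ M := by rw [hM]; have : 0 ≤ (4 * C + 1280 * Real.pi) / c := by positivity
                         linarith
  refine ⟨M, by linarith, fun α hα φ hφ s t τ hs0 hsπ ht0 htπ hτ hst => ?_⟩
  have hS : 0 < Real.sin s := Real.sin_pos_of_pos_of_lt_pi hs0 hsπ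
  have hT : 0 < Real.sin t := Real.sin_pos_of_pos_of_lt_pi ht0 htπ
  set J := ∫⁻ δ in Ioo 0 (τ ^ (1 / 3 : ℝ)), ENNReal.ofReal (kakeyaFun d δ ^ α / δ) with hJ
  set Y := τ ^ (1 / 9 : ℝ) * (1 / Real.sin s ^ (1 / 3 : ℝ) + 1 / Real.sin t ^ (1 / 3 : ℝ)) with hY
  set σ := min (Real.sin s) (Real.sin t) with hσ
  have hσ0 : 0 < σ := lt_min hS hT
  have hσ1 : σ ≤ 1 := (min_le_left _ _).trans (Real.sin_le_one s)
  set u := τ ^ (1 / 9 : ℝ) with hu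
  set v := σ ^ (1 / 3 : ℝ) with hv
  have hu0 : 0 < u := by positivity
  have hv0 : 0 < v := by positivity
  have hv1 : v ≤ 1 := Real.rpow_le_one hσ0.le hσ1 (by norm_num)
  have hτu : τ = u ^ 9 := by
    rw [hu, ← Real.rpow_mul_natCast hτ.le]; norm_num
  have hA : τ ^ (1 / 3 : ℝ) = u ^ 3 := by
    rw [hu, ← Real.rpow_mul_natCast hτ.le]; norm_num
  have hσv : σ = v ^ 3 := by
    rw [hv, ← Real.rpow_mul_natCast hσ0.le]; norm_num
  have huvY : u / v ≤ Y := by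
    rw [hY, div_eq_mul_one_div]
    refine mul_le_mul_of_nonneg_left ?_ hu0.le
    rcases min_choice (Real.sin s) (Real.sin t) with h | h
    · rw [hv, hσ, h]
      have : 0 ≤ 1 / Real.sin t ^ (1 / 3 : ℝ) := by positivity
      linarith
    · rw [hv, hσ, h]
      have : 0 ≤ 1 / Real.sin s ^ (1 / 3 : ℝ) := by positivity
      linarith
  have hY0 : 0 < Y := lt_of_lt_of_le (by positivity) huvY
  clear_value Y J u v σ
  -- If `v ≤ u` the second term of the bound is at least 1 and `‖φ‖ ≤ 2` is enough.
  rcases le_or_gt v u with huv | huv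
  · have h1 : ‖φ s - φ t‖ ≤ M * Y := by
      have h2 : 1 ≤ u / v := by rwa [one_le_div hv0]
      have h3 := norm_sub_le (φ s) (φ t)
      have h4 := hφ.norm_le hd s
      have h5 := hφ.norm_le hd t
      calc _ ≤ 4 * (1 : ℝ) := by linarith
        _ ≤ M * Y := by gcongr; exact h2.trans huvY
    calc _ ≤ ENNReal.ofReal (M * Y) := ENNReal.ofReal_le_ofReal h1
      _ = ENNReal.ofReal M * ENNReal.ofReal Y := ENNReal.ofReal_mul (by linarith)
      _ ≤ _ := by gcongr; exact le_add_self
  · set y := u / v with hy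
    have hy0 : 0 < y := by positivity
    have hy1 : y ≤ 1 := by rw [hy, div_le_one hv0]; exact huv.le
    have hu1 : u ≤ 1 := huv.le.trans hv1
    -- With `A = u³` and `y = u / v`, this gives `τ / R = y` and `R / (A² σ) = y²`, while `A ≤ y`:
    -- all errors are at most `y ≤ 1`.
    set R := u ^ 8 * v with hR
    have hR0 : 0 < R := by positivity
    have hRτ : τ / R = y := by rw [hτu, hR, hy]; field_simp
    have huy : u ≤ y := by rw [hy, le_div_iff₀ hv0]; nlinarith
    have hA1 : u ^ 3 ≤ 1 := pow_le_one₀ hu0.le hu1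
    have hAy : u ^ 3 ≤ y := le_trans (by nlinarith [pow_le_one₀ (n := 2) hu0.le hu1]) huy
    have hsin : ∀ x, σ ≤ Real.sin x → R / ((u ^ 3) ^ 2 * Real.sin x) ≤ y := by
      intro x hx
      calc R / ((u ^ 3) ^ 2 * Real.sin x) ≤ R / ((u ^ 3) ^ 2 * σ) := by gcongr
        _ = y * y := by rw [hR, hσv, hy]; field_simp
        _ ≤ y := by nlinarith
    have hone : ∀ x, 0 < x → x < Real.pi → σ ≤ Real.sin x →
        ENNReal.ofReal ‖(∫ x, annularKernel x) * φ x - dilateMean φ R x‖ ≤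
          ENNReal.ofReal (2 * C * y) + ENNReal.ofReal C * J := by
      intro x hx0 hxπ hx
      refine (hC α hα φ hφ x R (u ^ 3) hx0 hxπ hR0 (by positivity) hA1).trans ?_
      rw [hJ, hA]
      refine add_le_add_left (ENNReal.ofReal_le_ofReal ?_) _
      have := hsin x hx
      nlinarith
    have hs := hone s hs0 hsπ (hσ.le.trans (min_le_left _ _))
    have ht := hone t ht0 htπ (hσ.le.trans (min_le_right _ _))
    have hRst : |s - t| ≤ R := hst.trans (by
      have : τ = y * R := by rw [← hRτ]; field_simp
      rw [this]; nlinarith)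
    have hmid : ‖dilateMean φ R s - dilateMean φ R t‖ ≤ 1280 * Real.pi * y := by
      refine (norm_dilateMean_sub_le hφ.continuous (hφ.norm_le hd) hR0 s t hRst).trans ?_
      rw [← hRτ]
      gcongr
    set I := ∫ x, annularKernel x with hI
    have htri : c * ‖φ s - φ t‖ ≤ ‖I * φ s - dilateMean φ R s‖ + ‖I * φ t - dilateMean φ R t‖ +
        ‖dilateMean φ R s - dilateMean φ R t‖ := by
      rw [hc, ← norm_mul]
      have : I * (φ s - φ t) = (I * φ s - dilateMean φ R s) - (I * φ t - dilateMean φ R t) +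
        (dilateMean φ R s - dilateMean φ R t) := by ring
      rw [this]
      exact (norm_add_le _ _).trans (add_le_add_left (norm_sub_le _ _) _)
    have hsum : ENNReal.ofReal (c * ‖φ s - φ t‖) ≤
        ENNReal.ofReal ((4 * C + 1280 * Real.pi) * Y) + ENNReal.ofReal (2 * C) * J := by
      calc _ ≤ ENNReal.ofReal (‖I * φ s - dilateMean φ R s‖ + ‖I * φ t - dilateMean φ R t‖ +
            ‖dilateMean φ R s - dilateMean φ R t‖) := ENNReal.ofReal_le_ofReal htri
        _ ≤ (ENNReal.ofReal (2 * C * y) + ENNReal.ofReal C * J) +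
            (ENNReal.ofReal (2 * C * y) + ENNReal.ofReal C * J) +
            ENNReal.ofReal (1280 * Real.pi * y) := by
            rw [ENNReal.ofReal_add (by positivity) (by positivity),
              ENNReal.ofReal_add (by positivity) (by positivity)]
            gcongr
        _ = ENNReal.ofReal ((4 * C + 1280 * Real.pi) * y) + ENNReal.ofReal (2 * C) * J := by
            have e1 : (4 * C + 1280 * Real.pi) * y = 2 * C * y + 2 * C * y + 1280 * Real.pi * y := by
              ring
            have e2 : ENNReal.ofReal (2 * C) = ENNReal.ofReal C + ENNReal.ofReal C := by
              rw [two_mul, ENNReal.ofReal_add hC0 hC0]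
            rw [e1, e2, ENNReal.ofReal_add (by positivity) (by positivity),
              ENNReal.ofReal_add (by positivity) (by positivity)]
            ring
        _ ≤ _ := by gcongr
    have hfin : ENNReal.ofReal ‖φ s - φ t‖ = ENNReal.ofReal c⁻¹ * ENNReal.ofReal (c * ‖φ s - φ t‖) := by
      rw [← ENNReal.ofReal_mul (by positivity), inv_mul_cancel_left₀ hc0.ne']
    rw [hfin]
    calc _ ≤ ENNReal.ofReal c⁻¹ * (ENNReal.ofReal ((4 * C + 1280 * Real.pi) * Y) +
          ENNReal.ofReal (2 * C) * J) := by gcongr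
      _ = ENNReal.ofReal ((4 * C + 1280 * Real.pi) / c * Y) + ENNReal.ofReal (2 * C / c) * J := by
          rw [mul_add, ← ENNReal.ofReal_mul (by positivity), ← mul_assoc (ENNReal.ofReal c⁻¹),
            ← ENNReal.ofReal_mul (by positivity)]
          rw [← mul_assoc c⁻¹, inv_mul_eq_div, inv_mul_eq_div]
      _ ≤ ENNReal.ofReal (M * Y) + ENNReal.ofReal M * J := by
          gcongr
          · rw [hM]; linarith
          · rw [hM]
            have : 2 * C / c ≤ (4 * C + 1280 * Real.pi) / c := by gcongr; linarith
            linarith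
      _ = _ := by
          rw [ENNReal.ofReal_mul (by linarith), mul_add, add_comm]

/-- Folding the line onto [0, π] is 1-Lipschitz. Otherwise, as the cosine decreases there, the
addition formulas would give |sin t| sin|s-t| < sin(s-t) sin t. -/
theorem arccos_cos_sub_le (s t : ℝ) :
    Real.arccos (Real.cos s) - Real.arccos (Real.cos t) ≤ |s - t| := by
  by_contra! h
  have hs := Real.cos_arccos (Real.neg_one_le_cos s) (Real.cos_le_one s)
  have ht := Real.cos_arccos (Real.neg_one_le_cos t) (Real.cos_le_one t)
  have ht' : Real.sin (Real.arccos (Real.cos t)) = |Real.sin t| := by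
    rw [Real.sin_arccos, Real.abs_sin_eq_sqrt_one_sub_cos_sq]
  have h1 := Real.cos_lt_cos_of_nonneg_of_le_pi (add_nonneg (Real.arccos_nonneg (Real.cos t))
    (abs_nonneg (s - t))) (Real.arccos_le_pi (Real.cos s)) (by linarith)
  rw [hs, Real.cos_add, ht, ht', Real.cos_abs, ← sub_add_cancel s t, Real.cos_add,
    sub_add_cancel] at h1
  have hπ : |s - t| ≤ Real.pi := by
    linarith [Real.arccos_le_pi (Real.cos s), Real.arccos_nonneg (Real.cos t)]
  have h2 : Real.sin (s - t) * Real.sin t ≤ |Real.sin t| * Real.sin |s - t| := by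
    refine (le_abs_self _).trans ?_
    rw [abs_mul, mul_comm]
    refine mul_le_mul_of_nonneg_left ?_ (abs_nonneg _)
    rcases abs_choice (s - t) with h3 | h3
    · rw [h3, abs_of_nonneg]
      exact Real.sin_nonneg_of_nonneg_of_le_pi (h3 ▸ abs_nonneg _) (h3 ▸ hπ)
    · rw [h3, ← abs_neg, ← Real.sin_neg, abs_of_nonneg]
      exact Real.sin_nonneg_of_nonneg_of_le_pi (h3 ▸ abs_nonneg _) (h3 ▸ hπ)
  linarith

theorem abs_arccos_cos_sub_le (s t : ℝ) :
    |Real.arccos (Real.cos s) - Real.arccos (Real.cos t)| ≤ |s - t| :=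
  abs_sub_le_iff.2 ⟨arccos_cos_sub_le s t, abs_sub_comm s t ▸ arccos_cos_sub_le t s⟩

end Modulus

end

theorem corollary6p4 (d : ℕ) (hd : 1 ≤ d) :
    ∃ C : ℝ≥0, ∀ p : ℝ≥0∞, 1 ≤ p → ∀ m : ℝ → ℂ,
      MemLp (zonalSymbol d m) ∞ ((sphereMeasure d).prod (sphereMeasure d)) →
      schurNorm p (sphereMeasure d) (zonalSymbol d m) = 1 →
      ∀ᵐ z : ℝ × ℝ,
        ENNReal.ofReal ‖m (Real.cos z.1) - m (Real.cos z.2)‖ ≤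
          (C : ℝ≥0∞) *
            ((∫⁻ δ in Ioo (0 : ℝ) (|z.1 - z.2| ^ (1 / 3 : ℝ)),
                ENNReal.ofReal (kakeyaFun d δ ^ |(p⁻¹).toReal - 1 / 2| / δ)) +
              ENNReal.ofReal (|z.1 - z.2| ^ (1 / 9 : ℝ) *
                (1 / |Real.sin z.1| ^ (1 / 3 : ℝ) + 1 / |Real.sin z.2| ^ (1 / 3 : ℝ)))) := by
  obtain ⟨C, hC0, hC⟩ := exists_ofReal_norm_sub_le hd
  refine ⟨C.toNNReal, fun p hp m hM hnorm => ?_⟩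
  obtain ⟨φ, hφ, hlim⟩ := exists_isTestedSymbol_tendsto hd hp hM
    (schurContractive_of_schurNorm_le_one hnorm.le)
  have hsin : ∀ᵐ s : ℝ, Real.sin s ≠ 0 := by
    rw [ae_iff]
    refine Set.Countable.measure_zero ?_ _
    refine (countable_range fun n : ℤ => n * Real.pi).mono fun s hs => ?_
    simpa using Real.sin_eq_zero_iff.1 (not_not.1 hs)
  have hae := hlim.and hsin
  rw [Measure.volume_eq_prod]
  filter_upwards [Measure.quasiMeasurePreserving_fst.ae hae,
    Measure.quasiMeasurePreserving_snd.ae hae] with z hz1 hz2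
  rcases eq_or_ne z.1 z.2 with heq | hne
  · simp [heq]
  have hfold : ∀ s : ℝ, Real.sin s ≠ 0 → 0 < Real.arccos (Real.cos s) ∧
      Real.arccos (Real.cos s) < Real.pi ∧ Real.sin (Real.arccos (Real.cos s)) = |Real.sin s| ∧
      Real.cos (Real.arccos (Real.cos s)) = Real.cos s := by
    intro s hs
    have h1 := Real.cos_arccos (Real.neg_one_le_cos s) (Real.cos_le_one s)
    have h2 : Real.sin (Real.arccos (Real.cos s)) = |Real.sin s| := by
      rw [Real.sin_arccos, Real.abs_sin_eq_sqrt_one_sub_cos_sq]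
    have h3 : Real.sin (Real.arccos (Real.cos s)) ≠ 0 := by rw [h2]; exact abs_ne_zero.2 hs
    refine ⟨(Real.arccos_nonneg _).lt_of_ne' fun h => h3 ?_, (Real.arccos_le_pi _).lt_of_ne
      fun h => h3 ?_, h2, h1⟩
    · rw [h, Real.sin_zero]
    · rw [h, Real.sin_pi]
  have hdist : |Real.arccos (Real.cos z.1) - Real.arccos (Real.cos z.2)| ≤ |z.1 - z.2| :=
    abs_arccos_cos_sub_le _ _
  obtain ⟨s0, sπ, ssin, scos⟩ := hfold z.1 hz1.2
  obtain ⟨t0, tπ, tsin, tcos⟩ := hfold z.2 hz2.2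
  -- The estimate for `φ n` at the folded angles is uniform in `n`, so it passes to the limit.
  refine le_of_tendsto' ((ENNReal.continuous_ofReal.tendsto _).comp
    ((hz1.1.sub hz2.1).norm)) fun n => ?_
  have := hC _ (abs_nonneg _) (φ n) (hφ n) _ _ |z.1 - z.2| s0 sπ t0 tπ
    (abs_pos.2 (sub_ne_zero.2 hne)) hdist
  rw [(hφ n).congr_cos scos, (hφ n).congr_cos tcos, ssin, tsin] at this
  exact this
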